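/- Let $k$ be an algebraically closed field of characteristic $0$, let $G$ be a finite group with identity $e$, and let $\mathcal C$ be a fusion category over $k$ with a faithful $G$-grading $\mathcal C=\bigoplus_{g\in G}\mathcal C_g$ (so $\mathcal C_g\otimes\mathcal C_h\subset\mathcal C_{gh}$ and $\mathcal C_g\neq 0$ for all $g,h\in G$), with trivial component $\mathcal D=\mathcal C_e$. Let $\mathcal Z_{\mathcal D}(\mathcal C)$ be the relative center. Its objects are pairs $(Y,\gamma)$ with $Y\in\mathcal C$ and $\gamma=\{\gamma_V: V\otimes Y\xrightarrow{\sim}Y\otimes V\}_{V\in\mathcal D}$ a natural family of isomorphisms compatible with the tensor product of $\mathcal D$. Its morphisms are the morphisms of $\mathcal C$ compatible with the families $\gamma$, and $(Y,\gamma)\otimes(Y',\gamma')$ is $Y\otimes Y'$ with the composite of $\gamma_V\otimes \mathrm{id}$ and $\mathrm{id}\otimes\gamma'_V$. Let $\mathcal Z(\mathcal C)=\mathcal Z_{\mathcal C}(\mathcal C)$ be the Drinfeld center, with braiding $(X,\gamma)\otimes(Y,\delta)\to(Y,\delta)\otimes(X,\gamma)$ given by $\delta_X$. A canonical braided $G$-crossed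 structure on $\mathcal Z_{\mathcal D}(\mathcal C)$ consists of: the grading in which $(Y,\gamma)$ has degree $g$ if $Y\in\mathcal C_g$; an action $g\mapsto T_g$ of $G$ by $k$-linear tensor functors with $T_g(\mathcal Z_{\mathcal D}(\mathcal C_h))\subset\mathcal Z_{\mathcal D}(\mathcal C_{ghg^{-1}})$; and isomorphisms $$b_{X,Y}: X\otimes Y\xrightarrow{\sim}T_g(Y)\otimes X,\qquad X\in\mathcal C_g,\ Y\in\mathcal Z_{\mathcal D}(\mathcal C),\ g\in G,$$ natural in $X$ and $Y$ and, for fixed $Y$, isomorphisms of $\mathcal D$-bimodule functors $(-\otimes Y)\cong(T_g(Y)\otimes -)$ on $\mathcal C_g$, such that the tensor structure of each $T_g$ and the isomorphisms $T_gT_h\cong T_{gh}$ are those induced by $b$ (via $b_{X,Y\otimes Y'}$ and $b_{X\otimes X',Y}$ respectively), and such that the maps $b_{X,Y}$ with $X\in\mathcal Z_{\mathcal D}(\mathcal C_g)$ form a $G$-braiding on $\mathcal Z_{\mathcal D}(\mathcal C)$. Then such a canonical structure exists. Moreover, for every such structure, let the equivariantization $\mathcal Z_{\mathcal D}(\mathcal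 C)^G$ carry the induced braiding, i.e. for equivariant objects $(X,u)$ and $(Y,v)$ with $X=\bigoplus_{g} X_g$, the direct sum over $g\in G$ of the composites $$X_g\otimes Y\xrightarrow{b_{X_g,Y}}T_g(Y)\otimes X_g\xrightarrow{v_g\otimes\mathrm{id}}Y\otimes X_g .$$ Then there is an equivalence of braided fusion categories, that is, a $k$-linear braided monoidal equivalence, $$\mathcal Z_{\mathcal D}(\mathcal C)^G\xrightarrow{\ \sim\ }\mathcal Z(\mathcal C).$$ -/

import Mathlib

open CategoryTheory MonoidalCategory Limits

universe v u w

namespace GradedCenter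

section Fusion

/-- A `k`-linear abelian monoidal category (with bilinear tensor product; rigidity is the separate
Mathlib class `RigidCategory`) is fusion if its Hom spaces are finite-dimensional, every object is
a finite direct sum of simple objects, there are finitely many isomorphism classes of simple
objects, and the unit object is simple. -/
class IsFusionCategory (k : Type w) [Field k] (C : Type u) [Category.{v} C] [Abelian C]
    [Linear k C] [MonoidalCategory C] : Prop where
  finite_hom : ∀ X Y : C, FiniteDimensional k (X ⟶ Y)
  semisimple : ∀ X : C, ∃ (n : ℕ) (S : Fin n → C), (∀ i, Simple (S i)) ∧ ∃ b : Bicone S, Nonempty b.IsBilimit ∧ Nonempty (b.pt ≅ X)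
  finite_simples : ∃ (n : ℕ) (S : Fin n → C), ∀ X : C, Simple X → ∃ i, Nonempty (X ≅ S i)
  simple_unit : Simple (𝟙_ C)

end Fusion

section RelCenter

variable {C : Type u} [Category.{v} C] [MonoidalCategory C]

/-- Objects of the relative center of `C` with respect to the full subcategory `D` of `C` given by
the property `P` (in the application, a fusion subcategory): pairs `(X, γ)` of an object `X` of `C`
and a central structure `γ`, that is, a family of isomorphisms `γ_V : V ⊗ X ≅ X ⊗ V`, natural in
`V ∈ D` and compatible with tensor products of objects of `D`. -/
structure RelCenter (P : ObjectProperty C) where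
  pt : C
  γ : ∀ V : C, P V → (V ⊗ pt ≅ pt ⊗ V)
  naturality : ∀ {V W : C} (hV : P V) (hW : P W) (f : V ⟶ W),
    f ▷ pt ≫ (γ W hW).hom = (γ V hV).hom ≫ pt ◁ f
  monoidal : ∀ (V W : C) (hV : P V) (hW : P W) (hVW : P (V ⊗ W)),
    (γ (V ⊗ W) hVW).hom = (α_ V W pt).hom ≫ V ◁ (γ W hW).hom ≫ (α_ V pt W).inv ≫
      (γ V hV).hom ▷ W ≫ (α_ pt V W).hom

namespace RelCenter

variable {P : ObjectProperty C}

/-- Morphisms of the relative center: morphisms of `C` compatible with the central structures. -/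
@[ext]
structure Hom (X Y : RelCenter P) where
  f : X.pt ⟶ Y.pt
  comm : ∀ (V : C) (hV : P V), (X.γ V hV).hom ≫ f ▷ V = V ◁ f ≫ (Y.γ V hV).hom

instance : Category (RelCenter P) where
  Hom X Y := Hom X Y
  id X := { f := 𝟙 X.pt, comm := by simp }
  comp f g :=
    { f := f.f ≫ g.f
      comm := fun V hV => by simp [reassoc_of% (f.comm V hV), g.comm V hV] }

@[ext]
theorem hom_ext {X Y : RelCenter P} {f g : X ⟶ Y} (h : f.f = g.f) : f = g := Hom.ext h

@[simp] theorem id_f (X : RelCenter P) : Hom.f (𝟙 X) = 𝟙 X.pt := rfl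

@[simp] theorem comp_f {X Y Z : RelCenter P} (f : X ⟶ Y) (g : Y ⟶ Z) :
    (f ≫ g).f = f.f ≫ g.f := rfl

/-- An isomorphism in `C` compatible with the central structures. -/
@[reducible] def isoMk {X Y : RelCenter P} (e : X.pt ≅ Y.pt)
    (comm : ∀ (V : C) (hV : P V), (X.γ V hV).hom ≫ e.hom ▷ V = V ◁ e.hom ≫ (Y.γ V hV).hom) :
    X ≅ Y where
  hom := { f := e.hom, comm := comm }
  inv :=
    { f := e.inv
      comm := fun V hV => by
        rw [← cancel_epi (V ◁ e.hom), ← reassoc_of% (comm V hV), ← comp_whiskerRight,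
          ← whiskerLeft_comp_assoc]
        simp }

/-- The tensor product of objects of the relative center, with the composite central structure
`V ⊗ (X ⊗ Y) ≅ (V ⊗ X) ⊗ Y ≅ (X ⊗ V) ⊗ Y ≅ X ⊗ (V ⊗ Y) ≅ X ⊗ (Y ⊗ V) ≅ (X ⊗ Y) ⊗ V`. -/
@[reducible] def tensorObj (X Y : RelCenter P) : RelCenter P where
  pt := X.pt ⊗ Y.pt
  γ V hV := (α_ V X.pt Y.pt).symm ≪≫ whiskerRightIso (X.γ V hV) Y.pt ≪≫ α_ X.pt V Y.pt ≪≫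
    whiskerLeftIso X.pt (Y.γ V hV) ≪≫ (α_ X.pt Y.pt V).symm
  naturality {V W} hV hW f := by
    simp only [Iso.trans_hom, Iso.symm_hom, whiskerRightIso_hom, whiskerLeftIso_hom,
      Category.assoc]
    calc
      _ = 𝟙 _ ⊗≫ (f ▷ X.pt ≫ (X.γ W hW).hom) ▷ Y.pt ⊗≫ X.pt ◁ (Y.γ W hW).hom ⊗≫ 𝟙 _ := by
        monoidal
      _ = 𝟙 _ ⊗≫ (X.γ V hV).hom ▷ Y.pt ⊗≫ X.pt ◁ (f ▷ Y.pt ≫ (Y.γ W hW).hom) ⊗≫ 𝟙 _ := by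
        rw [X.naturality hV hW]; monoidal
      _ = _ := by rw [Y.naturality hV hW]; monoidal
  monoidal V W hV hW hVW := by
    simp only [Iso.trans_hom, Iso.symm_hom, whiskerRightIso_hom, whiskerLeftIso_hom]
    rw [X.monoidal V W hV hW hVW, Y.monoidal V W hV hW hVW]
    calc
      _ = 𝟙 _ ⊗≫ V ◁ (X.γ W hW).hom ▷ Y.pt ⊗≫ ((X.γ V hV).hom ▷ (W ⊗ Y.pt) ≫
            (X.pt ⊗ V) ◁ (Y.γ W hW).hom) ⊗≫ X.pt ◁ (Y.γ V hV).hom ▷ W ⊗≫ 𝟙 _ := by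
        monoidal
      _ = _ := by rw [← whisker_exchange]; monoidal

/-- The unit object, with the central structure given by the unit constraints. -/
@[reducible] def tensorUnit : RelCenter P where
  pt := 𝟙_ C
  γ V _ := ρ_ V ≪≫ (λ_ V).symm
  naturality _ _ f := by simp
  monoidal V W _ _ _ := by simp

theorem whiskerLeft_aux {A B B' V : C} (a : V ⊗ A ≅ A ⊗ V) (b : V ⊗ B ≅ B ⊗ V)
    (b' : V ⊗ B' ≅ B' ⊗ V) (f : B ⟶ B') (h : b.hom ≫ f ▷ V = V ◁ f ≫ b'.hom) :
    ((α_ V A B).inv ≫ a.hom ▷ B ≫ (α_ A V B).hom ≫ A ◁ b.hom ≫ (α_ A B V).inv) ≫ (A ◁ f) ▷ V =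
      V ◁ A ◁ f ≫ (α_ V A B').inv ≫ a.hom ▷ B' ≫ (α_ A V B').hom ≫ A ◁ b'.hom ≫
        (α_ A B' V).inv := by
  calc
    _ = 𝟙 _ ⊗≫ a.hom ▷ B ⊗≫ A ◁ (b.hom ≫ f ▷ V) ⊗≫ 𝟙 _ := by monoidal
    _ = 𝟙 _ ⊗≫ (a.hom ▷ B ≫ (A ⊗ V) ◁ f) ⊗≫ A ◁ b'.hom ⊗≫ 𝟙 _ := by rw [h]; monoidal
    _ = _ := by rw [← whisker_exchange]; monoidal

theorem whiskerRight_aux {A A' B V : C} (a : V ⊗ A ≅ A ⊗ V) (a' : V ⊗ A' ≅ A' ⊗ V)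
    (b : V ⊗ B ≅ B ⊗ V) (f : A ⟶ A') (h : a.hom ≫ f ▷ V = V ◁ f ≫ a'.hom) :
    ((α_ V A B).inv ≫ a.hom ▷ B ≫ (α_ A V B).hom ≫ A ◁ b.hom ≫ (α_ A B V).inv) ≫ (f ▷ B) ▷ V =
      V ◁ f ▷ B ≫ (α_ V A' B).inv ≫ a'.hom ▷ B ≫ (α_ A' V B).hom ≫ A' ◁ b.hom ≫
        (α_ A' B V).inv := by
  calc
    _ = 𝟙 _ ⊗≫ a.hom ▷ B ⊗≫ (A ◁ b.hom ≫ f ▷ (B ⊗ V)) ⊗≫ 𝟙 _ := by monoidal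
    _ = 𝟙 _ ⊗≫ (a.hom ≫ f ▷ V) ▷ B ⊗≫ A' ◁ b.hom ⊗≫ 𝟙 _ := by rw [whisker_exchange]; monoidal
    _ = _ := by rw [h]; monoidal

@[reducible] def whiskerLeft (X : RelCenter P) {Y Z : RelCenter P} (f : Y ⟶ Z) :
    tensorObj X Y ⟶ tensorObj X Z where
  f := X.pt ◁ f.f
  comm V hV := whiskerLeft_aux _ _ _ f.f (f.comm V hV)

@[reducible] def whiskerRight {X Y : RelCenter P} (f : X ⟶ Y) (Z : RelCenter P) :
    tensorObj X Z ⟶ tensorObj Y Z where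
  f := f.f ▷ Z.pt
  comm V hV := whiskerRight_aux _ _ _ f.f (f.comm V hV)

@[reducible] def associator (X Y Z : RelCenter P) :
    tensorObj (tensorObj X Y) Z ≅ tensorObj X (tensorObj Y Z) :=
  isoMk (α_ X.pt Y.pt Z.pt) (fun V hV => by dsimp only [tensorObj, tensorUnit]; simp)

@[reducible] def leftUnitor (X : RelCenter P) : tensorObj tensorUnit X ≅ X :=
  isoMk (λ_ X.pt) (fun V hV => by dsimp only [tensorObj, tensorUnit]; simp)

@[reducible] def rightUnitor (X : RelCenter P) : tensorObj X tensorUnit ≅ X :=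
  isoMk (ρ_ X.pt) (fun V hV => by dsimp only [tensorObj, tensorUnit]; simp)

instance : MonoidalCategory (RelCenter P) where
  tensorObj := tensorObj
  whiskerLeft X _ _ f := whiskerLeft X f
  whiskerRight f Z := whiskerRight f Z
  tensorHom f g := whiskerRight f _ ≫ whiskerLeft _ g
  tensorUnit := tensorUnit
  associator := associator
  leftUnitor := leftUnitor
  rightUnitor := rightUnitor
  tensorHom_def _ _ := rfl
  id_tensorHom_id _ _ := by ext; dsimp [isoMk]; simp
  tensorHom_comp_tensorHom _ _ _ _ := by ext; dsimp [isoMk]; simp [whisker_exchange_assoc]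
  whiskerLeft_id _ _ := by ext; dsimp [isoMk]; simp
  id_whiskerRight _ _ := by ext; dsimp [isoMk]; simp
  associator_naturality _ _ _ := by ext; dsimp [isoMk]; simp
  leftUnitor_naturality _ := by ext; dsimp [isoMk]; simp
  rightUnitor_naturality _ := by ext; dsimp [isoMk]; simp
  pentagon _ _ _ _ := by ext; dsimp [isoMk]; simp
  triangle _ _ := by ext; dsimp [isoMk]; simp


@[simp] theorem tensorObj_pt (X Y : RelCenter P) : (X ⊗ Y).pt = X.pt ⊗ Y.pt := rfl
theorem tensorObj_γ_hom (X Y : RelCenter P) (V : C) (hV : P V) :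
    ((X ⊗ Y).γ V hV).hom = (α_ V X.pt Y.pt).inv ≫ (X.γ V hV).hom ▷ Y.pt ≫
      (α_ X.pt V Y.pt).hom ≫ X.pt ◁ (Y.γ V hV).hom ≫ (α_ X.pt Y.pt V).inv := rfl
@[simp] theorem tensorUnit_pt : (𝟙_ (RelCenter P)).pt = 𝟙_ C := rfl
@[simp] theorem whiskerLeft_f (X : RelCenter P) {Y Z : RelCenter P} (f : Y ⟶ Z) :
    (X ◁ f).f = X.pt ◁ f.f := rfl
@[simp] theorem whiskerRight_f {X Y : RelCenter P} (f : X ⟶ Y) (Z : RelCenter P) :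
    (f ▷ Z).f = f.f ▷ Z.pt := rfl
@[simp] theorem associator_hom_f (X Y Z : RelCenter P) :
    (α_ X Y Z).hom.f = (α_ X.pt Y.pt Z.pt).hom := rfl
@[simp] theorem associator_inv_f (X Y Z : RelCenter P) :
    (α_ X Y Z).inv.f = (α_ X.pt Y.pt Z.pt).inv := rfl

section Linear

variable [Preadditive C] [MonoidalPreadditive C]

instance (X Y : RelCenter P) : Zero (X ⟶ Y) :=
  ⟨{ f := 0, comm := by simp }⟩
instance (X Y : RelCenter P) : Add (X ⟶ Y) :=
  ⟨fun f g => { f := f.f + g.f, comm := fun V hV => by simp [Hom.comm] }⟩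
theorem neg_comm {X Y : RelCenter P} (f : X ⟶ Y) (V : C) (hV : P V) :
    (X.γ V hV).hom ≫ (-f.f) ▷ V = V ◁ (-f.f) ≫ (Y.γ V hV).hom := by
  have h₁ : (-f.f) ▷ V = -(f.f ▷ V) := (tensorRight V).map_neg
  have h₂ : V ◁ (-f.f) = -(V ◁ f.f) := (tensorLeft V).map_neg
  rw [h₁, h₂, Preadditive.comp_neg, Preadditive.neg_comp, f.comm]

instance (X Y : RelCenter P) : Neg (X ⟶ Y) :=
  ⟨fun f => { f := -f.f, comm := neg_comm f }⟩

instance : Preadditive (RelCenter P) where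
  homGroup X Y :=
    { add_assoc f g h := by apply hom_ext; exact add_assoc _ _ _
      zero_add f := by apply hom_ext; exact zero_add _
      add_zero f := by apply hom_ext; exact add_zero _
      add_comm f g := by apply hom_ext; exact add_comm _ _
      neg_add_cancel f := by apply hom_ext; exact neg_add_cancel _
      nsmul := nsmulRec
      zsmul := zsmulRec }
  add_comp _ _ _ f f' g := by apply hom_ext; exact Preadditive.add_comp _ _ _ _ _ _
  comp_add _ _ _ f g g' := by apply hom_ext; exact Preadditive.comp_add _ _ _ _ _ _

@[simp] theorem zero_f (X Y : RelCenter P) : Hom.f (0 : X ⟶ Y) = 0 := rfl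
@[simp] theorem add_f {X Y : RelCenter P} (f g : X ⟶ Y) : (f + g).f = f.f + g.f := rfl

instance : MonoidalPreadditive (RelCenter P) where
  whiskerLeft_zero := by intros; apply hom_ext; exact MonoidalPreadditive.whiskerLeft_zero
  zero_whiskerRight := by intros; apply hom_ext; exact MonoidalPreadditive.zero_whiskerRight
  whiskerLeft_add _ _ := by apply hom_ext; exact MonoidalPreadditive.whiskerLeft_add _ _
  add_whiskerRight _ _ := by apply hom_ext; exact MonoidalPreadditive.add_whiskerRight _ _

variable (k : Type w) [Field k] [Linear k C] [MonoidalLinear k C]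

instance (X Y : RelCenter P) : SMul k (X ⟶ Y) :=
  ⟨fun r f => { f := r • f.f, comm := fun V hV => by simp [Hom.comm] }⟩

instance : Linear k (RelCenter P) where
  homModule X Y :=
    { one_smul f := by apply hom_ext; exact one_smul _ _
      mul_smul r s f := by apply hom_ext; exact mul_smul _ _ _
      smul_zero r := by apply hom_ext; exact smul_zero _
      smul_add r f g := by apply hom_ext; exact smul_add _ _ _
      add_smul r s f := by apply hom_ext; exact add_smul _ _ _
      zero_smul f := by apply hom_ext; exact zero_smul _ _ }
  smul_comp _ _ _ r f g := by apply hom_ext; exact Linear.smul_comp _ _ _ _ _ _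
  comp_smul _ _ _ f r g := by apply hom_ext; exact Linear.comp_smul _ _ _ _ _ _

instance : MonoidalLinear k (RelCenter P) where
  whiskerLeft_smul _ _ _ _ _ := by apply hom_ext; exact MonoidalLinear.whiskerLeft_smul _ _ _
  smul_whiskerRight _ _ _ _ _ := by apply hom_ext; exact MonoidalLinear.smul_whiskerRight _ _ _

end Linear

end RelCenter

/-- The Drinfeld center `Z(C)`: the relative center of `C` with respect to `C` itself. (Mathlib has
`CategoryTheory.Center`, whose half-braidings are the inverses `X ⊗ V ≅ V ⊗ X` of the central
structures used here, and whose braiding corresponds to the reverse of the one below.) -/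
abbrev DrinfeldCenter (C : Type u) [Category.{v} C] [MonoidalCategory C] :=
  RelCenter (⊤ : ObjectProperty C)

namespace DrinfeldCenter

/-- The braiding `X ⊗ Y ≅ Y ⊗ X` of the Drinfeld center: the central structure of `Y` evaluated
at `X`. -/
@[reducible] def braiding (X Y : DrinfeldCenter C) : X ⊗ Y ≅ Y ⊗ X :=
  RelCenter.isoMk (Y.γ X.pt trivial) (fun V hV => by
    have h := Y.naturality (V := V ⊗ X.pt) (W := X.pt ⊗ V) trivial trivial (X.γ V hV).hom
    rw [Y.monoidal V X.pt hV trivial trivial, Y.monoidal X.pt V trivial hV trivial] at h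
    have h' := congrArg (fun t => (α_ V X.pt Y.pt).inv ≫ t ≫ (α_ Y.pt X.pt V).inv) h
    rw [RelCenter.tensorObj_γ_hom, RelCenter.tensorObj_γ_hom]
    simpa using h')

instance : BraidedCategory (DrinfeldCenter C) where
  braiding := braiding
  braiding_naturality_right X Y Z f := by
    apply RelCenter.hom_ext; exact (f.comm _ _).symm
  braiding_naturality_left f Z := by
    apply RelCenter.hom_ext; exact Z.naturality _ _ _
  hexagon_forward X Y Z := by
    apply RelCenter.hom_ext; dsimp [RelCenter.isoMk]; rw [RelCenter.tensorObj_γ_hom]; simp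
  hexagon_reverse X Y Z := by
    apply RelCenter.hom_ext
    have h := Z.monoidal X.pt Y.pt trivial trivial trivial
    dsimp [RelCenter.isoMk]
    rw [h]; simp

@[simp] theorem braiding_hom_f (X Y : DrinfeldCenter C) : (β_ X Y).hom.f = (Y.γ X.pt trivial).hom := rfl

end DrinfeldCenter
end RelCenter

section Equivariantization

open Functor.LaxMonoidal Functor.OplaxMonoidal

/-- An action of `G` on a `k`-linear monoidal category `E` by `k`-linear monoidal functors, i.e. a
monoidal functor `g ↦ T g` from the discrete monoidal category `G` to the category of such functors
and monoidal natural transformations. The structure isomorphisms `T g ∘ T h ≅ T (g * h)` are indexed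
by the equations `g * h = l`, to avoid transports. Each `T g` is automatically an equivalence. -/
structure GroupAction (k : Type*) [Field k] (G : Type*) [Group G] (E : Type u) [Category.{v} E]
    [Preadditive E] [Linear k E] [MonoidalCategory E] where
  T : G → E ⥤ E
  additive : ∀ g, (T g).Additive
  linear : ∀ g, (T g).Linear k
  monoidal : ∀ g, (T g).Monoidal
  γ : ∀ {g h l : G}, g * h = l → (T h ⋙ T g ≅ T l)
  ι : T 1 ≅ 𝟭 E
  γ_monoidal : ∀ {g h l : G} (e : g * h = l), NatTrans.IsMonoidal (γ e).hom
  ι_monoidal : NatTrans.IsMonoidal ι.hom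
  assoc : ∀ {g h l a b c : G} (e₁ : g * h = a) (e₂ : h * l = b) (e₃ : a * l = c) (e₄ : g * b = c)
    (X : E), (γ e₁).hom.app ((T l).obj X) ≫ (γ e₃).hom.app X =
      (T g).map ((γ e₂).hom.app X) ≫ (γ e₄).hom.app X
  unit_left : ∀ (g : G) (X : E), (γ (one_mul g)).hom.app X = ι.hom.app ((T g).obj X)
  unit_right : ∀ (g : G) (X : E), (γ (mul_one g)).hom.app X = (T g).map (ι.hom.app X)

attribute [instance] GroupAction.additive GroupAction.linear GroupAction.monoidal
  GroupAction.γ_monoidal GroupAction.ι_monoidal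

variable {k : Type*} [Field k] {G : Type*} [Group G] {E : Type u} [Category.{v} E]
  [Preadditive E] [Linear k E] [MonoidalCategory E]

/-- A `G`-equivariant object: an object `X` with isomorphisms `u g : T g X ≅ X` satisfying
`u g ∘ T g (u h) = u (g * h) ∘ γ_{g,h}`. -/
structure Equivariantization (A : GroupAction k G E) where
  pt : E
  u : ∀ g : G, (A.T g).obj pt ≅ pt
  comm : ∀ {g h l : G} (e : g * h = l),
    (A.T g).map (u h).hom ≫ (u g).hom = (A.γ e).hom.app pt ≫ (u l).hom

namespace Equivariantization

variable {A : GroupAction k G E}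

/-- Morphisms of equivariant objects: morphisms of `E` commuting with the `u g`. -/
@[ext]
structure Hom (X Y : Equivariantization A) where
  f : X.pt ⟶ Y.pt
  comm : ∀ g : G, (X.u g).hom ≫ f = (A.T g).map f ≫ (Y.u g).hom

instance : Category (Equivariantization A) where
  Hom X Y := Hom X Y
  id X := { f := 𝟙 X.pt, comm := by simp }
  comp f g :=
    { f := f.f ≫ g.f
      comm := fun a => by simp [reassoc_of% (f.comm a), g.comm a] }

@[ext]
theorem hom_ext {X Y : Equivariantization A} {f g : X ⟶ Y} (h : f.f = g.f) : f = g := Hom.ext h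

@[simp] theorem id_f (X : Equivariantization A) : Hom.f (𝟙 X) = 𝟙 X.pt := rfl

@[simp] theorem comp_f {X Y Z : Equivariantization A} (f : X ⟶ Y) (g : Y ⟶ Z) :
    (f ≫ g).f = f.f ≫ g.f := rfl

@[reducible] def isoMk {X Y : Equivariantization A} (e : X.pt ≅ Y.pt)
    (comm : ∀ g : G, (X.u g).hom ≫ e.hom = (A.T g).map e.hom ≫ (Y.u g).hom) : X ≅ Y where
  hom := { f := e.hom, comm := comm }
  inv :=
    { f := e.inv
      comm := fun g => by
        rw [← cancel_epi ((A.T g).map e.hom), ← reassoc_of% (comm g), ← Functor.map_comp_assoc]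
        simp }

theorem γ_δ (A : GroupAction k G E) {g h l : G} (e : g * h = l) (X Y : E) :
    (A.γ e).hom.app (X ⊗ Y) ≫ δ (A.T l) X Y = (A.T g).map (δ (A.T h) X Y) ≫
      δ (A.T g) ((A.T h).obj X) ((A.T h).obj Y) ≫ ((A.γ e).hom.app X ⊗ₘ (A.γ e).hom.app Y) := by
  have h₁ := NatTrans.IsMonoidal.tensor (τ := (A.γ e).hom) X Y
  rw [Functor.LaxMonoidal.comp_μ, Category.assoc] at h₁
  rw [← cancel_epi ((A.T g).map (μ (A.T h) X Y)), ← cancel_epi (μ (A.T g) _ _),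
    reassoc_of% h₁]
  simp

/-- The tensor product of equivariant objects, with
`T g (X ⊗ Y) ≅ T g X ⊗ T g Y ≅ X ⊗ Y`. -/
@[reducible] def tensorObj (X Y : Equivariantization A) : Equivariantization A where
  pt := X.pt ⊗ Y.pt
  u g := (Functor.Monoidal.μIso (A.T g) X.pt Y.pt).symm ≪≫ (X.u g ⊗ᵢ Y.u g)
  comm {g h l} e := by
    simp only [Iso.trans_hom, Iso.symm_hom, Functor.Monoidal.μIso_inv, tensorIso_hom,
      Functor.map_comp, Category.assoc]
    rw [reassoc_of% (γ_δ A e), tensorHom_comp_tensorHom, ← X.comm e, ← Y.comm e,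
      ← tensorHom_comp_tensorHom, δ_natural_assoc]

@[reducible] def tensorUnit : Equivariantization A where
  pt := 𝟙_ E
  u g := (Functor.Monoidal.εIso (A.T g)).symm
  comm {g h l} e := by
    have h₁ := NatTrans.IsMonoidal.unit (τ := (A.γ e).hom)
    rw [Functor.LaxMonoidal.comp_ε, Category.assoc] at h₁
    simp only [Iso.symm_hom, Functor.Monoidal.εIso_inv]
    rw [← cancel_epi ((A.T g).map (ε (A.T h))), ← cancel_epi (ε (A.T g)), reassoc_of% h₁]
    simp

@[reducible] def whiskerLeft (X : Equivariantization A) {Y Z : Equivariantization A} (f : Y ⟶ Z) :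
    tensorObj X Y ⟶ tensorObj X Z where
  f := X.pt ◁ f.f
  comm g := by
    simp only [Iso.trans_hom, Iso.symm_hom, Functor.Monoidal.μIso_inv, tensorIso_hom,
      Category.assoc]
    rw [← δ_natural_right_assoc, ← id_tensorHom, tensorHom_comp_tensorHom, f.comm,
      ← id_tensorHom, tensorHom_comp_tensorHom]
    simp

@[reducible] def whiskerRight {X Y : Equivariantization A} (f : X ⟶ Y) (Z : Equivariantization A) :
    tensorObj X Z ⟶ tensorObj Y Z where
  f := f.f ▷ Z.pt
  comm g := by
    simp only [Iso.trans_hom, Iso.symm_hom, Functor.Monoidal.μIso_inv, tensorIso_hom,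
      Category.assoc]
    rw [← δ_natural_left_assoc, ← tensorHom_id, tensorHom_comp_tensorHom, f.comm,
      ← tensorHom_id, tensorHom_comp_tensorHom]
    simp

@[reducible] def associator (X Y Z : Equivariantization A) :
    tensorObj (tensorObj X Y) Z ≅ tensorObj X (tensorObj Y Z) :=
  isoMk (α_ X.pt Y.pt Z.pt) (fun g => by
    simp only [Iso.trans_hom, Iso.symm_hom, Functor.Monoidal.μIso_inv, tensorIso_hom,
      Category.assoc]
    have e₁ : ((δ (A.T g) X.pt Y.pt ≫ ((X.u g).hom ⊗ₘ (Y.u g).hom)) ⊗ₘ (Z.u g).hom) =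
        δ (A.T g) X.pt Y.pt ▷ (A.T g).obj Z.pt ≫
          (((X.u g).hom ⊗ₘ (Y.u g).hom) ⊗ₘ (Z.u g).hom) := by
      simp [MonoidalCategory.tensorHom_def]
    have e₂ : ((X.u g).hom ⊗ₘ (δ (A.T g) Y.pt Z.pt ≫ ((Y.u g).hom ⊗ₘ (Z.u g).hom))) =
        (A.T g).obj X.pt ◁ δ (A.T g) Y.pt Z.pt ≫
          ((X.u g).hom ⊗ₘ ((Y.u g).hom ⊗ₘ (Z.u g).hom)) := by
      simp [MonoidalCategory.tensorHom_def']
    rw [e₁, e₂, Category.assoc, MonoidalCategory.associator_naturality, 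
      ← Functor.OplaxMonoidal.associativity_assoc])

@[reducible] def leftUnitor (X : Equivariantization A) : tensorObj tensorUnit X ≅ X :=
  isoMk (λ_ X.pt) (fun g => by
    simp only [Iso.trans_hom, Iso.symm_hom, Functor.Monoidal.μIso_inv, tensorIso_hom,
      Functor.Monoidal.εIso_inv, Category.assoc]
    rw [← left_unitality_hom]
    simp [MonoidalCategory.tensorHom_def])

@[reducible] def rightUnitor (X : Equivariantization A) : tensorObj X tensorUnit ≅ X :=
  isoMk (ρ_ X.pt) (fun g => by
    simp only [Iso.trans_hom, Iso.symm_hom, Functor.Monoidal.μIso_inv, tensorIso_hom,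
      Functor.Monoidal.εIso_inv, Category.assoc]
    rw [← right_unitality_hom]
    simp [MonoidalCategory.tensorHom_def'])

instance : MonoidalCategory (Equivariantization A) where
  tensorObj := tensorObj
  whiskerLeft X _ _ f := whiskerLeft X f
  whiskerRight f Z := whiskerRight f Z
  tensorHom f g := whiskerRight f _ ≫ whiskerLeft _ g
  tensorUnit := tensorUnit
  associator := associator
  leftUnitor := leftUnitor
  rightUnitor := rightUnitor
  tensorHom_def _ _ := rfl
  id_tensorHom_id _ _ := by ext; dsimp [isoMk]; simp
  tensorHom_comp_tensorHom _ _ _ _ := by ext; dsimp [isoMk]; simp [whisker_exchange_assoc]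
  whiskerLeft_id _ _ := by ext; dsimp [isoMk]; simp
  id_whiskerRight _ _ := by ext; dsimp [isoMk]; simp
  associator_naturality _ _ _ := by ext; dsimp [isoMk]; simp
  leftUnitor_naturality _ := by ext; dsimp [isoMk]; simp
  rightUnitor_naturality _ := by ext; dsimp [isoMk]; simp
  pentagon _ _ _ _ := by ext; dsimp [isoMk]; simp
  triangle _ _ := by ext; dsimp [isoMk]; simp


@[simp] theorem tensorObj_pt (X Y : Equivariantization A) : (X ⊗ Y).pt = X.pt ⊗ Y.pt := rfl
theorem tensorObj_u_hom (X Y : Equivariantization A) (g : G) :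
    ((X ⊗ Y).u g).hom = δ (A.T g) X.pt Y.pt ≫ ((X.u g).hom ⊗ₘ (Y.u g).hom) := rfl
@[simp] theorem whiskerLeft_f (X : Equivariantization A) {Y Z : Equivariantization A}
    (f : Y ⟶ Z) : (X ◁ f).f = X.pt ◁ f.f := rfl
@[simp] theorem whiskerRight_f {X Y : Equivariantization A} (f : X ⟶ Y)
    (Z : Equivariantization A) : (f ▷ Z).f = f.f ▷ Z.pt := rfl
@[simp] theorem associator_hom_f (X Y Z : Equivariantization A) :
    (α_ X Y Z).hom.f = (α_ X.pt Y.pt Z.pt).hom := rfl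
@[simp] theorem associator_inv_f (X Y Z : Equivariantization A) :
    (α_ X Y Z).inv.f = (α_ X.pt Y.pt Z.pt).inv := rfl

instance (X Y : Equivariantization A) : Zero (X ⟶ Y) :=
  ⟨{ f := 0, comm := by simp }⟩
instance (X Y : Equivariantization A) : Add (X ⟶ Y) :=
  ⟨fun f g => { f := f.f + g.f, comm := fun a => by simp [Hom.comm, Functor.map_add] }⟩
instance (X Y : Equivariantization A) : Neg (X ⟶ Y) :=
  ⟨fun f => { f := -f.f, comm := fun a => by simp [Hom.comm, Functor.map_neg] }⟩

instance : Preadditive (Equivariantization A) where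
  homGroup X Y :=
    { add_assoc f g h := by apply hom_ext; exact add_assoc _ _ _
      zero_add f := by apply hom_ext; exact zero_add _
      add_zero f := by apply hom_ext; exact add_zero _
      add_comm f g := by apply hom_ext; exact add_comm _ _
      neg_add_cancel f := by apply hom_ext; exact neg_add_cancel _
      nsmul := nsmulRec
      zsmul := zsmulRec }
  add_comp _ _ _ f f' g := by apply hom_ext; exact Preadditive.add_comp _ _ _ _ _ _
  comp_add _ _ _ f g g' := by apply hom_ext; exact Preadditive.comp_add _ _ _ _ _ _

@[simp] theorem zero_f (X Y : Equivariantization A) : Hom.f (0 : X ⟶ Y) = 0 := rfl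
@[simp] theorem add_f {X Y : Equivariantization A} (f g : X ⟶ Y) :
    (f + g).f = f.f + g.f := rfl

instance (X Y : Equivariantization A) : SMul k (X ⟶ Y) :=
  ⟨fun r f => { f := r • f.f, comm := fun a => by simp [Hom.comm, Functor.map_smul] }⟩

instance : Linear k (Equivariantization A) where
  homModule X Y :=
    { one_smul f := by apply hom_ext; exact one_smul _ _
      mul_smul r s f := by apply hom_ext; exact mul_smul _ _ _
      smul_zero r := by apply hom_ext; exact smul_zero _
      smul_add r f g := by apply hom_ext; exact smul_add _ _ _
      add_smul r s f := by apply hom_ext; exact add_smul _ _ _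
      zero_smul f := by apply hom_ext; exact zero_smul _ _ }
  smul_comp _ _ _ r f g := by apply hom_ext; exact Linear.smul_comp _ _ _ _ _ _
  comp_smul _ _ _ f r g := by apply hom_ext; exact Linear.comp_smul _ _ _ _ _ _

end Equivariantization
end Equivariantization

section GCrossed

open Functor.LaxMonoidal Functor.OplaxMonoidal

/-- A decomposition of `X` as a direct sum of homogeneous objects, one for each degree. (The
relations `i g ≫ p h = 0` for `g ≠ h` follow from the vanishing of morphisms between objects of
different degrees in a grading.) -/
structure Decomposition {G : Type*} [Fintype G] {E : Type u} [Category.{v} E] [Preadditive E]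
    (deg : G → ObjectProperty E) (X : E) where
  comp : G → E
  deg_comp : ∀ g, deg g (comp g)
  p : ∀ g, X ⟶ comp g
  i : ∀ g, comp g ⟶ X
  i_p : ∀ g, i g ≫ p g = 𝟙 (comp g)
  sum_p_i : ∑ g, p g ≫ i g = 𝟙 X

namespace Decomposition

variable {G : Type*} [Fintype G] {E : Type u} [Category.{v} E] [Preadditive E]
  {deg : G → ObjectProperty E} {X : E}

theorem hom_ext_functor (D : Decomposition deg X) (F : E ⥤ E) [F.Additive] {W : E} {a b : F.obj X ⟶ W}
    (H : ∀ {g : G} {Z : E} (_ : deg g Z) (f : Z ⟶ X), F.map f ≫ a = F.map f ≫ b) : a = b := by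
  rw [← Category.id_comp a, ← Category.id_comp b, ← F.map_id, ← D.sum_p_i, F.map_sum,
    Preadditive.sum_comp, Preadditive.sum_comp]
  refine Finset.sum_congr rfl fun g _ => ?_
  rw [F.map_comp, Category.assoc, Category.assoc, H (D.deg_comp g)]

variable [MonoidalCategory E] [MonoidalPreadditive E]

theorem hom_ext_right (D : Decomposition deg X) {Y W : E} {a b : X ⊗ Y ⟶ W}
    (H : ∀ {g : G} {Z : E} (_ : deg g Z) (f : Z ⟶ X), f ▷ Y ≫ a = f ▷ Y ≫ b) : a = b :=
  D.hom_ext_functor (tensorRight Y) H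

theorem hom_ext_left (D : Decomposition deg X) {Y W : E} {a b : Y ⊗ X ⟶ W}
    (H : ∀ {g : G} {Z : E} (_ : deg g Z) (f : Z ⟶ X), Y ◁ f ≫ a = Y ◁ f ≫ b) : a = b :=
  D.hom_ext_functor (tensorLeft Y) H

end Decomposition

/-- The full subcategories `deg g` of `E` form a `G`-grading of `E`: `E` is their direct sum, and
the tensor product maps `deg g × deg h` to `deg (g * h)`. Not necessarily faithful. -/
structure IsGrading {G : Type*} [Group G] [Fintype G] {E : Type u} [Category.{v} E]
    [Preadditive E] [MonoidalCategory E] (deg : G → ObjectProperty E) : Prop where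
  of_iso : ∀ {g : G} {X Y : E}, (X ≅ Y) → deg g X → deg g Y
  hom_eq_zero : ∀ {g h : G}, g ≠ h → ∀ {X Y : E}, deg g X → deg h Y → ∀ f : X ⟶ Y, f = 0
  decomposition : ∀ X : E, Nonempty (Decomposition deg X)
  tensor : ∀ {g h : G} {X Y : E}, deg g X → deg h Y → deg (g * h) (X ⊗ Y)

/-- A braided `G`-crossed structure on `E` with the prescribed homogeneous subcategories `deg g`:
these form a grading, `G` acts on `E` with `T g` mapping degree `h` to degree `g * h * g⁻¹`, and
there is a `G`-braiding `c : X ⊗ Y ≅ T g Y ⊗ X`, for `X` of degree `g`, which is natural, compatible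
with the action (`c_T`) and with tensor products in both variables. -/
structure BraidedGCrossed (k : Type*) [Field k] {G : Type*} [Group G] [Fintype G] {E : Type u}
    [Category.{v} E] [Preadditive E] [Linear k E] [MonoidalCategory E]
    (deg : G → ObjectProperty E) extends GroupAction k G E where
  grading : IsGrading deg
  deg_T : ∀ (g : G) {h : G} {X : E}, deg h X → deg (g * h * g⁻¹) ((T g).obj X)
  c : ∀ {g : G} (X Y : E), deg g X → (X ⊗ Y ≅ (T g).obj Y ⊗ X)
  c_naturality_left : ∀ {g : G} {X X' : E} (hX : deg g X) (hX' : deg g X') (f : X ⟶ X') (Y : E),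
    f ▷ Y ≫ (c X' Y hX').hom = (c X Y hX).hom ≫ (T g).obj Y ◁ f
  c_naturality_right : ∀ {g : G} (X : E) (hX : deg g X) {Y Y' : E} (f : Y ⟶ Y'),
    X ◁ f ≫ (c X Y' hX).hom = (c X Y hX).hom ≫ (T g).map f ▷ X
  c_T : ∀ {g h : G} (X Y : E) (hX : deg h X),
    (c ((T g).obj X) ((T g).obj Y) (deg_T g hX)).hom ≫
        (γ (inv_mul_cancel_right (g * h) g)).hom.app Y ▷ (T g).obj X =
      μ (T g) X Y ≫ (T g).map (c X Y hX).hom ≫ δ (T g) ((T h).obj Y) X ≫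
        (γ (rfl : g * h = g * h)).hom.app Y ▷ (T g).obj X
  c_tensor_right : ∀ {g : G} (X Y Z : E) (hX : deg g X),
    (α_ X Y Z).hom ≫ (c X (Y ⊗ Z) hX).hom ≫ δ (T g) Y Z ▷ X ≫
        (α_ ((T g).obj Y) ((T g).obj Z) X).hom =
      (c X Y hX).hom ▷ Z ≫ (α_ ((T g).obj Y) X Z).hom ≫ (T g).obj Y ◁ (c X Z hX).hom
  c_tensor_left : ∀ {g h : G} (X Y Z : E) (hX : deg g X) (hY : deg h Y),
    (c (X ⊗ Y) Z (grading.tensor hX hY)).hom =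
      (α_ X Y Z).hom ≫ X ◁ (c Y Z hY).hom ≫ (α_ X ((T h).obj Z) Y).inv ≫
        (c X ((T h).obj Z) hX).hom ▷ Y ≫ (α_ ((T g).obj ((T h).obj Z)) X Y).hom ≫
          (γ (rfl : g * h = g * h)).hom.app Z ▷ (X ⊗ Y)

namespace BraidedGCrossed

variable {k : Type*} [Field k] {G : Type*} [Group G] [Fintype G] {E : Type u}
  [Category.{v} E] [Preadditive E] [Linear k E] [MonoidalCategory E]
  {deg : G → ObjectProperty E} (S : BraidedGCrossed k deg)

/-- A chosen decomposition into homogeneous components. -/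
noncomputable def decomp (X : E) : Decomposition deg X := (S.grading.decomposition X).some

theorem comp_p_i {X Z : E} {g : G} (hZ : deg g Z) (f : Z ⟶ X) :
    f ≫ (S.decomp X).p g ≫ (S.decomp X).i g = f := by
  conv_rhs => rw [← Category.comp_id f, ← (S.decomp X).sum_p_i, Preadditive.comp_sum]
  rw [Finset.sum_eq_single g]
  · intro h _ hh
    rw [← Category.assoc, S.grading.hom_eq_zero (Ne.symm hh) hZ ((S.decomp X).deg_comp h)
      (f ≫ (S.decomp X).p h), zero_comp]
  · simp

variable [MonoidalPreadditive E]

/-- The braiding of the equivariantization: the sum over `g` of the maps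
`X_g ⊗ Y ⟶ T g Y ⊗ X_g ⟶ Y ⊗ X_g` given by the `G`-braiding and the equivariant structure of `Y`. -/
noncomputable def braidHom (X : E) (Y : Equivariantization S.toGroupAction) :
    X ⊗ Y.pt ⟶ Y.pt ⊗ X :=
  ∑ g, (S.decomp X).p g ▷ Y.pt ≫ (S.c ((S.decomp X).comp g) Y.pt ((S.decomp X).deg_comp g)).hom ≫
    (Y.u g).hom ▷ (S.decomp X).comp g ≫ Y.pt ◁ (S.decomp X).i g

/-- The inverse of `braidHom`. -/
noncomputable def braidInv (X : E) (Y : Equivariantization S.toGroupAction) :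
    Y.pt ⊗ X ⟶ X ⊗ Y.pt :=
  ∑ g, Y.pt ◁ (S.decomp X).p g ≫ (Y.u g).inv ▷ (S.decomp X).comp g ≫
    (S.c ((S.decomp X).comp g) Y.pt ((S.decomp X).deg_comp g)).inv ≫ (S.decomp X).i g ▷ Y.pt

theorem comp_braidHom {X Z : E} {g : G} (hZ : deg g Z) (f : Z ⟶ X)
    (Y : Equivariantization S.toGroupAction) :
    f ▷ Y.pt ≫ S.braidHom X Y = (S.c Z Y.pt hZ).hom ≫ (Y.u g).hom ▷ Z ≫ Y.pt ◁ f := by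
  rw [braidHom, Preadditive.comp_sum, Finset.sum_eq_single g]
  · rw [← comp_whiskerRight_assoc, reassoc_of% (S.c_naturality_left hZ ((S.decomp X).deg_comp g)), whisker_exchange_assoc,
      ← MonoidalCategory.whiskerLeft_comp, Category.assoc, S.comp_p_i hZ]
  · intro h _ hh
    rw [← comp_whiskerRight_assoc, S.grading.hom_eq_zero (Ne.symm hh) hZ
      ((S.decomp X).deg_comp h) (f ≫ (S.decomp X).p h)]
    simp
  · simp

theorem comp_braidInv {X Z : E} {g : G} (hZ : deg g Z) (f : Z ⟶ X)
    (Y : Equivariantization S.toGroupAction) :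
    Y.pt ◁ f ≫ S.braidInv X Y = (Y.u g).inv ▷ Z ≫ (S.c Z Y.pt hZ).inv ≫ f ▷ Y.pt := by
  rw [braidInv, Preadditive.comp_sum, Finset.sum_eq_single g]
  · have h := S.c_naturality_left hZ ((S.decomp X).deg_comp g) (f ≫ (S.decomp X).p g) Y.pt
    rw [← Iso.inv_comp_eq, ← Category.assoc, ← Iso.eq_comp_inv] at h
    rw [← MonoidalCategory.whiskerLeft_comp_assoc, whisker_exchange_assoc, ← reassoc_of% h,
      ← comp_whiskerRight, Category.assoc, S.comp_p_i hZ]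
  · intro h _ hh
    rw [← MonoidalCategory.whiskerLeft_comp_assoc, S.grading.hom_eq_zero (Ne.symm hh) hZ
      ((S.decomp X).deg_comp h) (f ≫ (S.decomp X).p h)]
    simp
  · simp

@[simps] noncomputable def braidIso (X : E) (Y : Equivariantization S.toGroupAction) :
    X ⊗ Y.pt ≅ Y.pt ⊗ X where
  hom := S.braidHom X Y
  inv := S.braidInv X Y
  hom_inv_id := (S.decomp X).hom_ext_right fun hZ f => by
    rw [reassoc_of% (S.comp_braidHom hZ), S.comp_braidInv hZ]; simp
  inv_hom_id := (S.decomp X).hom_ext_left fun hZ f => by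
    rw [reassoc_of% (S.comp_braidInv hZ), S.comp_braidHom hZ]; simp

theorem braidHom_comm (X Y : Equivariantization S.toGroupAction) (g : G) :
    ((X ⊗ Y).u g).hom ≫ S.braidHom X.pt Y =
      (S.T g).map (S.braidHom X.pt Y) ≫ ((Y ⊗ X).u g).hom := by
  rw [Equivariantization.tensorObj_u_hom, Equivariantization.tensorObj_u_hom]
  refine (S.decomp X.pt).hom_ext_functor (tensorRight Y.pt ⋙ S.T g) fun {h Z} hZ f => ?_
  have e₁ : (S.T g).map (f ▷ Y.pt) ≫ (S.T g).map (S.braidHom X.pt Y) =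
      (S.T g).map (S.c Z Y.pt hZ).hom ≫ (S.T g).map ((Y.u h).hom ⊗ₘ f) := by
    rw [← Functor.map_comp, S.comp_braidHom hZ, Functor.map_comp,
      ← MonoidalCategory.tensorHom_def]
  have e₂ := S.comp_braidHom (S.deg_T g hZ) ((S.T g).map f ≫ (X.u g).hom) Y
  have e₃ := S.c_naturality_right ((S.T g).obj Z) (S.deg_T g hZ) (Y.u g).hom
  have e₄ := S.c_T (g := g) Z Y.pt hZ
  have e₅ := Y.comm (inv_mul_cancel_right (g * h) g)
  have e₆ := Y.comm (rfl : g * h = g * h)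
  change (S.T g).map (f ▷ Y.pt) ≫ _ = (S.T g).map (f ▷ Y.pt) ≫ _
  rw [reassoc_of% e₁, ← δ_natural_assoc, tensorHom_comp_tensorHom, e₆,
    ← cancel_epi (μ (S.T g) Z Y.pt)]
  have e₇ : (((S.γ (rfl : g * h = g * h)).hom.app Y.pt ≫ (Y.u (g * h)).hom) ⊗ₘ
      ((S.T g).map f ≫ (X.u g).hom)) = (S.γ (rfl : g * h = g * h)).hom.app Y.pt ▷ _ ≫
        ((Y.u (g * h)).hom ⊗ₘ ((S.T g).map f ≫ (X.u g).hom)) := by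
    simp [MonoidalCategory.tensorHom_def]
  rw [e₇, ← reassoc_of% e₄, Category.assoc, ← δ_natural_left_assoc, Functor.Monoidal.μ_δ_assoc]
  have e₈ : (S.T g).map f ▷ (S.T g).obj Y.pt ≫ ((X.u g).hom ⊗ₘ (Y.u g).hom) =
      (S.T g).obj Z ◁ (Y.u g).hom ≫ ((S.T g).map f ≫ (X.u g).hom) ▷ Y.pt := by
    rw [MonoidalCategory.tensorHom_def', ← whisker_exchange_assoc, ← comp_whiskerRight]
  rw [reassoc_of% e₈, e₂, reassoc_of% e₃, ← comp_whiskerRight_assoc, e₅,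
    MonoidalCategory.tensorHom_def, comp_whiskerRight_assoc]

/-- The equivariantization of a braided `G`-crossed category is a braided category. -/
noncomputable instance : BraidedCategory (Equivariantization S.toGroupAction) where
  braiding X Y := Equivariantization.isoMk (S.braidIso X.pt Y) (S.braidHom_comm X Y)
  braiding_naturality_right X Y Z f := by
    apply Equivariantization.hom_ext
    refine (S.decomp X.pt).hom_ext_right fun {g W} hW t => ?_
    dsimp [Equivariantization.isoMk]
    rw [braidIso_hom, braidIso_hom, ← whisker_exchange_assoc, S.comp_braidHom hW, reassoc_of% (S.comp_braidHom hW),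
      reassoc_of% (S.c_naturality_right W hW f.f), whisker_exchange, ← comp_whiskerRight_assoc, ← f.comm,
      comp_whiskerRight_assoc]
  braiding_naturality_left {X _} f Z := by
    apply Equivariantization.hom_ext
    refine (S.decomp X.pt).hom_ext_right fun {g W} hW t => ?_
    dsimp [Equivariantization.isoMk]
    rw [braidIso_hom, braidIso_hom, ← comp_whiskerRight_assoc, S.comp_braidHom hW,
      reassoc_of% (S.comp_braidHom hW)]
    simp
  hexagon_forward X Y Z := by
    apply Equivariantization.hom_ext
    dsimp [Equivariantization.isoMk]
    refine (S.decomp X.pt).hom_ext_functor (tensorRight Y.pt ⋙ tensorRight Z.pt)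
      fun {g W} hW t => ?_
    change t ▷ Y.pt ▷ Z.pt ≫ _ = t ▷ Y.pt ▷ Z.pt ≫ _
    have e₁ : t ▷ (Y.pt ⊗ Z.pt) ≫ S.braidHom X.pt (Y ⊗ Z) = (S.c W (Y.pt ⊗ Z.pt) hW).hom ≫
        (δ (S.T g) Y.pt Z.pt ≫ ((Y.u g).hom ⊗ₘ (Z.u g).hom)) ▷ W ≫ (Y.pt ⊗ Z.pt) ◁ t :=
      S.comp_braidHom hW t (Y ⊗ Z)
    have e₂ := S.c_tensor_right W Y.pt Z.pt hW
    have e₃ : t ▷ Y.pt ▷ Z.pt ≫ S.braidHom X.pt Y ▷ Z.pt =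
        (S.c W Y.pt hW).hom ▷ Z.pt ≫ (Y.u g).hom ▷ W ▷ Z.pt ≫ (Y.pt ◁ t) ▷ Z.pt := by
      rw [← comp_whiskerRight, S.comp_braidHom hW]; simp
    have e₄ : Y.pt ◁ t ▷ Z.pt ≫ Y.pt ◁ S.braidHom X.pt Z =
        Y.pt ◁ (S.c W Z.pt hW).hom ≫ Y.pt ◁ (Z.u g).hom ▷ W ≫ Y.pt ◁ Z.pt ◁ t := by
      rw [← MonoidalCategory.whiskerLeft_comp, S.comp_braidHom hW]; simp
    have e₅ : ((Y.u g).hom ⊗ₘ (Z.u g).hom) ▷ W ≫ (Y.pt ⊗ Z.pt) ◁ t ≫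
        (α_ Y.pt Z.pt X.pt).hom = (α_ ((S.T g).obj Y.pt) ((S.T g).obj Z.pt) W).hom ≫
        (S.T g).obj Y.pt ◁ (Z.u g).hom ▷ W ≫ (S.T g).obj Y.pt ◁ Z.pt ◁ t ≫
        (Y.u g).hom ▷ (Z.pt ⊗ X.pt) := by
      rw [MonoidalCategory.tensorHom_def]
      calc
        _ = 𝟙 _ ⊗≫ ((Y.u g).hom ▷ ((S.T g).obj Z.pt ⊗ W) ≫
              Y.pt ◁ ((Z.u g).hom ▷ W ≫ Z.pt ◁ t)) := by monoidal
        _ = _ := by rw [← whisker_exchange]; monoidal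
    rw [braidIso_hom, braidIso_hom, braidIso_hom, reassoc_of% e₃, associator_naturality_left_assoc,
      reassoc_of% e₁, associator_naturality_middle_assoc, associator_naturality_left_assoc,
      e₄, comp_whiskerRight_assoc, e₅, reassoc_of% e₂]
    simp only [whisker_exchange, whisker_exchange_assoc]

  hexagon_reverse X Y Z := by
    apply Equivariantization.hom_ext
    dsimp [Equivariantization.isoMk]
    refine (S.decomp X.pt).hom_ext_functor (tensorRight (Y.pt ⊗ Z.pt)) fun {g W} hW t => ?_
    refine (S.decomp Y.pt).hom_ext_functor (tensorRight Z.pt ⋙ tensorLeft W) fun {h V} hV s => ?_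
    change W ◁ s ▷ Z.pt ≫ t ▷ (Y.pt ⊗ Z.pt) ≫ _ = W ◁ s ▷ Z.pt ≫ t ▷ (Y.pt ⊗ Z.pt) ≫ _
    have e₁ : S.braidHom (X.pt ⊗ Y.pt) Z = S.braidHom (X ⊗ Y).pt Z := rfl
    have e₂ := S.comp_braidHom (S.grading.tensor hW hV) (t ⊗ₘ s) Z
    have e₃ : t ▷ Z.pt ▷ Y.pt ≫ S.braidHom X.pt Z ▷ Y.pt =
        (S.c W Z.pt hW).hom ▷ Y.pt ≫ (Z.u g).hom ▷ W ▷ Y.pt ≫ (Z.pt ◁ t) ▷ Y.pt := by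
      rw [← comp_whiskerRight, S.comp_braidHom hW]; simp
    have e₄ : W ◁ s ▷ Z.pt ≫ W ◁ S.braidHom Y.pt Z =
        W ◁ (S.c V Z.pt hV).hom ≫ W ◁ (Z.u h).hom ▷ V ≫ W ◁ Z.pt ◁ s := by
      rw [← MonoidalCategory.whiskerLeft_comp, S.comp_braidHom hV]; simp
    have e₅ : W ◁ s ▷ Z.pt ≫ t ▷ (Y.pt ⊗ Z.pt) ≫ (α_ X.pt Y.pt Z.pt).inv =
        (α_ W V Z.pt).inv ≫ (t ⊗ₘ s) ▷ Z.pt := by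
      rw [MonoidalCategory.tensorHom_def']; simp
    have e₆ : W ◁ (Z.u h).hom ▷ V ≫ (α_ W Z.pt V).inv ≫ (S.c W Z.pt hW).hom ▷ V ≫
        (Z.u g).hom ▷ W ▷ V = (α_ W ((S.T h).obj Z.pt) V).inv ≫
        (S.c W ((S.T h).obj Z.pt) hW).hom ▷ V ≫
        (S.γ (rfl : g * h = g * h)).hom.app Z.pt ▷ W ▷ V ≫ (Z.u (g * h)).hom ▷ W ▷ V := by
      have e : (S.T g).map (Z.u h).hom ▷ W ▷ V ≫ (Z.u g).hom ▷ W ▷ V =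
          (S.γ (rfl : g * h = g * h)).hom.app Z.pt ▷ W ▷ V ≫ (Z.u (g * h)).hom ▷ W ▷ V := by
        simp only [← comp_whiskerRight, Z.comm (rfl : g * h = g * h)]
      rw [associator_inv_naturality_middle_assoc, ← comp_whiskerRight_assoc,
        S.c_naturality_right, comp_whiskerRight_assoc, e]
    have e₇ : t ▷ (Y.pt ⊗ Z.pt) ≫ X.pt ◁ S.braidHom Y.pt Z =
        W ◁ S.braidHom Y.pt Z ≫ t ▷ (Z.pt ⊗ Y.pt) := (whisker_exchange _ _).symm
    have e₈ : W ◁ Z.pt ◁ s ≫ (α_ W Z.pt Y.pt).inv ≫ (S.c W Z.pt hW).hom ▷ Y.pt ≫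
        (Z.u g).hom ▷ W ▷ Y.pt = (α_ W Z.pt V).inv ≫ (S.c W Z.pt hW).hom ▷ V ≫
        (Z.u g).hom ▷ W ▷ V ≫ (Z.pt ⊗ W) ◁ s := by
      rw [associator_inv_naturality_right_assoc, whisker_exchange_assoc, whisker_exchange]
    have e₉ : Z.pt ◁ (t ⊗ₘ s) ≫ (α_ Z.pt X.pt Y.pt).inv =
        (α_ Z.pt W V).inv ≫ (Z.pt ⊗ W) ◁ s ≫ (Z.pt ◁ t) ▷ Y.pt := by
      rw [MonoidalCategory.tensorHom_def']; simp
    rw [braidIso_hom, braidIso_hom, braidIso_hom, reassoc_of% e₅, reassoc_of% e₂,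
      S.c_tensor_left W V Z.pt hW hV, reassoc_of% e₇, reassoc_of% e₄,
      associator_inv_naturality_left_assoc, e₃, reassoc_of% e₈, reassoc_of% e₆, e₉]
    simp

end BraidedGCrossed
end GCrossed

section Canonical

open Functor.OplaxMonoidal

/-- The canonical braided `G`-crossed structure on the relative center `Z_D(C)` of a `G`-graded
category `C` with trivial component `D = deg 1`. The component of degree `g` consists of the objects
whose underlying object of `C` has degree `g`. The action is characterized, uniquely up to unique
isomorphism, by `L (T g Y) ≅ R Y` for the functors `R Y = (- ⊗ Y)` and `L Z = (Z ⊗ -)` on `C_g`: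
there are isomorphisms `b : X ⊗ Y ≅ T g Y ⊗ X`, for all `X` in `C_g` and `Y` in `Z_D(C)`, natural in
`X` and in `Y`, which for fixed `Y` are isomorphisms of `D`-bimodule functors of `X` (`b_left`,
`b_right`). The tensor structure of `T g` is the one induced by `b` (`b_tensor_right`), the
isomorphism `T g ∘ T h ≅ T (g * h)` is the one obtained from `b` at `X ⊗ X'` (`b_tensor_left`), and
the `G`-braiding of `Z_D(C)` is `b` at the objects `X` underlying objects of `Z_D(C)` (`c_eq_b`). -/
structure CanonicalGCrossed (k : Type*) [Field k] {G : Type*} [Group G] [Fintype G] {C : Type u}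
    [Category.{v} C] [Preadditive C] [Linear k C] [MonoidalCategory C] [MonoidalPreadditive C]
    [MonoidalLinear k C] (deg : G → ObjectProperty C) extends
    BraidedGCrossed k (E := RelCenter (deg 1)) (fun g Y => deg g Y.pt) where
  b : ∀ {g : G} (X : C) (Y : RelCenter (deg 1)), deg g X →
    (X ⊗ Y.pt ≅ ((T g).obj Y).pt ⊗ X)
  b_naturality_left : ∀ {g : G} {X X' : C} (hX : deg g X) (hX' : deg g X') (f : X ⟶ X')
    (Y : RelCenter (deg 1)),
    f ▷ Y.pt ≫ (b X' Y hX').hom = (b X Y hX).hom ≫ ((T g).obj Y).pt ◁ f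
  b_naturality_right : ∀ {g : G} (X : C) (hX : deg g X) {Y Y' : RelCenter (deg 1)} (f : Y ⟶ Y'),
    X ◁ f.f ≫ (b X Y' hX).hom = (b X Y hX).hom ≫ ((T g).map f).f ▷ X
  b_left : ∀ {g : G} (V X : C) (Y : RelCenter (deg 1)) (hV : deg 1 V) (hX : deg g X)
    (hVX : deg g (V ⊗ X)),
    (b (V ⊗ X) Y hVX).hom = (α_ V X Y.pt).hom ≫ V ◁ (b X Y hX).hom ≫
      (α_ V ((T g).obj Y).pt X).inv ≫ (((T g).obj Y).γ V hV).hom ▷ X ≫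
        (α_ ((T g).obj Y).pt V X).hom
  b_right : ∀ {g : G} (X V : C) (Y : RelCenter (deg 1)) (hX : deg g X) (hV : deg 1 V)
    (hXV : deg g (X ⊗ V)),
    (b (X ⊗ V) Y hXV).hom = (α_ X V Y.pt).hom ≫ X ◁ (Y.γ V hV).hom ≫
      (α_ X Y.pt V).inv ≫ (b X Y hX).hom ▷ V ≫ (α_ ((T g).obj Y).pt X V).hom
  b_tensor_right : ∀ {g : G} (X : C) (Y Z : RelCenter (deg 1)) (hX : deg g X),
    (α_ X Y.pt Z.pt).hom ≫ (b X (Y ⊗ Z) hX).hom ≫ (δ (T g) Y Z).f ▷ X ≫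
        (α_ ((T g).obj Y).pt ((T g).obj Z).pt X).hom =
      (b X Y hX).hom ▷ Z.pt ≫ (α_ ((T g).obj Y).pt X Z.pt).hom ≫
        ((T g).obj Y).pt ◁ (b X Z hX).hom
  b_tensor_left : ∀ {g h : G} (X X' : C) (Y : RelCenter (deg 1)) (hX : deg g X)
    (hX' : deg h X') (hXX' : deg (g * h) (X ⊗ X')),
    (b (X ⊗ X') Y hXX').hom =
      (α_ X X' Y.pt).hom ≫ X ◁ (b X' Y hX').hom ≫ (α_ X ((T h).obj Y).pt X').inv ≫
        (b X ((T h).obj Y) hX).hom ▷ X' ≫ (α_ ((T g).obj ((T h).obj Y)).pt X X').hom ≫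
          ((γ (rfl : g * h = g * h)).hom.app Y).f ▷ (X ⊗ X')
  c_eq_b : ∀ {g : G} (X Y : RelCenter (deg 1)) (hX : deg g X.pt),
    (c X Y hX).hom.f = (b X.pt Y hX).hom

end Canonical
end GradedCenter

/-!
Let `D` be the trivial component of the grading. The proof works with *twists*: for `Y` and `B` in
the relative center, a `Twist deg g Y B` is an isomorphism `(- ⊗ Y) ≅ (B ⊗ -)` of `D`-bimodule
functors on the component `C_g` of degree `g`.

Duals and semisimplicity provide objects `P` in `C_g` and `Q` in `C_{g⁻¹}` such that the unit is a
retract of `P ⊗ Q` (`IsGrading.nonempty_splitGrading`). This has three consequences. The functor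
`A ↦ (A ⊗ -)` from `C` to right `D`-module functors on `C_g` is fully faithful
(`SplitGrading.whiskerRight_ext`, `SplitGrading.exists_whiskerRight_eq`). Since `- ⊗ Y` is a
retract of `(P ⊗ Y ⊗ Q) ⊗ -`, splitting an idempotent of `P ⊗ Y ⊗ Q` shows that every `Y` has a
twist by every `g` (`SplitGrading.exists_twist`). Finally, natural transformations on `C_{gh}` are
the same as balanced ones on pairs from `C_g` and `C_h` (`SplitGrading.exists_natTrans`), so that
twists compose.

By full faithfulness, a twist of `Y` with target `B` and a twist of `Y'` with target `B'`
associate to each `f : Y ⟶ Y'` exactly one morphism `B ⟶ B'` lying over it (`Twist.Over`). Hence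
`T g Y` may be defined as the target of any twist of `Y` by `g`; the functor, its monoidal
structure and the isomorphisms `T g ∘ T h ≅ T (g * h)` are the morphisms over the evident ones,
and every coherence identity holds because both sides lie over the same morphism. This gives the
canonical structure (`SplitGrading.nonempty_canonicalGCrossed`).

Conversely, for any canonical structure the isomorphisms `b` are twists, and all structure
morphisms, including those not mentioned in the definition, lie over the evident ones. An
equivariant structure on `Y` thus amounts to a multiplicative family of twists `X ⊗ Y ≅ Y ⊗ X`,
one for each degree of `X`, extending the central structure of `Y` from `D`. Taking the direct sum
over the degrees, this is a half-braiding of `Y` with all of `C`. So the functor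
`CanonicalGCrossed.toCenter`, which is the identity on underlying objects and morphisms of `C`, is
an equivalence; it is braided because both braidings are the sum over the homogeneous components
of the same morphisms (`CanonicalGCrossed.braidHom_f`).
-/

namespace GradedCenter

set_option linter.unusedSectionVars false

/-! ### Gradings with a retract of the unit in every degree -/

/-- A grading in which every degree `g` contains an object `P g` such that the unit is a retract of
`P g ⊗ Q g` for some `Q g` of degree `g⁻¹`. This is the only consequence of faithfulness, rigidity
and semisimplicity that the argument uses: it makes every object of degree `g * h` a retract of a
tensor product of objects of degrees `g` and `h`, see `SplitGrading.sec` and `SplitGrading.ret`. -/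
structure SplitGrading {G : Type*} [Group G] [Fintype G] {C : Type u} [Category.{v} C]
    [Preadditive C] [MonoidalCategory C] (deg : G → ObjectProperty C) extends IsGrading deg where
  P : G → C
  Q : G → C
  deg_P : ∀ g, deg g (P g)
  deg_Q : ∀ g, deg g⁻¹ (Q g)
  η : ∀ g, 𝟙_ C ⟶ P g ⊗ Q g
  r : ∀ g, P g ⊗ Q g ⟶ 𝟙_ C
  η_r : ∀ g, η g ≫ r g = 𝟙 _

section

variable {G : Type*} [Group G] [Fintype G] {C : Type u} [Category.{v} C]
    [Preadditive C] [MonoidalCategory C] {deg : G → ObjectProperty C}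

theorem IsGrading.of_retract (H : IsGrading deg) {g : G} {X Y : C} (hY : deg g Y)
    (i : X ⟶ Y) (p : Y ⟶ X) (hip : i ≫ p = 𝟙 X) : deg g X := by
  obtain ⟨D⟩ := H.decomposition X
  refine H.of_iso (X := D.comp g) ⟨D.i g, D.p g, D.i_p g, ?_⟩ (D.deg_comp g)
  rw [← D.sum_p_i, Finset.sum_eq_single g]
  · intro h _ hh
    have h₁ : D.i h ≫ i = 0 := H.hom_eq_zero hh (D.deg_comp h) hY _
    have h₂ : D.i h = 0 := by
      rw [← Category.comp_id (D.i h), ← hip, ← Category.assoc, h₁, zero_comp]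
    rw [h₂, comp_zero]
  · simp

theorem IsGrading.tensor' (H : IsGrading deg) {g h l : G} (e : g * h = l) {X Y : C}
    (hX : deg g X) (hY : deg h Y) : deg l (X ⊗ Y) := e ▸ H.tensor hX hY

namespace SplitGrading

variable (H : SplitGrading deg)
include H

theorem tensor_left {g : G} {V X : C} (hV : deg 1 V) (hX : deg g X) : deg g (V ⊗ X) :=
  H.tensor' (one_mul g) hV hX

theorem tensor_right {g : G} {X V : C} (hX : deg g X) (hV : deg 1 V) : deg g (X ⊗ V) :=
  H.tensor' (mul_one g) hX hV

theorem deg_Q_tensor {g h l : G} (e : g * h = l) {X : C} (hX : deg l X) : deg h (H.Q g ⊗ X) :=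
  H.tensor' (by rw [← e]; group) (H.deg_Q g) hX

/-- The inclusion of `X` as a retract of `P g ⊗ (Q g ⊗ X)`. -/
def sec (g : G) (X : C) : X ⟶ H.P g ⊗ (H.Q g ⊗ X) :=
  (λ_ X).inv ≫ H.η g ▷ X ≫ (α_ _ _ _).hom

/-- The retraction of `SplitGrading.sec`. -/
def ret (g : G) (X : C) : H.P g ⊗ (H.Q g ⊗ X) ⟶ X :=
  (α_ _ _ _).inv ≫ H.r g ▷ X ≫ (λ_ X).hom

@[simp]
theorem sec_ret (g : G) (X : C) : H.sec g X ≫ H.ret g X = 𝟙 X := by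
  simp [sec, ret, ← comp_whiskerRight_assoc, H.η_r]

theorem sec_naturality (g : G) {X X' : C} (f : X ⟶ X') :
    f ≫ H.sec g X' = H.sec g X ≫ H.P g ◁ H.Q g ◁ f := by
  simp only [sec]
  calc _ = 𝟙 _ ⊗≫ (𝟙_ C ◁ f ≫ H.η g ▷ X') ⊗≫ 𝟙 _ := by monoidal
    _ = _ := by rw [whisker_exchange]; monoidal

theorem ret_naturality (g : G) {X X' : C} (f : X ⟶ X') :
    H.P g ◁ H.Q g ◁ f ≫ H.ret g X' = H.ret g X ≫ f := by
  simp only [ret]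
  calc _ = 𝟙 _ ⊗≫ ((H.P g ⊗ H.Q g) ◁ f ≫ H.r g ▷ X') ⊗≫ 𝟙 _ := by monoidal
    _ = _ := by rw [whisker_exchange]; monoidal

theorem sec_tensor (g : G) (X Y : C) :
    H.sec g (X ⊗ Y) = H.sec g X ▷ Y ≫ (α_ _ _ _).hom ≫ H.P g ◁ (α_ _ _ _).hom := by
  simp only [sec]; monoidal

theorem ret_tensor (g : G) (X Y : C) :
    H.ret g (X ⊗ Y) = H.P g ◁ (α_ _ _ _).inv ≫ (α_ _ _ _).inv ≫ H.ret g X ▷ Y := by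
  simp only [ret]; monoidal

theorem deg_sec {g : G} {X : C} (hX : deg g X) : deg g (H.P g ⊗ (H.Q g ⊗ X)) :=
  H.tensor_right (H.deg_P g) (H.deg_Q_tensor (mul_one g) hX)

/-! ### Descent along a homogeneous component -/

/-- The functor `A ↦ (A ⊗ -)` from `C` to functors on the component of degree `g` is faithful. -/
theorem whiskerRight_ext {g : G} {A B : C} {f f' : A ⟶ B}
    (h : ∀ X, deg g X → f ▷ X = f' ▷ X) : f = f' := by
  have key : ∀ k : A ⟶ B, k = (ρ_ A).inv ≫ A ◁ H.η g ≫ (α_ _ _ _).inv ≫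
      k ▷ H.P g ▷ H.Q g ≫ (α_ _ _ _).hom ≫ B ◁ H.r g ≫ (ρ_ B).hom := fun k => by
    calc _ = 𝟙 _ ⊗≫ k ▷ 𝟙_ C ⊗≫ 𝟙 _ := by monoidal
      _ = 𝟙 _ ⊗≫ A ◁ (H.η g ≫ H.r g) ≫ k ▷ 𝟙_ C ⊗≫ 𝟙 _ := by rw [H.η_r]; monoidal
      _ = 𝟙 _ ⊗≫ A ◁ H.η g ⊗≫ (A ◁ H.r g ≫ k ▷ 𝟙_ C) ⊗≫ 𝟙 _ := by monoidal
      _ = _ := by rw [whisker_exchange]; monoidal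
  rw [key f, key f', h _ (H.deg_P g)]

/-- The functor `A ↦ (A ⊗ -)` from `C` to right `D`-module functors on the component of degree `g`
is full, where `D` is the trivial component. -/
theorem exists_whiskerRight_eq {g : G} {A B : C} (φ : ∀ X, deg g X → (A ⊗ X ⟶ B ⊗ X))
    (nat : ∀ {X X' : C} (hX : deg g X) (hX' : deg g X') (f : X ⟶ X'),
      A ◁ f ≫ φ X' hX' = φ X hX ≫ B ◁ f)
    (lin : ∀ (X V : C) (hX : deg g X) (_ : deg 1 V) (hXV : deg g (X ⊗ V)),
      φ (X ⊗ V) hXV = (α_ A X V).inv ≫ φ X hX ▷ V ≫ (α_ B X V).hom) :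
    ∃ f : A ⟶ B, ∀ X hX, f ▷ X = φ X hX := by
  refine ⟨(ρ_ A).inv ≫ A ◁ H.η g ≫ (α_ _ _ _).inv ≫ φ _ (H.deg_P g) ▷ H.Q g ≫
    (α_ _ _ _).hom ≫ B ◁ H.r g ≫ (ρ_ B).hom, fun X hX => ?_⟩
  have h₁ := nat hX (H.deg_sec hX) (H.sec g X)
  rw [lin _ _ (H.deg_P g) (H.deg_Q_tensor (mul_one g) hX)] at h₁
  have h₂ : φ X hX = φ X hX ≫ B ◁ H.sec g X ≫ B ◁ H.ret g X := by
    rw [← MonoidalCategory.whiskerLeft_comp, sec_ret]; simp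
  rw [h₂, ← reassoc_of% h₁, sec, ret]
  monoidal

theorem exists_iso_whiskerRight_eq {g : G} {A B : C} (φ : ∀ X, deg g X → (A ⊗ X ≅ B ⊗ X))
    (nat : ∀ {X X' : C} (hX : deg g X) (hX' : deg g X') (f : X ⟶ X'),
      A ◁ f ≫ (φ X' hX').hom = (φ X hX).hom ≫ B ◁ f)
    (lin : ∀ (X V : C) (hX : deg g X) (_ : deg 1 V) (hXV : deg g (X ⊗ V)),
      (φ (X ⊗ V) hXV).hom = (α_ A X V).inv ≫ (φ X hX).hom ▷ V ≫ (α_ B X V).hom) :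
    ∃ f : A ≅ B, ∀ X hX, f.hom ▷ X = (φ X hX).hom := by
  obtain ⟨f, hf⟩ := H.exists_whiskerRight_eq (fun X hX => (φ X hX).hom) nat lin
  obtain ⟨f', hf'⟩ := H.exists_whiskerRight_eq (fun X hX => (φ X hX).inv)
    (fun {X X'} hX hX' k => by
      rw [Iso.comp_inv_eq, Category.assoc, nat hX hX', Iso.inv_hom_id_assoc])
    (fun X V hX hV hXV => by
      rw [← cancel_epi (φ (X ⊗ V) hXV).hom, Iso.hom_inv_id]
      simp [lin X V hX hV hXV, ← comp_whiskerRight_assoc])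
  refine ⟨⟨f, f', ?_, ?_⟩, hf⟩
  all_goals
    refine H.whiskerRight_ext (g := g) fun X hX => ?_
    rw [comp_whiskerRight, hf X hX, hf' X hX]
    simp

/-! ### Extension from products of homogeneous components -/

/-- A natural transformation on the component of degree `g * h` is determined by its values on
tensor products of objects of degrees `g` and `h`. -/
theorem natTrans_ext {g h l : G} (e : g * h = l) {F F' : C ⥤ C}
    {φ φ' : ∀ X, deg l X → (F.obj X ⟶ F'.obj X)}
    (nat : ∀ {X X' : C} (hX : deg l X) (hX' : deg l X') (f : X ⟶ X'),
      F.map f ≫ φ X' hX' = φ X hX ≫ F'.map f)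
    (nat' : ∀ {X X' : C} (hX : deg l X) (hX' : deg l X') (f : X ⟶ X'),
      F.map f ≫ φ' X' hX' = φ' X hX ≫ F'.map f)
    (H' : ∀ (X X' : C) (_ : deg g X) (_ : deg h X') (hXX' : deg l (X ⊗ X')),
      φ (X ⊗ X') hXX' = φ' (X ⊗ X') hXX') (X : C) (hX : deg l X) : φ X hX = φ' X hX := by
  have hs := H.tensor' e (H.deg_P g) (H.deg_Q_tensor e hX)
  have h₁ := nat hX hs (H.sec g X)
  rw [H' _ _ (H.deg_P g) (H.deg_Q_tensor e hX), nat' hX hs] at h₁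
  have h₂ := congrArg (· ≫ F'.map (H.ret g X)) h₁
  simpa [← Functor.map_comp] using h₂.symm

/-- A family on tensor products `X ⊗ X'` of objects of degrees `g` and `h` which is natural in both
variables and balanced over the trivial component extends to a natural transformation on the
component of degree `g * h`. This replaces the equivalence between that component and the relative
tensor product of the components of degrees `g` and `h`. -/
theorem exists_natTrans {g h l : G} (e : g * h = l) (F F' : C ⥤ C)
    (θ : ∀ X X', deg g X → deg h X' → (F.obj (X ⊗ X') ⟶ F'.obj (X ⊗ X')))
    (natl : ∀ {X X₁ X' : C} (hX : deg g X) (hX₁ : deg g X₁) (hX' : deg h X') (f : X ⟶ X₁),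
      F.map (f ▷ X') ≫ θ X₁ X' hX₁ hX' = θ X X' hX hX' ≫ F'.map (f ▷ X'))
    (natr : ∀ {X X' X₁ : C} (hX : deg g X) (hX' : deg h X') (hX₁ : deg h X₁) (f : X' ⟶ X₁),
      F.map (X ◁ f) ≫ θ X X₁ hX hX₁ = θ X X' hX hX' ≫ F'.map (X ◁ f))
    (bal : ∀ (X V X' : C) (hX : deg g X) (_ : deg 1 V) (hX' : deg h X') (hXV : deg g (X ⊗ V))
      (hVX' : deg h (V ⊗ X')), F.map (α_ X V X').hom ≫ θ X (V ⊗ X') hX hVX' =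
        θ (X ⊗ V) X' hXV hX' ≫ F'.map (α_ X V X').hom) :
    ∃ φ : ∀ X, deg l X → (F.obj X ⟶ F'.obj X),
      (∀ {X X' : C} (hX : deg l X) (hX' : deg l X') (f : X ⟶ X'),
        F.map f ≫ φ X' hX' = φ X hX ≫ F'.map f) ∧
      ∀ (X X' : C) (hX : deg g X) (hX' : deg h X') (hXX' : deg l (X ⊗ X')),
        φ (X ⊗ X') hXX' = θ X X' hX hX' := by
  refine ⟨fun X hX => F.map (H.sec g X) ≫ θ _ _ (H.deg_P g) (H.deg_Q_tensor e hX) ≫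
    F'.map (H.ret g X), fun {X X'} hX hX' f => ?_, fun X X' hX hX' hXX' => ?_⟩
  · rw [← Functor.map_comp_assoc, H.sec_naturality, Functor.map_comp_assoc,
      reassoc_of% (natr (H.deg_P g) (H.deg_Q_tensor e hX) (H.deg_Q_tensor e hX')),
      ← Functor.map_comp, ret_naturality]
    simp
  · have hV := H.deg_Q_tensor (mul_one g) hX
    have h₁ := natr (H.deg_P g) (H.tensor_left hV hX') (H.deg_Q_tensor e hXX') (α_ _ _ _).hom
    have h₂ := bal (H.P g) _ X' (H.deg_P g) hV hX' (H.deg_sec hX) (H.tensor_left hV hX')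
    have h₃ := natl hX (H.deg_sec hX) hX' (H.sec g X)
    simp only [sec_tensor, ret_tensor, Functor.map_comp, Category.assoc]
    rw [reassoc_of% h₁, reassoc_of% h₂, reassoc_of% h₃]
    simp [← Functor.map_comp, ← MonoidalCategory.whiskerLeft_comp_assoc, ← comp_whiskerRight]

end SplitGrading

theorem SplitGrading.exists_natIso (H : SplitGrading deg) {g h l : G} (e : g * h = l) (F F' : C ⥤ C)
    (θ : ∀ X X', deg g X → deg h X' → (F.obj (X ⊗ X') ≅ F'.obj (X ⊗ X')))
    (natl : ∀ {X X₁ X' : C} (hX : deg g X) (hX₁ : deg g X₁) (hX' : deg h X') (f : X ⟶ X₁),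
      F.map (f ▷ X') ≫ (θ X₁ X' hX₁ hX').hom = (θ X X' hX hX').hom ≫ F'.map (f ▷ X'))
    (natr : ∀ {X X' X₁ : C} (hX : deg g X) (hX' : deg h X') (hX₁ : deg h X₁) (f : X' ⟶ X₁),
      F.map (X ◁ f) ≫ (θ X X₁ hX hX₁).hom = (θ X X' hX hX').hom ≫ F'.map (X ◁ f))
    (bal : ∀ (X V X' : C) (hX : deg g X) (_ : deg 1 V) (hX' : deg h X') (hXV : deg g (X ⊗ V))
      (hVX' : deg h (V ⊗ X')), F.map (α_ X V X').hom ≫ (θ X (V ⊗ X') hX hVX').hom =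
        (θ (X ⊗ V) X' hXV hX').hom ≫ F'.map (α_ X V X').hom) :
    ∃ φ : ∀ X, deg l X → (F.obj X ≅ F'.obj X),
      (∀ {X X' : C} (hX : deg l X) (hX' : deg l X') (f : X ⟶ X'),
        F.map f ≫ (φ X' hX').hom = (φ X hX).hom ≫ F'.map f) ∧
      ∀ (X X' : C) (hX : deg g X) (hX' : deg h X') (hXX' : deg l (X ⊗ X')),
        (φ (X ⊗ X') hXX').hom = (θ X X' hX hX').hom := by
  obtain ⟨φ, nat, hφ⟩ := H.exists_natTrans e F F' (fun X X' hX hX' => (θ X X' hX hX').hom)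
    natl natr bal
  obtain ⟨ψ, nat', hψ⟩ := H.exists_natTrans e F' F (fun X X' hX hX' => (θ X X' hX hX').inv)
    (fun hX hX₁ hX' f => by
      rw [Iso.comp_inv_eq, Category.assoc, natl hX hX₁ hX' f, Iso.inv_hom_id_assoc])
    (fun hX hX₁ hX' f => by
      rw [Iso.comp_inv_eq, Category.assoc, natr hX hX₁ hX' f, Iso.inv_hom_id_assoc])
    (fun X V X' hX hV hX' hXV hVX' => by
      rw [Iso.comp_inv_eq, Category.assoc, bal X V X' hX hV hX' hXV, Iso.inv_hom_id_assoc])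
  refine ⟨fun X hX => ⟨φ X hX, ψ X hX, ?_, ?_⟩, nat, hφ⟩
  · refine H.natTrans_ext e (F := F) (F' := F) (φ := fun X hX => φ X hX ≫ ψ X hX)
      (φ' := fun X _ => 𝟙 (F.obj X)) (fun {X X'} hX hX' f => ?_) (by simp)
      (fun X X' hX hX' hXX' => ?_) X hX
    · rw [reassoc_of% (nat hX hX'), nat' hX hX', Category.assoc]
    · simp only [hφ _ _ hX hX', hψ _ _ hX hX', Iso.hom_inv_id]
  · refine H.natTrans_ext e (F := F') (F' := F') (φ := fun X hX => ψ X hX ≫ φ X hX)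
      (φ' := fun X _ => 𝟙 (F'.obj X)) (fun {X X'} hX hX' f => ?_) (by simp)
      (fun X X' hX hX' hXX' => ?_) X hX
    · rw [reassoc_of% (nat' hX hX'), nat hX hX', Category.assoc]
    · simp only [hφ _ _ hX hX', hψ _ _ hX hX', Iso.inv_hom_id]

/-! ### Twisting by a homogeneous component -/

namespace SplitGrading

variable (H : SplitGrading deg)

/-- The isomorphism `P g ⊗ Q g ⊗ X ⊗ Y ≅ P g ⊗ Y ⊗ Q g ⊗ X` given by the central structure of `Y` at
`Q g ⊗ X`, which lies in the trivial component. It presents `- ⊗ Y` on the component of degree `g`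
as a retract of `N ⊗ -`, where `N = P g ⊗ Y ⊗ Q g`. -/
def conjIso {g : G} (Y : RelCenter (deg 1)) (X : C) (hX : deg g X) :
    (H.P g ⊗ (H.Q g ⊗ X)) ⊗ Y.pt ≅ ((H.P g ⊗ Y.pt) ⊗ H.Q g) ⊗ X :=
  α_ _ _ _ ≪≫ whiskerLeftIso (H.P g) (Y.γ _ (H.deg_Q_tensor (mul_one g) hX)) ≪≫
    (α_ _ _ _).symm ≪≫ (α_ _ _ _).symm

theorem conjIso_naturality {g : G} (Y : RelCenter (deg 1)) {X X' : C} (hX : deg g X)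
    (hX' : deg g X') (f : X ⟶ X') :
    (H.P g ◁ H.Q g ◁ f) ▷ Y.pt ≫ (H.conjIso Y X' hX').hom = (H.conjIso Y X hX).hom ≫ _ ◁ f := by
  simp only [conjIso, Iso.trans_hom, whiskerLeftIso_hom, Iso.symm_hom]
  calc
    _ = 𝟙 _ ⊗≫ H.P g ◁ ((H.Q g ◁ f) ▷ Y.pt ≫ (Y.γ _ (H.deg_Q_tensor (mul_one g) hX')).hom)
      ⊗≫ 𝟙 _ := by monoidal
    _ = _ := by rw [Y.naturality (H.deg_Q_tensor (mul_one g) hX)]; monoidal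

theorem conjIso_tensor {g : G} (Y : RelCenter (deg 1)) (X V : C) (hX : deg g X) (hV : deg 1 V)
    (hXV : deg g (X ⊗ V)) :
    (H.conjIso Y (X ⊗ V) hXV).hom = 𝟙 _ ⊗≫ (H.P g ⊗ (H.Q g ⊗ X)) ◁ (Y.γ V hV).hom ⊗≫
      (H.conjIso Y X hX).hom ▷ V ⊗≫ 𝟙 _ := by
  simp only [conjIso, Iso.trans_hom, whiskerLeftIso_hom, Iso.symm_hom]
  have hQX := H.deg_Q_tensor (mul_one g) hX
  have h₁ := Y.naturality (H.deg_Q_tensor (mul_one g) hXV) (H.tensor_left hQX hV) (α_ _ _ _).inv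
  rw [Y.monoidal _ V hQX hV] at h₁
  have h₂ : (Y.γ _ (H.deg_Q_tensor (mul_one g) hXV)).hom = 𝟙 _ ⊗≫ (H.Q g ⊗ X) ◁ (Y.γ V hV).hom
      ⊗≫ (Y.γ _ hQX).hom ▷ V ⊗≫ 𝟙 _ := by
    rw [← cancel_mono (Y.pt ◁ (α_ (H.Q g) X V).inv), ← h₁]
    monoidal
  rw [h₂]
  monoidal

theorem conjIso_inv_tensor {g : G} (Y : RelCenter (deg 1)) (X V : C) (hX : deg g X) (hV : deg 1 V)
    (hXV : deg g (X ⊗ V)) :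
    (H.conjIso Y (X ⊗ V) hXV).inv = 𝟙 _ ⊗≫ (H.conjIso Y X hX).inv ▷ V ⊗≫
      (H.P g ⊗ (H.Q g ⊗ X)) ◁ (Y.γ V hV).inv ⊗≫ 𝟙 _ := by
  rw [← cancel_epi (H.conjIso Y (X ⊗ V) hXV).hom, Iso.hom_inv_id, H.conjIso_tensor Y X V hX hV]
  symm
  calc
    _ = 𝟙 _ ⊗≫ (H.P g ⊗ (H.Q g ⊗ X)) ◁ (Y.γ V hV).hom ⊗≫
      ((H.conjIso Y X hX).hom ≫ (H.conjIso Y X hX).inv) ▷ V ⊗≫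
        (H.P g ⊗ (H.Q g ⊗ X)) ◁ (Y.γ V hV).inv ⊗≫ 𝟙 _ := by monoidal
    _ = 𝟙 _ ⊗≫ (H.P g ⊗ (H.Q g ⊗ X)) ◁ ((Y.γ V hV).hom ≫ (Y.γ V hV).inv) ⊗≫ 𝟙 _ := by
      rw [Iso.hom_inv_id]; monoidal
    _ = _ := by rw [Iso.hom_inv_id]; monoidal

include H in
/-- The right `D`-module functor `- ⊗ Y` on the component of degree `g` is `T ⊗ -` for an object `T`
of `C`. It is a retract of `N ⊗ -` for `N = P g ⊗ Y ⊗ Q g`; by `SplitGrading.exists_whiskerRight_eq`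
the corresponding idempotent comes from an idempotent of `N`, and `T` is the image of the latter. -/
theorem exists_right_twist [IsIdempotentComplete C] (g : G) (Y : RelCenter (deg 1)) :
    ∃ (T : C) (b : ∀ X, deg g X → (X ⊗ Y.pt ≅ T ⊗ X)),
      (∀ {X X' : C} (hX : deg g X) (hX' : deg g X') (f : X ⟶ X'),
        f ▷ Y.pt ≫ (b X' hX').hom = (b X hX).hom ≫ T ◁ f) ∧
      ∀ (X V : C) (hX : deg g X) (hV : deg 1 V) (hXV : deg g (X ⊗ V)),
        (b (X ⊗ V) hXV).hom = (α_ X V Y.pt).hom ≫ X ◁ (Y.γ V hV).hom ≫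
          (α_ X Y.pt V).inv ≫ (b X hX).hom ▷ V ≫ (α_ T X V).hom := by
  -- `a` and `c` exhibit `X ⊗ Y` as a retract of `N ⊗ X`, compatibly with the right module
  -- structures.
  let N := (H.P g ⊗ Y.pt) ⊗ H.Q g
  let a : ∀ X, deg g X → (X ⊗ Y.pt ⟶ N ⊗ X) := fun X hX =>
    H.sec g X ▷ Y.pt ≫ (H.conjIso Y X hX).hom
  let c : ∀ X, deg g X → (N ⊗ X ⟶ X ⊗ Y.pt) := fun X hX =>
    (H.conjIso Y X hX).inv ≫ H.ret g X ▷ Y.pt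
  have a_c : ∀ X hX, a X hX ≫ c X hX = 𝟙 _ := fun X hX => by
    simp [a, c, ← comp_whiskerRight]
  have a_nat : ∀ {X X' : C} (hX : deg g X) (hX' : deg g X') (f : X ⟶ X'),
      f ▷ Y.pt ≫ a X' hX' = a X hX ≫ N ◁ f := fun {X X'} hX hX' f => by
    simp only [a, N]
    rw [← comp_whiskerRight_assoc, H.sec_naturality, comp_whiskerRight_assoc,
      H.conjIso_naturality Y hX, Category.assoc]
  have c_nat : ∀ {X X' : C} (hX : deg g X) (hX' : deg g X') (f : X ⟶ X'),
      N ◁ f ≫ c X' hX' = c X hX ≫ f ▷ Y.pt := fun {X X'} hX hX' f => by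
    simp only [c, N, Category.assoc]
    rw [← comp_whiskerRight, ← H.ret_naturality, Iso.eq_inv_comp,
      ← reassoc_of% (H.conjIso_naturality Y hX hX'), Iso.hom_inv_id_assoc, comp_whiskerRight]
  have a_lin : ∀ (X V : C) (hX : deg g X) (hV : deg 1 V) (hXV : deg g (X ⊗ V)),
      a (X ⊗ V) hXV = (α_ X V Y.pt).hom ≫ X ◁ (Y.γ V hV).hom ≫
          (α_ X Y.pt V).inv ≫ (a X hX) ▷ V ≫ (α_ N X V).hom := fun X V hX hV hXV => by
    simp only [a, N]
    rw [H.conjIso_tensor Y X V hX hV, H.sec_tensor]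
    calc
      _ = 𝟙 _ ⊗≫ (H.sec g X ▷ (V ⊗ Y.pt) ≫ _ ◁ (Y.γ V hV).hom) ⊗≫
        (H.conjIso Y X hX).hom ▷ V ⊗≫ 𝟙 _ := by monoidal
      _ = _ := by rw [← whisker_exchange]; monoidal
  have c_lin : ∀ (X V : C) (hX : deg g X) (hV : deg 1 V) (hXV : deg g (X ⊗ V)),
      c (X ⊗ V) hXV = (α_ N X V).inv ≫ (c X hX) ▷ V ≫ (α_ X Y.pt V).hom ≫
        X ◁ (Y.γ V hV).inv ≫ (α_ X V Y.pt).inv := fun X V hX hV hXV => by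
    simp only [c, N]
    rw [H.conjIso_inv_tensor Y X V hX hV, H.ret_tensor]
    calc
      _ = 𝟙 _ ⊗≫ (H.conjIso Y X hX).inv ▷ V ⊗≫ (_ ◁ (Y.γ V hV).inv ≫
        H.ret g X ▷ (V ⊗ Y.pt)) ⊗≫ 𝟙 _ := by monoidal
      _ = _ := by rw [whisker_exchange]; monoidal
  clear_value a c
  -- The idempotent `c ≫ a` of `N ⊗ -` comes from an endomorphism of `N`.
  obtain ⟨e, he⟩ := H.exists_whiskerRight_eq (fun X hX => c X hX ≫ a X hX)
    (fun {X X'} hX hX' f => by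
      rw [reassoc_of% (c_nat hX hX' f), a_nat hX hX', Category.assoc])
    (fun X V hX hV hXV => by
      rw [a_lin X V hX hV, c_lin X V hX hV]
      simp)
  have hee : e ≫ e = e := H.whiskerRight_ext (g := g) fun X hX => by
    rw [comp_whiskerRight, he X hX, Category.assoc, reassoc_of% (a_c X hX)]
  obtain ⟨T, i, p, hip, hpi⟩ := IsIdempotentComplete.idempotents_split N e hee
  refine ⟨T, fun X hX => ⟨a X hX ≫ p ▷ X, i ▷ X ≫ c X hX, ?_, ?_⟩, ?_, ?_⟩
  · rw [Category.assoc, ← comp_whiskerRight_assoc, hpi, he X hX, Category.assoc, a_c,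
      Category.comp_id, a_c]
  · rw [Category.assoc, ← reassoc_of% (he X hX), ← comp_whiskerRight, ← comp_whiskerRight,
      ← hpi, Category.assoc, hip, Category.comp_id, hip, id_whiskerRight]
  · intro X X' hX hX' f
    dsimp only
    rw [reassoc_of% (a_nat hX hX' f), whisker_exchange, Category.assoc]
  · intro X V hX hV hXV
    dsimp only
    rw [a_lin X V hX hV]
    simp

end SplitGrading

/-! ### Twists -/

/-- A twist of `Y` by degree `g` with target `B`: an isomorphism `(- ⊗ Y) ≅ (B ⊗ -)` of `D`-bimodule
functors on the component of degree `g`, where `D` is the trivial component. Here `Y` and `B` are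
objects of the relative center; the central structure of `Y` gives the right module structure of
`- ⊗ Y`, and that of `B` gives the left module structure of `B ⊗ -`. -/
structure Twist (deg : G → ObjectProperty C) (g : G) (Y B : RelCenter (deg 1)) where
  b : ∀ X, deg g X → (X ⊗ Y.pt ≅ B.pt ⊗ X)
  nat : ∀ {X X' : C} (hX : deg g X) (hX' : deg g X') (f : X ⟶ X'),
    f ▷ Y.pt ≫ (b X' hX').hom = (b X hX).hom ≫ B.pt ◁ f
  left : ∀ (V X : C) (hV : deg 1 V) (hX : deg g X) (hVX : deg g (V ⊗ X)),
    (b (V ⊗ X) hVX).hom = (α_ V X Y.pt).hom ≫ V ◁ (b X hX).hom ≫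
      (α_ V B.pt X).inv ≫ (B.γ V hV).hom ▷ X ≫ (α_ B.pt V X).hom
  right : ∀ (X V : C) (hX : deg g X) (hV : deg 1 V) (hXV : deg g (X ⊗ V)),
    (b (X ⊗ V) hXV).hom = (α_ X V Y.pt).hom ≫ X ◁ (Y.γ V hV).hom ≫
      (α_ X Y.pt V).inv ≫ (b X hX).hom ▷ V ≫ (α_ B.pt X V).hom

namespace SplitGrading

variable (H : SplitGrading deg)
include H

/-- Every object `Y` of the relative center has a twist by every degree. The object `T` of
`SplitGrading.exists_right_twist` carries a unique central structure for which the isomorphisms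
`X ⊗ Y ≅ T ⊗ X` are compatible with the left action of the trivial component, since `V ⊗ T` and `T ⊗ V`
both represent `X ↦ (V ⊗ X) ⊗ Y`. -/
theorem exists_twist [IsIdempotentComplete C] (g : G) (Y : RelCenter (deg 1)) :
    ∃ B : RelCenter (deg 1), Nonempty (Twist deg g Y B) := by
  obtain ⟨T, b, nat, right⟩ := H.exists_right_twist g Y
  have key : ∀ V (hV : deg 1 V), ∃ f : V ⊗ T ≅ T ⊗ V, ∀ (X : C) (hX : deg g X),
      (b (V ⊗ X) (H.tensor_left hV hX)).hom = (α_ V X Y.pt).hom ≫ V ◁ (b X hX).hom ≫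
      (α_ V T X).inv ≫ f.hom ▷ X ≫ (α_ T V X).hom := by
    intro V hV
    obtain ⟨f, hf⟩ := H.exists_iso_whiskerRight_eq (g := g) (A := V ⊗ T) (B := T ⊗ V)
      (fun X hX => α_ _ _ _ ≪≫ whiskerLeftIso V (b X hX).symm ≪≫ (α_ _ _ _).symm ≪≫
        b (V ⊗ X) (H.tensor_left hV hX) ≪≫ (α_ _ _ _).symm)
      (fun {X X'} hX hX' f => by
        have h₁ : T ◁ f ≫ (b X' hX').inv = (b X hX).inv ≫ f ▷ Y.pt := by
          rw [Iso.comp_inv_eq, Category.assoc, nat hX hX', Iso.inv_hom_id_assoc]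
        simp only [Iso.trans_hom, whiskerLeftIso_hom, Iso.symm_hom]
        calc
          _ = 𝟙 _ ⊗≫ V ◁ (T ◁ f ≫ (b X' hX').inv) ⊗≫
              (b (V ⊗ X') (H.tensor_left hV hX')).hom ⊗≫ 𝟙 _ := by monoidal
          _ = 𝟙 _ ⊗≫ V ◁ (b X hX).inv ⊗≫
              ((V ◁ f) ▷ Y.pt ≫ (b (V ⊗ X') (H.tensor_left hV hX')).hom) ⊗≫ 𝟙 _ := by
            rw [h₁]; monoidal
          _ = _ := by rw [nat (H.tensor_left hV hX)]; monoidal)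
      (fun X W hX hW hXW => by
        simp only [Iso.trans_hom, whiskerLeftIso_hom, Iso.symm_hom]
        have h₁ := nat (H.tensor_left hV hXW) (H.tensor_right (H.tensor_left hV hX) hW)
          (α_ _ _ _).inv
        rw [right _ W (H.tensor_left hV hX) hW] at h₁
        have h₃ : V ◁ (b (X ⊗ W) hXW).inv = 𝟙 _ ⊗≫ V ◁ ((b X hX).inv ▷ W) ⊗≫
            V ◁ X ◁ (Y.γ W hW).inv ⊗≫ 𝟙 _ := by
          rw [← cancel_epi (V ◁ (b (X ⊗ W) hXW).hom), ← MonoidalCategory.whiskerLeft_comp,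
            Iso.hom_inv_id, right X W hX hW]
          symm
          calc
            _ = 𝟙 _ ⊗≫ V ◁ X ◁ (Y.γ W hW).hom ⊗≫
                V ◁ ((b X hX).hom ≫ (b X hX).inv) ▷ W ⊗≫ V ◁ X ◁ (Y.γ W hW).inv ⊗≫ 𝟙 _ := by
              monoidal
            _ = 𝟙 _ ⊗≫ V ◁ X ◁ ((Y.γ W hW).hom ≫ (Y.γ W hW).inv) ⊗≫ 𝟙 _ := by
              rw [Iso.hom_inv_id]; monoidal
            _ = _ := by rw [Iso.hom_inv_id]; monoidal
        have h₄ : (b (V ⊗ X ⊗ W) (H.tensor_left hV hXW)).hom = 𝟙 _ ⊗≫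
            (V ⊗ X) ◁ (Y.γ W hW).hom ⊗≫ (b (V ⊗ X) (H.tensor_left hV hX)).hom ▷ W ⊗≫ 𝟙 _ := by
          rw [← cancel_mono (T ◁ (α_ V X W).inv), ← h₁]
          monoidal
        rw [h₃, h₄]
        calc
          _ = 𝟙 _ ⊗≫ V ◁ ((b X hX).inv ▷ W) ⊗≫
              (V ⊗ X) ◁ ((Y.γ W hW).inv ≫ (Y.γ W hW).hom) ⊗≫
              (b (V ⊗ X) (H.tensor_left hV hX)).hom ▷ W ⊗≫ 𝟙 _ := by monoidal
          _ = _ := by rw [Iso.inv_hom_id]; monoidal)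
    refine ⟨f, fun X hX => ?_⟩
    rw [hf X hX]
    simp
  choose f hf using key
  refine ⟨⟨T, f, fun {V W} hV hW k => ?_, fun V W hV hW hVW => ?_⟩,
    ⟨⟨b, nat, fun V X hV hX _ => hf V hV X hX, right⟩⟩⟩
  · refine H.whiskerRight_ext (g := g) fun X hX => ?_
    have h₁ := nat (H.tensor_left hV hX) (H.tensor_left hW hX) (k ▷ X)
    rw [hf V hV X hX, hf W hW X hX] at h₁
    rw [← cancel_epi (α_ V T X).inv, ← cancel_epi (V ◁ (b X hX).hom),
      ← cancel_epi (α_ V X Y.pt).hom, ← cancel_mono (α_ T W X).hom]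
    calc
      _ = 𝟙 _ ⊗≫ (V ◁ (b X hX).hom ≫ k ▷ _) ⊗≫ (f W hW).hom ▷ X ⊗≫ 𝟙 _ := by monoidal
      _ = k ▷ X ▷ Y.pt ≫ (α_ W X Y.pt).hom ≫ W ◁ (b X hX).hom ≫
      (α_ W T X).inv ≫ (f W hW).hom ▷ X ≫ (α_ T W X).hom := by
        rw [whisker_exchange]; monoidal
      _ = _ := by rw [h₁]; monoidal
  · refine H.whiskerRight_ext (g := g) fun X hX => ?_
    have hWX := H.tensor_left hW hX
    have h₁ := nat (H.tensor_left hV hWX) (H.tensor_left hVW hX) (α_ V W X).inv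
    rw [hf V hV _ hWX, hf W hW X hX, hf (V ⊗ W) hVW X hX] at h₁
    rw [← cancel_epi (α_ (V ⊗ W) T X).inv, ← cancel_epi ((V ⊗ W) ◁ (b X hX).hom),
      ← cancel_epi (α_ (V ⊗ W) X Y.pt).hom, ← cancel_mono (α_ T (V ⊗ W) X).hom,
      ← cancel_epi ((α_ V W X).inv ▷ Y.pt)]
    calc
      _ = _ := by simp only [Category.assoc]; exact h₁
      _ = _ := by monoidal

end SplitGrading

namespace Twist

variable {g h l : G} {Y Y' Y'' Z Z' B B' B'' D D' : RelCenter (deg 1)}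

/-! ### Morphisms of twists -/

/-- A morphism `F : B ⟶ B'` lies over `f : Y ⟶ Y'`, with respect to twists of `Y` and `Y'` with
targets `B` and `B'`, if the twists identify `X ◁ f` with `F ▷ X`. For given twists there is exactly
one morphism over each `f` (`Twist.exists_over`, `Twist.Over.unique`), so that an identity between
morphisms of the relative center follows as soon as both sides lie over the same morphism. -/
def Over (t : Twist deg g Y B) (t' : Twist deg g Y' B') (f : Y ⟶ Y') (F : B ⟶ B') : Prop :=
  ∀ X hX, X ◁ f.f ≫ (t'.b X hX).hom = (t.b X hX).hom ≫ F.f ▷ X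

theorem Over.refl (t : Twist deg g Y B) : Over t t (𝟙 Y) (𝟙 B) := fun X hX => by simp

theorem Over.comp {t : Twist deg g Y B} {t' : Twist deg g Y' B'} {t'' : Twist deg g Y'' B''}
    {f : Y ⟶ Y'} {F : B ⟶ B'} {f' : Y' ⟶ Y''} {F' : B' ⟶ B''} (h₁ : Over t t' f F)
    (h₂ : Over t' t'' f' F') : Over t t'' (f ≫ f') (F ≫ F') := fun X hX => by
  simp [h₂ X hX, reassoc_of% (h₁ X hX)]

theorem hom_ext (H : SplitGrading deg) (t : Twist deg g Y B) {A : C} {F F' : B.pt ⟶ A}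
    (h : ∀ X hX, (t.b X hX).hom ≫ F ▷ X = (t.b X hX).hom ≫ F' ▷ X) : F = F' :=
  H.whiskerRight_ext (g := g) fun X hX => by rw [← cancel_epi (t.b X hX).hom, h X hX]

theorem Over.unique (H : SplitGrading deg) {t : Twist deg g Y B} {t' : Twist deg g Y' B'}
    {f : Y ⟶ Y'} {F F' : B ⟶ B'} (h₁ : Over t t' f F) (h₂ : Over t t' f F') : F = F' :=
  RelCenter.hom_ext (t.hom_ext H fun X hX => by rw [← h₁ X hX, ← h₂ X hX])

theorem exists_over (H : SplitGrading deg) (t : Twist deg g Y B) (t' : Twist deg g Y' B')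
    (f : Y ⟶ Y') : ∃ F : B ⟶ B', Over t t' f F := by
  have t_inv : ∀ {X X' : C} (hX : deg g X) (hX' : deg g X') (k : X ⟶ X'),
      B.pt ◁ k ≫ (t.b X' hX').inv = (t.b X hX).inv ≫ k ▷ Y.pt := fun {X X'} hX hX' k => by
    rw [Iso.comp_inv_eq, Category.assoc, t.nat hX hX', Iso.inv_hom_id_assoc]
  obtain ⟨F, hF⟩ := H.exists_whiskerRight_eq (g := g) (A := B.pt) (B := B'.pt)
    (fun X hX => (t.b X hX).inv ≫ X ◁ f.f ≫ (t'.b X hX).hom)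
    (fun {X X'} hX hX' k => by
      rw [reassoc_of% (t_inv hX hX' k), ← whisker_exchange_assoc, t'.nat hX hX']
      simp only [Category.assoc])
    (fun X V hX hV hXV => by
      rw [Iso.inv_comp_eq, t.right X V hX hV hXV, t'.right X V hX hV hXV]
      have h₁ := f.comm V hV
      symm
      calc
        _ = 𝟙 _ ⊗≫ X ◁ (Y.γ V hV).hom ⊗≫ ((t.b X hX).hom ≫ (t.b X hX).inv) ▷ V ⊗≫
            X ◁ f.f ▷ V ⊗≫ (t'.b X hX).hom ▷ V ⊗≫ 𝟙 _ := by monoidal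
        _ = 𝟙 _ ⊗≫ X ◁ ((Y.γ V hV).hom ≫ f.f ▷ V) ⊗≫ (t'.b X hX).hom ▷ V ⊗≫ 𝟙 _ := by
          rw [Iso.hom_inv_id]; monoidal
        _ = _ := by rw [h₁]; monoidal)
  have hF' : ∀ X hX, X ◁ f.f ≫ (t'.b X hX).hom = (t.b X hX).hom ≫ F ▷ X := fun X hX => by
    rw [hF X hX, Iso.hom_inv_id_assoc]
  -- Compatibility with the central structures is tested after tensoring with `X` of degree `g`.
  refine ⟨⟨F, fun V hV => H.whiskerRight_ext (g := g) fun X hX => ?_⟩, hF'⟩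
  have hVX := H.tensor_left hV hX
  have h₁ := hF' (V ⊗ X) hVX
  rw [t.left V X hV hX, t'.left V X hV hX] at h₁
  rw [← cancel_epi (α_ V B.pt X).inv, ← cancel_epi (V ◁ (t.b X hX).hom),
    ← cancel_epi (α_ V X Y.pt).hom, ← cancel_mono (α_ B'.pt V X).hom]
  symm
  calc
    _ = 𝟙 _ ⊗≫ V ◁ ((t.b X hX).hom ≫ F ▷ X) ⊗≫ (B'.γ V hV).hom ▷ X ⊗≫ 𝟙 _ := by monoidal
    _ = (V ⊗ X) ◁ f.f ≫ (α_ V X Y'.pt).hom ≫ V ◁ (t'.b X hX).hom ≫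
          (α_ V B'.pt X).inv ≫ (B'.γ V hV).hom ▷ X ≫ (α_ B'.pt V X).hom := by
      rw [← hF']; monoidal
    _ = _ := by rw [h₁]; monoidal

/-- Lying over a morphism, in degree `g * h`, can be tested on tensor products of objects of degrees
`g` and `h`. -/
theorem over_of_prod (H : SplitGrading deg) (e : g * h = l) (t : Twist deg l Y B)
    (t' : Twist deg l Y' B') (f : Y ⟶ Y') (F : B ⟶ B')
    (H' : ∀ X X' (_ : deg g X) (_ : deg h X') (hXX' : deg l (X ⊗ X')),
      (X ⊗ X') ◁ f.f ≫ (t'.b (X ⊗ X') hXX').hom = (t.b (X ⊗ X') hXX').hom ≫ F.f ▷ (X ⊗ X')) :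
    Over t t' f F :=
  H.natTrans_ext e (F := tensorRight Y.pt) (F' := tensorLeft B'.pt)
    (φ := fun X hX => X ◁ f.f ≫ (t'.b X hX).hom) (φ' := fun X hX => (t.b X hX).hom ≫ F.f ▷ X)
    (fun hX hX' k => by
      dsimp
      rw [← whisker_exchange_assoc, t'.nat hX hX', Category.assoc])
    (fun hX hX' k => by
      dsimp
      rw [reassoc_of% (t.nat hX hX' k), whisker_exchange, Category.assoc]) H'

/-! ### Operations on twists -/

/-- The central structure of `Y` is a twist of `Y` by the trivial degree, with target `Y`. -/
@[simps] def refl (Y : RelCenter (deg 1)) : Twist deg 1 Y Y where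
  b X hX := Y.γ X hX
  nat hX hX' f := Y.naturality hX hX' f
  left V X hV hX hVX := Y.monoidal V X hV hX hVX
  right X V hX hV hXV := Y.monoidal X V hX hV hXV

/-- The twist of the unit object given by the unit constraints. -/
@[simps] def unit (deg : G → ObjectProperty C) (g : G) :
    Twist deg g (𝟙_ (RelCenter (deg 1))) (𝟙_ (RelCenter (deg 1))) where
  b X _ := ρ_ X ≪≫ (λ_ X).symm
  nat _ _ f := by simp
  left V X hV hX _ := by
    have : ((𝟙_ (RelCenter (deg 1))).γ V hV).hom = (ρ_ V).hom ≫ (λ_ V).inv := rfl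
    simp [this]
  right X V _ hV _ := by
    have : ((𝟙_ (RelCenter (deg 1))).γ V hV).hom = (ρ_ V).hom ≫ (λ_ V).inv := rfl
    simp [this]

/-- The composite of twists of `Y` and `Z` by the same degree, as a twist of `Y ⊗ Z`. -/
@[simps] def tensor (t : Twist deg g Y B) (s : Twist deg g Z D) : Twist deg g (Y ⊗ Z) (B ⊗ D) where
  b X hX := (α_ _ _ _).symm ≪≫ whiskerRightIso (t.b X hX) Z.pt ≪≫ α_ _ _ _ ≪≫
    whiskerLeftIso B.pt (s.b X hX) ≪≫ (α_ _ _ _).symm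
  nat {X X'} hX hX' f := by
    simp only [Iso.trans_hom, Iso.symm_hom, whiskerRightIso_hom, whiskerLeftIso_hom,
      RelCenter.tensorObj_pt]
    calc
      _ = 𝟙 _ ⊗≫ (f ▷ Y.pt ≫ (t.b X' hX').hom) ▷ Z.pt ⊗≫ B.pt ◁ (s.b X' hX').hom ⊗≫ 𝟙 _ := by
        monoidal
      _ = 𝟙 _ ⊗≫ (t.b X hX).hom ▷ Z.pt ⊗≫ B.pt ◁ (f ▷ Z.pt ≫ (s.b X' hX').hom) ⊗≫ 𝟙 _ := by
        rw [t.nat hX hX']; monoidal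
      _ = _ := by rw [s.nat hX hX']; monoidal
  left V X hV hX hVX := by
    rw [RelCenter.tensorObj_γ_hom]
    simp only [Iso.trans_hom, Iso.symm_hom, whiskerRightIso_hom, whiskerLeftIso_hom,
      RelCenter.tensorObj_pt]
    rw [t.left V X hV hX hVX, s.left V X hV hX hVX]
    calc
      _ = 𝟙 _ ⊗≫ V ◁ (t.b X hX).hom ▷ Z.pt ⊗≫ ((B.γ V hV).hom ▷ (X ⊗ Z.pt) ≫
            (B.pt ⊗ V) ◁ (s.b X hX).hom) ⊗≫ B.pt ◁ (D.γ V hV).hom ▷ X ⊗≫ 𝟙 _ := by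
        monoidal
      _ = _ := by rw [← whisker_exchange]; monoidal
  right X V hX hV hXV := by
    rw [RelCenter.tensorObj_γ_hom]
    simp only [Iso.trans_hom, Iso.symm_hom, whiskerRightIso_hom, whiskerLeftIso_hom,
      RelCenter.tensorObj_pt]
    rw [t.right X V hX hV hXV, s.right X V hX hV hXV]
    calc
      _ = 𝟙 _ ⊗≫ X ◁ (Y.γ V hV).hom ▷ Z.pt ⊗≫ ((t.b X hX).hom ▷ (V ⊗ Z.pt) ≫
            (B.pt ⊗ X) ◁ (Z.γ V hV).hom) ⊗≫ B.pt ◁ (s.b X hX).hom ▷ V ⊗≫ 𝟙 _ := by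
        monoidal
      _ = _ := by rw [← whisker_exchange]; monoidal

theorem exists_comp (H : SplitGrading deg) (e : g * h = l) (s : Twist deg g B D)
    (t : Twist deg h Y B) : ∃ r : Twist deg l Y D,
      ∀ X X' (hX : deg g X) (hX' : deg h X') (hXX' : deg l (X ⊗ X')),
        (r.b (X ⊗ X') hXX').hom = (α_ X X' Y.pt).hom ≫ X ◁ (t.b X' hX').hom ≫
          (α_ X B.pt X').inv ≫ (s.b X hX).hom ▷ X' ≫ (α_ D.pt X X').hom := by
  obtain ⟨b, nat, hb⟩ := H.exists_natIso e (tensorRight Y.pt) (tensorLeft D.pt)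
    (fun X X' hX hX' => α_ X X' Y.pt ≪≫ whiskerLeftIso X (t.b X' hX') ≪≫
          (α_ X B.pt X').symm ≪≫ whiskerRightIso (s.b X hX) X' ≪≫ α_ D.pt X X')
    (fun {X X₁ X'} hX hX₁ hX' f => by
      simp only [Iso.trans_hom, Iso.symm_hom, whiskerRightIso_hom, whiskerLeftIso_hom]
      dsimp
      calc
        _ = 𝟙 _ ⊗≫ (f ▷ (X' ⊗ Y.pt) ≫ X₁ ◁ (t.b X' hX').hom) ⊗≫ (s.b X₁ hX₁).hom ▷ X' ⊗≫ 𝟙 _ := by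
          monoidal
        _ = 𝟙 _ ⊗≫ X ◁ (t.b X' hX').hom ⊗≫ (f ▷ B.pt ≫ (s.b X₁ hX₁).hom) ▷ X' ⊗≫ 𝟙 _ := by
          rw [← whisker_exchange]; monoidal
        _ = _ := by rw [s.nat hX hX₁]; monoidal)
    (fun {X X' X₁} hX hX' hX₁ f => by
      simp only [Iso.trans_hom, Iso.symm_hom, whiskerRightIso_hom, whiskerLeftIso_hom]
      dsimp
      calc
        _ = 𝟙 _ ⊗≫ X ◁ (f ▷ Y.pt ≫ (t.b X₁ hX₁).hom) ⊗≫ (s.b X hX).hom ▷ X₁ ⊗≫ 𝟙 _ := by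
          monoidal
        _ = 𝟙 _ ⊗≫ X ◁ (t.b X' hX').hom ⊗≫ ((X ⊗ B.pt) ◁ f ≫ (s.b X hX).hom ▷ X₁) ⊗≫ 𝟙 _ := by
          rw [t.nat hX' hX₁]; monoidal
        _ = _ := by rw [whisker_exchange]; monoidal)
    (fun X V X' hX hV hX' hXV hVX' => by
      simp only [Iso.trans_hom, Iso.symm_hom, whiskerRightIso_hom, whiskerLeftIso_hom]
      dsimp
      rw [t.left V X' hV hX' hVX', s.right X V hX hV hXV]
      monoidal)
  dsimp at b nat hb
  simp only [whiskerRightIso_hom, whiskerLeftIso_hom] at hb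
  refine ⟨⟨b, nat, fun V X hV hX hVX => ?_, fun X V hX hV hXV => ?_⟩, hb⟩
  · refine H.natTrans_ext e (F := tensorLeft V ⋙ tensorRight Y.pt)
      (F' := tensorLeft V ⋙ tensorLeft D.pt)
      (φ := fun X hX => (b (V ⊗ X) (H.tensor_left hV hX)).hom)
      (φ' := fun X hX => (α_ V X Y.pt).hom ≫ V ◁ (b X hX).hom ≫
      (α_ V D.pt X).inv ≫ (D.γ V hV).hom ▷ X ≫ (α_ D.pt V X).hom)
      (fun hX hX' f => nat _ _ _) (fun {X X'} hX hX' f => ?_) (fun X X' hX hX' hXX' => ?_) X hX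
    · dsimp
      calc
        _ = 𝟙 _ ⊗≫ V ◁ (f ▷ Y.pt ≫ (b X' hX').hom) ⊗≫ (D.γ V hV).hom ▷ X' ⊗≫ 𝟙 _ := by monoidal
        _ = 𝟙 _ ⊗≫ V ◁ (b X hX).hom ⊗≫ ((V ⊗ D.pt) ◁ f ≫ (D.γ V hV).hom ▷ X') ⊗≫ 𝟙 _ := by
          rw [nat hX hX']; monoidal
        _ = _ := by rw [whisker_exchange]; monoidal
    · have hVX := H.tensor_left hV hX
      have h₁ := nat (H.tensor_left hV hXX') (H.tensor' e hVX hX') (α_ V X X').inv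
      rw [hb (V ⊗ X) X' hVX hX', s.left V X hV hX hVX] at h₁
      rw [hb X X' hX hX', ← cancel_mono (D.pt ◁ (α_ V X X').inv), ← h₁]
      monoidal
  · refine H.natTrans_ext e (F := tensorRight V ⋙ tensorRight Y.pt)
      (F' := tensorRight V ⋙ tensorLeft D.pt)
      (φ := fun X hX => (b (X ⊗ V) (H.tensor_right hX hV)).hom)
      (φ' := fun X hX => (α_ X V Y.pt).hom ≫ X ◁ (Y.γ V hV).hom ≫
      (α_ X Y.pt V).inv ≫ (b X hX).hom ▷ V ≫ (α_ D.pt X V).hom)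
      (fun hX hX' f => nat _ _ _) (fun {X X'} hX hX' f => ?_) (fun X X' hX hX' hXX' => ?_) X hX
    · dsimp
      calc
        _ = 𝟙 _ ⊗≫ (f ▷ (V ⊗ Y.pt) ≫ X' ◁ (Y.γ V hV).hom) ⊗≫ (b X' hX').hom ▷ V ⊗≫ 𝟙 _ := by
          monoidal
        _ = 𝟙 _ ⊗≫ X ◁ (Y.γ V hV).hom ⊗≫ (f ▷ Y.pt ≫ (b X' hX').hom) ▷ V ⊗≫ 𝟙 _ := by
          rw [← whisker_exchange]; monoidal
        _ = _ := by rw [nat hX hX']; monoidal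
    · have hXV := H.tensor_right hX' hV
      have h₁ := nat (H.tensor_right hXX' hV) (H.tensor' e hX hXV) (α_ X X' V).hom
      rw [hb X (X' ⊗ V) hX hXV, t.right X' V hX' hV hXV] at h₁
      rw [hb X X' hX hX', ← cancel_mono (D.pt ◁ (α_ X X' V).hom), ← h₁]
      monoidal

/-- The composite of a twist of `Y` by `h` and a twist of its target by `g`, as a twist of `Y` by
`g * h`. On tensor products of objects of degrees `g` and `h` it is given by `Twist.comp_b_hom`, which
characterizes it. -/
noncomputable def comp (H : SplitGrading deg) (e : g * h = l) (s : Twist deg g B D)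
    (t : Twist deg h Y B) : Twist deg l Y D := (exists_comp H e s t).choose

theorem comp_b_hom (H : SplitGrading deg) (e : g * h = l) (s : Twist deg g B D)
    (t : Twist deg h Y B) (X X' : C) (hX : deg g X) (hX' : deg h X') (hXX' : deg l (X ⊗ X')) :
    ((comp H e s t).b (X ⊗ X') hXX').hom = (α_ X X' Y.pt).hom ≫ X ◁ (t.b X' hX').hom ≫
      (α_ X B.pt X').inv ≫ (s.b X hX).hom ▷ X' ≫ (α_ D.pt X X').hom :=
  (exists_comp H e s t).choose_spec X X' hX hX' hXX'

/-! ### Compatibility of morphisms of twists with the operations -/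

theorem Over.of_hom (f : Y ⟶ Y') : Over (Twist.refl Y) (Twist.refl Y') f f :=
  fun X hX => (f.comm X hX).symm

theorem Over.tensor {t : Twist deg g Y B} {t' : Twist deg g Y' B'} {s : Twist deg g Z D}
    {s' : Twist deg g Z' D'} {f : Y ⟶ Y'} {F : B ⟶ B'} {k : Z ⟶ Z'} {K : D ⟶ D'}
    (h₁ : Over t t' f F) (h₂ : Over s s' k K) :
    Over (t.tensor s) (t'.tensor s') (f ⊗ₘ k) (F ⊗ₘ K) := fun X hX => by
  rw [MonoidalCategory.tensorHom_def, MonoidalCategory.tensorHom_def]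
  simp only [tensor_b, Iso.trans_hom, Iso.symm_hom, whiskerRightIso_hom, whiskerLeftIso_hom,
      RelCenter.tensorObj_pt, RelCenter.comp_f, RelCenter.whiskerLeft_f, RelCenter.whiskerRight_f]
  calc
    _ = 𝟙 _ ⊗≫ X ◁ f.f ▷ Z.pt ⊗≫ ((X ⊗ Y'.pt) ◁ k.f ≫ (t'.b X hX).hom ▷ Z'.pt) ⊗≫
        B'.pt ◁ (s'.b X hX).hom ⊗≫ 𝟙 _ := by monoidal
    _ = 𝟙 _ ⊗≫ (X ◁ f.f ≫ (t'.b X hX).hom) ▷ Z.pt ⊗≫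
        B'.pt ◁ (X ◁ k.f ≫ (s'.b X hX).hom) ⊗≫ 𝟙 _ := by rw [whisker_exchange]; monoidal
    _ = 𝟙 _ ⊗≫ (t.b X hX).hom ▷ Z.pt ⊗≫ (F.f ▷ (X ⊗ Z.pt) ≫
        B'.pt ◁ (s.b X hX).hom) ⊗≫ B'.pt ◁ K.f ▷ X ⊗≫ 𝟙 _ := by
      rw [h₁ X hX, h₂ X hX]; monoidal
    _ = _ := by rw [← whisker_exchange]; monoidal

theorem Over.associator (t : Twist deg g Y B) (t' : Twist deg g Y' B') (t'' : Twist deg g Y'' B'') :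
    Over ((t.tensor t').tensor t'') (t.tensor (t'.tensor t'')) (α_ Y Y' Y'').hom
      (α_ B B' B'').hom := fun X hX => by
  simp only [tensor_b, Iso.trans_hom, Iso.symm_hom, whiskerRightIso_hom, whiskerLeftIso_hom,
      RelCenter.tensorObj_pt, RelCenter.associator_hom_f]
  monoidal

theorem Over.leftUnitor (t : Twist deg g Y B) :
    Over ((unit deg g).tensor t) t (λ_ Y).hom (λ_ B).hom := fun X hX => by
  have h₁ : (λ_ Y).hom.f = (λ_ Y.pt).hom := rfl
  have h₂ : (λ_ B).hom.f = (λ_ B.pt).hom := rfl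
  simp only [tensor_b, unit_b, Iso.trans_hom, Iso.symm_hom, whiskerRightIso_hom, whiskerLeftIso_hom,
      RelCenter.tensorUnit_pt, h₁, h₂]
  monoidal

theorem Over.rightUnitor (t : Twist deg g Y B) :
    Over (t.tensor (unit deg g)) t (ρ_ Y).hom (ρ_ B).hom := fun X hX => by
  have h₁ : (ρ_ Y).hom.f = (ρ_ Y.pt).hom := rfl
  have h₂ : (ρ_ B).hom.f = (ρ_ B.pt).hom := rfl
  simp only [tensor_b, unit_b, Iso.trans_hom, Iso.symm_hom, whiskerRightIso_hom, whiskerLeftIso_hom,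
      RelCenter.tensorUnit_pt, h₁, h₂]
  monoidal

theorem Over.comp_comp (H : SplitGrading deg) (e : g * h = l) {s : Twist deg g B D}
    {s' : Twist deg g B' D'} {t : Twist deg h Y B} {t' : Twist deg h Y' B'} {f : Y ⟶ Y'}
    {F : B ⟶ B'} {K : D ⟶ D'} (h₁ : Over s s' F K) (h₂ : Over t t' f F) :
    Over (Twist.comp H e s t) (Twist.comp H e s' t') f K := by
  refine over_of_prod H e _ _ _ _ fun X X' hX hX' hXX' => ?_
  rw [comp_b_hom H e s t X X' hX hX', comp_b_hom H e s' t' X X' hX hX']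
  calc
    _ = 𝟙 _ ⊗≫ X ◁ (X' ◁ f.f ≫ (t'.b X' hX').hom) ⊗≫ (s'.b X hX).hom ▷ X' ⊗≫ 𝟙 _ := by monoidal
    _ = 𝟙 _ ⊗≫ X ◁ (t.b X' hX').hom ⊗≫ (X ◁ F.f ≫ (s'.b X hX).hom) ▷ X' ⊗≫ 𝟙 _ := by
      rw [h₂ X' hX']; monoidal
    _ = _ := by rw [h₁ X hX]; monoidal

theorem Over.comp_tensor (H : SplitGrading deg) (e : g * h = l) (s : Twist deg g B D)
    (t : Twist deg h Y B) (s' : Twist deg g B' D') (t' : Twist deg h Y' B') :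
    Over (Twist.comp H e (s.tensor s') (t.tensor t'))
      ((Twist.comp H e s t).tensor (Twist.comp H e s' t'))
      (𝟙 _) (𝟙 _) := by
  refine over_of_prod H e _ _ _ _ fun X X' hX hX' hXX' => ?_
  rw [comp_b_hom H e _ _ X X' hX hX']
  simp only [tensor_b, Iso.trans_hom, Iso.symm_hom, whiskerRightIso_hom, whiskerLeftIso_hom,
      RelCenter.tensorObj_pt, RelCenter.id_f]
  rw [comp_b_hom H e s t X X' hX hX', comp_b_hom H e s' t' X X' hX hX']
  calc
    _ = 𝟙 _ ⊗≫ X ◁ (t.b X' hX').hom ▷ Y'.pt ⊗≫ ((s.b X hX).hom ▷ (X' ⊗ Y'.pt) ≫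
        (D.pt ⊗ X) ◁ (t'.b X' hX').hom) ⊗≫ D.pt ◁ (s'.b X hX).hom ▷ X' ⊗≫ 𝟙 _ := by monoidal
    _ = _ := by rw [← whisker_exchange]; monoidal

theorem Over.comp_unit (H : SplitGrading deg) (e : g * h = l) :
    Over (Twist.comp H e (unit deg g) (unit deg h)) (unit deg l) (𝟙 _) (𝟙 _) := by
  refine over_of_prod H e _ _ _ _ fun X X' hX hX' hXX' => ?_
  rw [comp_b_hom H e _ _ X X' hX hX']
  simp only [unit_b, Iso.trans_hom, Iso.symm_hom, RelCenter.tensorUnit_pt, RelCenter.id_f]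
  monoidal

theorem Over.unit_refl :
    Over (unit deg 1) (Twist.refl (𝟙_ (RelCenter (deg 1)))) (𝟙 _) (𝟙 _) := fun X hX => by
  have : ((𝟙_ (RelCenter (deg 1))).γ X hX).hom = (ρ_ X).hom ≫ (λ_ X).inv := rfl
  simp [this]

theorem Over.refl_tensor (Y Z : RelCenter (deg 1)) :
    Over ((Twist.refl Y).tensor (Twist.refl Z)) (Twist.refl (Y ⊗ Z)) (𝟙 _) (𝟙 _) := fun X hX => by
  simp [RelCenter.tensorObj_γ_hom]

theorem Over.refl_comp (H : SplitGrading deg) (t : Twist deg g Y B) :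
    Over (Twist.comp H (one_mul g) (Twist.refl B) t) t (𝟙 _) (𝟙 _) := by
  refine over_of_prod H (one_mul g) _ _ _ _ fun X X' hX hX' hXX' => ?_
  rw [comp_b_hom H _ _ _ X X' hX hX', t.left X X' hX hX']
  simp

theorem Over.comp_refl (H : SplitGrading deg) (t : Twist deg g Y B) :
    Over (Twist.comp H (mul_one g) t (Twist.refl Y)) t (𝟙 _) (𝟙 _) := by
  refine over_of_prod H (mul_one g) _ _ _ _ fun X X' hX hX' hXX' => ?_
  rw [comp_b_hom H _ _ _ X X' hX hX', t.right X X' hX hX']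
  simp

/-- Both composites are determined by their values on threefold tensor products, where they agree.
-/
theorem Over.assoc (H : SplitGrading deg) {a b c : G} (e₁ : g * h = a) (e₂ : h * l = b)
    (e₃ : a * l = c) (e₄ : g * b = c) (r : Twist deg g B D) (s : Twist deg h Z B)
    (t : Twist deg l Y Z) :
    Over (Twist.comp H e₃ (Twist.comp H e₁ r s) t) (Twist.comp H e₄ r (Twist.comp H e₂ s t))
      (𝟙 _) (𝟙 _) := by
  refine over_of_prod H e₃ _ _ _ _ fun W X'' hW hX'' hWX'' => ?_
  have hP := H.deg_P g
  refine H.natTrans_ext e₁ (F := tensorRight X'' ⋙ tensorRight Y.pt)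
    (F' := tensorRight X'' ⋙ tensorLeft D.pt)
    (φ := fun W hW => (W ⊗ X'') ◁ 𝟙 Y.pt ≫ ((Twist.comp H e₄ r (Twist.comp H e₂ s t)).b (W ⊗ X'')
      (H.tensor' e₃ hW hX'')).hom)
    (φ' := fun W hW => ((Twist.comp H e₃ (Twist.comp H e₁ r s) t).b (W ⊗ X'')
      (H.tensor' e₃ hW hX'')).hom ≫ 𝟙 D.pt ▷ (W ⊗ X'')) ?_ ?_ ?_ W hW
  · intro X X' hX hX' f
    simpa using Twist.nat _ _ _ _
  · intro X X' hX hX' f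
    simpa using Twist.nat _ _ _ _
  · intro X X' hX hX' hXX'
    have hX'X'' := H.tensor' e₂ hX' hX''
    have h₁ := (Twist.comp H e₄ r (Twist.comp H e₂ s t)).nat (H.tensor' e₃ hXX' hX'')
      (H.tensor' e₄ hX hX'X'') (α_ X X' X'').hom
    rw [comp_b_hom H _ _ _ X (X' ⊗ X'') hX hX'X'', comp_b_hom H _ _ _ X' X'' hX' hX''] at h₁
    rw [comp_b_hom H _ _ _ (X ⊗ X') X'' hXX' hX'', comp_b_hom H _ _ _ X X' hX hX',
      ← cancel_mono (D.pt ◁ (α_ X X' X'').hom), Category.assoc, ← h₁]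
    monoidal

/-! ### Lifts -/

/-- The unique morphism between the targets of two twists lying over `f`. -/
noncomputable def lift (H : SplitGrading deg) (t : Twist deg g Y B) (t' : Twist deg g Y' B')
    (f : Y ⟶ Y') : B ⟶ B' := (exists_over H t t' f).choose

theorem over_lift (H : SplitGrading deg) (t : Twist deg g Y B) (t' : Twist deg g Y' B')
    (f : Y ⟶ Y') : Over t t' f (lift H t t' f) := (exists_over H t t' f).choose_spec

/-- The unique isomorphism between the targets of two twists of `Y` by the same degree which lies
over the identity. -/
@[simps] noncomputable def liftIso (H : SplitGrading deg) (t : Twist deg g Y B)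
    (t' : Twist deg g Y B') : B ≅ B' where
  hom := lift H t t' (𝟙 Y)
  inv := lift H t' t (𝟙 Y)
  hom_inv_id := ((over_lift H t t' _).comp (over_lift H t' t _)).unique H
    (by simpa using Over.refl t)
  inv_hom_id := ((over_lift H t' t _).comp (over_lift H t t' _)).unique H
    (by simpa using Over.refl t')

end Twist
end

/-! ### The grading of the relative center -/

section

variable {C : Type u} [Category.{v} C] [MonoidalCategory C]

theorem comp_id_whiskerRight_of_eq {A V : C} {a b : V ⊗ A ⟶ A ⊗ V} (h : a = b) :
    a ≫ 𝟙 A ▷ V = V ◁ 𝟙 A ≫ b := by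
  simp [h]

/-- A retract, in `C`, of an object of the relative center, with the induced central structure. The
idempotent has to be compatible with the central structure. -/
@[reducible] def RelCenter.retract {P : ObjectProperty C} (Y : RelCenter P) {Z : C} (i : Z ⟶ Y.pt)
    (p : Y.pt ⟶ Z) (hip : i ≫ p = 𝟙 Z)
    (comm : ∀ V hV, (Y.γ V hV).hom ≫ (p ≫ i) ▷ V = V ◁ (p ≫ i) ≫ (Y.γ V hV).hom) :
    RelCenter P where
  pt := Z
  γ V hV :=
    { hom := V ◁ i ≫ (Y.γ V hV).hom ≫ p ▷ V
      inv := i ▷ V ≫ (Y.γ V hV).inv ≫ V ◁ p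
      hom_inv_id := by
        simp only [Category.assoc, ← comp_whiskerRight_assoc p i]
        rw [reassoc_of% (comm V hV)]
        simp [← MonoidalCategory.whiskerLeft_comp, hip]
      inv_hom_id := by
        simp only [Category.assoc, ← MonoidalCategory.whiskerLeft_comp_assoc _ p i]
        rw [← reassoc_of% (comm V hV)]
        simp [← comp_whiskerRight, hip] }
  naturality {V W} hV hW f := by
    dsimp only
    rw [← whisker_exchange_assoc, reassoc_of% (Y.naturality hV hW f)]
    simp [whisker_exchange]
  monoidal V W hV hW hVW := by
    dsimp only
    have hi : i ≫ p ≫ i = i := by rw [← Category.assoc, hip, Category.id_comp]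
    symm
    calc
      _ = 𝟙 _ ⊗≫ V ◁ W ◁ i ⊗≫ V ◁ ((Y.γ W hW).hom ≫ (p ≫ i) ▷ W) ⊗≫ (Y.γ V hV).hom ▷ W ⊗≫
          p ▷ V ▷ W ⊗≫ 𝟙 _ := by monoidal
      _ = 𝟙 _ ⊗≫ V ◁ W ◁ (i ≫ p ≫ i) ⊗≫ V ◁ (Y.γ W hW).hom ⊗≫ (Y.γ V hV).hom ▷ W ⊗≫
          p ▷ V ▷ W ⊗≫ 𝟙 _ := by rw [comm]; monoidal
      _ = _ := by rw [hi, Y.monoidal V W hV hW hVW]; monoidal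

variable {G : Type*} [Group G] [Fintype G] [Preadditive C] [MonoidalPreadditive C]
  {deg : G → ObjectProperty C}

theorem Decomposition.whiskerRight_sum_p_i {X : C} (D : Decomposition deg X) (V : C) :
    ∑ g, (D.p g ≫ D.i g) ▷ V = 𝟙 (X ⊗ V) := by
  have := congrArg (tensorRight V).map D.sum_p_i
  rw [CategoryTheory.Functor.map_sum, CategoryTheory.Functor.map_id] at this
  exact this

theorem Decomposition.whiskerLeft_sum_p_i {X : C} (D : Decomposition deg X) (V : C) :
    ∑ g, V ◁ (D.p g ≫ D.i g) = 𝟙 (V ⊗ X) := by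
  have := congrArg (tensorLeft V).map D.sum_p_i
  rw [CategoryTheory.Functor.map_sum, CategoryTheory.Functor.map_id] at this
  exact this

/-- The projectors onto homogeneous components commute with every morphism `V ⊗ Y ⟶ Y ⊗ V` for `V`
in the trivial component, because such a morphism preserves degrees. -/
theorem IsGrading.comp_p_i_comm (H : IsGrading deg) {Y : C} (D : Decomposition deg Y) {V : C}
    (hV : deg 1 V) (θ : V ⊗ Y ⟶ Y ⊗ V) (g : G) :
    θ ≫ (D.p g ≫ D.i g) ▷ V = V ◁ (D.p g ≫ D.i g) ≫ θ := by
  have key : ∀ a b : G, a ≠ b → V ◁ (D.p a ≫ D.i a) ≫ θ ≫ (D.p b ≫ D.i b) ▷ V = 0 := by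
    intro a b hab
    have h₁ : V ◁ D.i a ≫ θ ≫ D.p b ▷ V = 0 :=
      H.hom_eq_zero hab (H.tensor' (one_mul a) hV (D.deg_comp a))
        (H.tensor' (mul_one b) (D.deg_comp b) hV) _
    simp only [MonoidalCategory.whiskerLeft_comp, comp_whiskerRight, Category.assoc]
    rw [reassoc_of% h₁]
    simp
  calc
    _ = (∑ a, V ◁ (D.p a ≫ D.i a)) ≫ θ ≫ (D.p g ≫ D.i g) ▷ V := by
      rw [D.whiskerLeft_sum_p_i, Category.id_comp]
    _ = V ◁ (D.p g ≫ D.i g) ≫ θ ≫ (D.p g ≫ D.i g) ▷ V := by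
      rw [Preadditive.sum_comp, Finset.sum_eq_single g (fun a _ ha => key a g ha) (by simp)]
    _ = V ◁ (D.p g ≫ D.i g) ≫ θ ≫ ∑ a, (D.p a ≫ D.i a) ▷ V := by
      rw [Preadditive.comp_sum, Preadditive.comp_sum,
        Finset.sum_eq_single g (fun a _ ha => key g a ha.symm) (by simp)]
    _ = _ := by rw [D.whiskerRight_sum_p_i, Category.comp_id]

theorem RelCenter.sum_f {P : ObjectProperty C} {ι : Type*} (s : Finset ι) {X Y : RelCenter P}
    (f : ι → (X ⟶ Y)) : Hom.f (∑ a ∈ s, f a : X ⟶ Y) = ∑ a ∈ s, (f a).f := by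
  classical
  induction s using Finset.induction_on with
  | empty => simp
  | insert a s ha ih => rw [Finset.sum_insert ha, Finset.sum_insert ha, add_f, ih]

/-- The relative center is graded by the degrees of the underlying objects. -/
theorem IsGrading.relCenter (H : IsGrading deg) :
    IsGrading (E := RelCenter (deg 1)) (fun g Y => deg g Y.pt) where
  of_iso {g X Y} e h := H.of_iso ⟨e.hom.f, e.inv.f, congrArg RelCenter.Hom.f e.hom_inv_id,
    congrArg RelCenter.Hom.f e.inv_hom_id⟩ h
  hom_eq_zero hgh X Y hX hY f := RelCenter.hom_ext (H.hom_eq_zero hgh hX hY f.f)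
  tensor hX hY := H.tensor hX hY
  decomposition Y := by
    obtain ⟨D⟩ := H.decomposition Y.pt
    have comm g V hV := H.comp_p_i_comm D (V := V) hV (Y.γ V hV).hom g
    exact ⟨{
      comp := fun g => Y.retract (D.i g) (D.p g) (D.i_p g) (comm g)
      deg_comp := D.deg_comp
      p := fun g =>
        { f := D.p g
          comm := fun V hV => by
            dsimp only
            have h₁ : D.p g ≫ D.i g ≫ D.p g = D.p g := by rw [D.i_p, Category.comp_id]
            rw [← MonoidalCategory.whiskerLeft_comp_assoc, ← reassoc_of% (comm g V hV),
              ← comp_whiskerRight, Category.assoc, h₁] }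
      i := fun g =>
        { f := D.i g
          comm := fun V hV => by
            dsimp only
            have h₁ : D.i g ≫ D.p g ≫ D.i g = D.i g := by
              rw [← Category.assoc, D.i_p, Category.id_comp]
            rw [Category.assoc, Category.assoc, ← comp_whiskerRight, comm g V hV,
              ← MonoidalCategory.whiskerLeft_comp_assoc, h₁] }
      i_p := fun g => RelCenter.hom_ext (D.i_p g)
      sum_p_i := RelCenter.hom_ext (by
        rw [RelCenter.sum_f]
        exact D.sum_p_i) }⟩

end

section

variable {G : Type*} [Group G] [Fintype G] {C : Type u} [Category.{v} C]
    [Preadditive C] [MonoidalCategory C] {deg : G → ObjectProperty C}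

namespace Twist

variable {g h l : G} {Y Y' B B' : RelCenter (deg 1)}

/-- The form of `Twist.Over.unique` in which the two morphisms below need only be equal, rather than
syntactically the same. -/
theorem Over.eq (H : SplitGrading deg) {t : Twist deg g Y B} {t' : Twist deg g Y' B'}
    {f f' : Y ⟶ Y'} {F F' : B ⟶ B'} (h₁ : Over t t' f F) (h₂ : Over t t' f' F')
    (h : f = f' := by simp) : F = F' := by
  subst h; exact h₁.unique H h₂

theorem Over.add [MonoidalPreadditive C] {t : Twist deg g Y B} {t' : Twist deg g Y' B'}
    {f f' : Y ⟶ Y'} {F F' : B ⟶ B'} (h₁ : Over t t' f F) (h₂ : Over t t' f' F') :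
    Over t t' (f + f') (F + F') := fun X hX => by simp [h₁ X hX, h₂ X hX]

theorem Over.smul [MonoidalPreadditive C] {k : Type*} [Field k] [Linear k C] [MonoidalLinear k C]
    {t : Twist deg g Y B} {t' : Twist deg g Y' B'}
    {f : Y ⟶ Y'} {F : B ⟶ B'} (r : k) (h₁ : Over t t' f F) :
    Over t t' (r • f) (r • F) := fun X hX => by
  have e₁ : (r • f).f = r • f.f := rfl
  have e₂ : (r • F).f = r • F.f := rfl
  simp [h₁ X hX, e₁, e₂]

/-- The map `b` of a twist at an object of the relative center is a morphism there. -/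
def braiding (t : Twist deg g Y B) (X : RelCenter (deg 1)) (hX : deg g X.pt)
    (hl : ∀ V, deg 1 V → deg g (V ⊗ X.pt)) (hr : ∀ V, deg 1 V → deg g (X.pt ⊗ V)) :
    X ⊗ Y ≅ B ⊗ X :=
  RelCenter.isoMk (t.b X.pt hX) fun V hV => by
    have h₁ := t.nat (hl V hV) (hr V hV) (X.γ V hV).hom
    rw [t.left V X.pt hV hX, t.right X.pt V hX hV] at h₁
    rw [RelCenter.tensorObj_γ_hom, RelCenter.tensorObj_γ_hom, ← cancel_epi (α_ V X.pt Y.pt).hom,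
      ← cancel_mono (α_ B.pt X.pt V).hom]
    simpa using h₁

end Twist

/-! ### The action on the relative center -/

namespace SplitGrading

variable (H : SplitGrading deg)

section

variable [IsIdempotentComplete C]

/-- The action of `g` on the relative center, sending `Y` to the target of a chosen twist of `Y` by
`g`, and `f` to the unique morphism over `f`. -/
noncomputable def conjFunctor (g : G) : RelCenter (deg 1) ⥤ RelCenter (deg 1) where
  obj Y := (H.exists_twist g Y).choose
  map {Y Y'} f := Twist.lift H (H.exists_twist g Y).choose_spec.some
    (H.exists_twist g Y').choose_spec.some f
  map_id _ := (Twist.over_lift H _ _ _).eq H (Twist.Over.refl _) rfl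
  map_comp f f' := (Twist.over_lift H _ _ _).eq H
    ((Twist.over_lift H _ _ f).comp (Twist.over_lift H _ _ f')) rfl

/-- The chosen twist of `Y` by `g`. -/
noncomputable def twist (g : G) (Y : RelCenter (deg 1)) :
    Twist deg g Y ((H.conjFunctor g).obj Y) :=
  (H.exists_twist g Y).choose_spec.some

theorem over_map (g : G) {Y Y' : RelCenter (deg 1)} (f : Y ⟶ Y') :
    Twist.Over (H.twist g Y) (H.twist g Y') f ((H.conjFunctor g).map f) :=
  Twist.over_lift H _ _ f

instance [MonoidalPreadditive C] (g : G) : (H.conjFunctor g).Additive where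
  map_add {_ _ f f'} := (H.over_map g _).eq H ((H.over_map g f).add (H.over_map g f')) rfl

instance [MonoidalPreadditive C] {k : Type*} [Field k] [Linear k C] [MonoidalLinear k C] (g : G) :
    (H.conjFunctor g).Linear k where
  map_smul f r := (H.over_map g _).eq H ((H.over_map g f).smul r) rfl

/-- The unit constraint of the action functors, the isomorphism over the identity of the unit. -/
noncomputable def conjUnitIso (g : G) :
    𝟙_ (RelCenter (deg 1)) ≅ (H.conjFunctor g).obj (𝟙_ (RelCenter (deg 1))) :=
  Twist.liftIso H (Twist.unit deg g) (H.twist g _)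

/-- The tensor constraint of the action functors, the isomorphism over the identity of `Y ⊗ Z`. -/
noncomputable def conjTensorIso (g : G) (Y Z : RelCenter (deg 1)) :
    (H.conjFunctor g).obj Y ⊗ (H.conjFunctor g).obj Z ≅ (H.conjFunctor g).obj (Y ⊗ Z) :=
  Twist.liftIso H ((H.twist g Y).tensor (H.twist g Z)) (H.twist g _)

theorem over_conjUnitIso_hom (g : G) :
    Twist.Over (Twist.unit deg g) (H.twist g _) (𝟙 _) (H.conjUnitIso g).hom :=
  Twist.over_lift H _ _ _

theorem over_conjTensorIso_hom (g : G) (Y Z : RelCenter (deg 1)) :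
    Twist.Over ((H.twist g Y).tensor (H.twist g Z)) (H.twist g _) (𝟙 _)
      (H.conjTensorIso g Y Z).hom :=
  Twist.over_lift H _ _ _

theorem over_conjTensorIso_inv (g : G) (Y Z : RelCenter (deg 1)) :
    Twist.Over (H.twist g _) ((H.twist g Y).tensor (H.twist g Z)) (𝟙 _)
      (H.conjTensorIso g Y Z).inv :=
  Twist.over_lift H _ _ _

/-- The monoidal structure of the action functors. In each coherence identity both sides lie over
the same morphism. -/
noncomputable def conjCoreMonoidal (g : G) : (H.conjFunctor g).CoreMonoidal where
  εIso := H.conjUnitIso g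
  μIso Y Z := H.conjTensorIso g Y Z
  μIso_hom_natural_left f Z := by
    rw [← tensorHom_id, ← tensorHom_id]
    exact (((H.over_map g f).tensor (Twist.Over.refl _)).comp (H.over_conjTensorIso_hom g _ _)).eq H
      ((H.over_conjTensorIso_hom g _ _).comp (H.over_map g _))
  μIso_hom_natural_right Z f := by
    rw [← id_tensorHom, ← id_tensorHom]
    exact (((Twist.Over.refl _).tensor (H.over_map g f)).comp (H.over_conjTensorIso_hom g _ _)).eq H
      ((H.over_conjTensorIso_hom g _ _).comp (H.over_map g _))
  associativity X Y Z := by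
    rw [← tensorHom_id, ← id_tensorHom]
    exact (((H.over_conjTensorIso_hom g X Y).tensor (Twist.Over.refl _)).comp
      ((H.over_conjTensorIso_hom g _ _).comp (H.over_map g (α_ X Y Z).hom))).eq H
      ((Twist.Over.associator _ _ _).comp (((Twist.Over.refl _).tensor
        (H.over_conjTensorIso_hom g Y Z)).comp (H.over_conjTensorIso_hom g _ _)))
  left_unitality X := by
    rw [← tensorHom_id]
    exact (Twist.Over.leftUnitor (H.twist g X)).eq H (((H.over_conjUnitIso_hom g).tensor
      (Twist.Over.refl _)).comp ((H.over_conjTensorIso_hom g _ _).comp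
        (H.over_map g (λ_ X).hom)))
  right_unitality X := by
    rw [← id_tensorHom]
    exact (Twist.Over.rightUnitor (H.twist g X)).eq H (((Twist.Over.refl _).tensor
      (H.over_conjUnitIso_hom g)).comp ((H.over_conjTensorIso_hom g _ _).comp
        (H.over_map g (ρ_ X).hom)))

end
end SplitGrading

theorem Twist.Over.symm {g : G} {Y B : RelCenter (deg 1)} {t t' : Twist deg g Y B}
    (h : Over t t' (𝟙 Y) (𝟙 B)) : Over t' t (𝟙 Y) (𝟙 B) := fun X hX => by
  have := h X hX
  simp at this
  simp [this]

theorem Twist.Over.precomp {g : G} {Y Y' B B' : RelCenter (deg 1)} {t t₀ : Twist deg g Y B}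
    {t' : Twist deg g Y' B'} {f : Y ⟶ Y'} {F : B ⟶ B'} (h : Over t t₀ (𝟙 Y) (𝟙 B))
    (h' : Over t₀ t' f F) : Over t t' f F := by
  simpa using h.comp h'

theorem Twist.Over.postcomp {g : G} {Y Y' B B' : RelCenter (deg 1)} {t : Twist deg g Y B}
    {t₀ t' : Twist deg g Y' B'} {f : Y ⟶ Y'} {F : B ⟶ B'} (h : Over t t₀ f F)
    (h' : Over t₀ t' (𝟙 Y') (𝟙 B')) : Over t t' f F := by
  simpa using h.comp h'

namespace SplitGrading

variable (H : SplitGrading deg) [IsIdempotentComplete C]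

noncomputable instance (g : G) : (H.conjFunctor g).Monoidal := (H.conjCoreMonoidal g).toMonoidal

theorem conjFunctor_ε (g : G) :
    Functor.LaxMonoidal.ε (H.conjFunctor g) = (H.conjUnitIso g).hom := rfl

theorem conjFunctor_μ (g : G) (Y Z : RelCenter (deg 1)) :
    Functor.LaxMonoidal.μ (H.conjFunctor g) Y Z = (H.conjTensorIso g Y Z).hom := rfl

/-- The isomorphism from the composite of the actions of `h` and `g` to the action of `g * h`. The
equation `e` avoids transports along identities in `G`. -/
noncomputable def conjComp {g h l : G} (e : g * h = l) :
    H.conjFunctor h ⋙ H.conjFunctor g ≅ H.conjFunctor l :=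
  NatIso.ofComponents (fun Y => Twist.liftIso H
    (Twist.comp H e (H.twist g ((H.conjFunctor h).obj Y)) (H.twist h Y)) (H.twist l Y)) fun f =>
      ((Twist.Over.comp_comp H e (H.over_map g _) (H.over_map h f)).comp
        (Twist.over_lift H _ _ _)).eq H ((Twist.over_lift H _ _ _).comp (H.over_map l f))

theorem over_conjComp {g h l : G} (e : g * h = l) (Y : RelCenter (deg 1)) :
    Twist.Over (Twist.comp H e (H.twist g ((H.conjFunctor h).obj Y)) (H.twist h Y)) (H.twist l Y)
      (𝟙 Y) ((H.conjComp e).hom.app Y) := Twist.over_lift H _ _ _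

/-- The action of the neutral element is isomorphic to the identity, since the central structure of
`Y` is a twist of `Y` by the trivial degree. -/
noncomputable def conjOne : H.conjFunctor 1 ≅ 𝟭 (RelCenter (deg 1)) :=
  NatIso.ofComponents (fun Y => Twist.liftIso H (H.twist 1 Y) (Twist.refl Y)) fun f =>
    ((H.over_map 1 f).comp (Twist.over_lift H _ _ _)).eq H
      ((Twist.over_lift H _ _ _).comp (Twist.Over.of_hom f))

theorem over_conjOne (Y : RelCenter (deg 1)) :
    Twist.Over (H.twist 1 Y) (Twist.refl Y) (𝟙 Y) (H.conjOne.hom.app Y) :=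
  Twist.over_lift H _ _ _

/-- The action of `G` on the relative center. -/
noncomputable def groupAction [MonoidalPreadditive C] (k : Type*) [Field k] [Linear k C]
    [MonoidalLinear k C] : GroupAction k G (RelCenter (deg 1)) where
  T := H.conjFunctor
  additive _ := inferInstance
  linear _ := inferInstance
  monoidal _ := inferInstance
  γ := H.conjComp
  ι := H.conjOne
  γ_monoidal {g h l} e :=
    { unit := by
        rw [Functor.LaxMonoidal.comp_ε, Category.assoc, conjFunctor_ε, conjFunctor_ε, conjFunctor_ε]
        have h₁ := (H.over_conjUnitIso_hom g).comp (H.over_map g (H.conjUnitIso h).hom)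
        rw [Category.id_comp] at h₁
        have h₂ := (Twist.Over.comp_unit H e).symm.precomp
          ((Twist.Over.comp_comp H e h₁ (H.over_conjUnitIso_hom h)).comp (H.over_conjComp e _))
        rw [Category.assoc] at h₂
        exact h₂.eq H (H.over_conjUnitIso_hom l)
      tensor := fun X Y => by
        rw [Functor.LaxMonoidal.comp_μ, Category.assoc, conjFunctor_μ, conjFunctor_μ, conjFunctor_μ]
        have h₁ := (H.over_conjTensorIso_hom g ((H.conjFunctor h).obj X)
          ((H.conjFunctor h).obj Y)).comp (H.over_map g (H.conjTensorIso h X Y).hom)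
        rw [Category.id_comp] at h₁
        have h₂ := (Twist.Over.comp_tensor H e _ _ _ _).symm.precomp
          ((Twist.Over.comp_comp H e h₁ (H.over_conjTensorIso_hom h X Y)).comp
            (H.over_conjComp e _))
        rw [Category.assoc] at h₂
        exact h₂.eq H (((H.over_conjComp e X).tensor (H.over_conjComp e Y)).comp
          (H.over_conjTensorIso_hom l X Y)) }
  ι_monoidal :=
    { unit := by
        exact ((H.over_conjUnitIso_hom 1).comp (H.over_conjOne _)).eq H Twist.Over.unit_refl
      tensor := fun X Y => by
        exact ((H.over_conjTensorIso_hom 1 X Y).comp (H.over_conjOne _)).eq H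
          (((H.over_conjOne X).tensor (H.over_conjOne Y)).comp (Twist.Over.refl_tensor X Y)) }
  assoc {g h l a b c} e₁ e₂ e₃ e₄ X := by
    have h₁ := (Twist.Over.comp_comp H e₃ (H.over_conjComp e₁ ((H.conjFunctor l).obj X))
      (Twist.Over.refl (H.twist l X))).comp (H.over_conjComp e₃ X)
    have h₂ := (Twist.Over.assoc H e₁ e₂ e₃ e₄ (H.twist g _) (H.twist h _) (H.twist l X)).precomp
      ((Twist.Over.comp_comp H e₄ (H.over_map g _) (H.over_conjComp e₂ X)).comp
        (H.over_conjComp e₄ X))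
    exact h₁.eq H h₂
  unit_left g X := by
    have h₁ := (Twist.Over.comp_comp H (one_mul g) (H.over_conjOne ((H.conjFunctor g).obj X))
      (Twist.Over.refl (H.twist g X))).postcomp (Twist.Over.refl_comp H (H.twist g X))
    exact (H.over_conjComp (one_mul g) X).eq H h₁ rfl
  unit_right g X := by
    have h₁ := (Twist.Over.comp_comp H (mul_one g) (H.over_map g _) (H.over_conjOne X)).postcomp
      (Twist.Over.comp_refl H (H.twist g X))
    exact (H.over_conjComp (mul_one g) X).eq H h₁ rfl

/-! ### Existence of the canonical structure -/

/-- The unit is a retract of `P g ⊗ Q g`, so that the degree of the target `B` of a twist of `Y` by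
`g` can be read off from `B ⊗ (P g ⊗ Q g) ≅ (P g ⊗ Y) ⊗ Q g`. -/
theorem deg_conj (g : G) {h : G} {Y : RelCenter (deg 1)} (hY : deg h Y.pt) :
    deg (g * h * g⁻¹) ((H.conjFunctor g).obj Y).pt := by
  have e := whiskerRightIso ((H.twist g Y).b (H.P g) (H.deg_P g)) (H.Q g) ≪≫ α_ _ _ _
  have h₁ : deg (g * h * g⁻¹) (((H.conjFunctor g).obj Y).pt ⊗ (H.P g ⊗ H.Q g)) :=
    H.of_iso e (H.tensor (H.tensor (H.deg_P g) hY) (H.deg_Q g))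
  refine H.of_retract h₁ ((ρ_ _).inv ≫ _ ◁ H.η g) (_ ◁ H.r g ≫ (ρ_ _).hom) ?_
  rw [Category.assoc, ← MonoidalCategory.whiskerLeft_comp_assoc, H.η_r]
  simp

/-- The `G`-braiding of the relative center: the chosen twist of `Y` evaluated at an object
underlying an object of the relative center. -/
noncomputable def crossedBraiding {g : G} (X Y : RelCenter (deg 1)) (hX : deg g X.pt) :
    X ⊗ Y ≅ (H.conjFunctor g).obj Y ⊗ X :=
  (H.twist g Y).braiding X hX (fun _ hV => H.tensor_left hV hX) (fun _ hV => H.tensor_right hX hV)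

@[simp] theorem crossedBraiding_hom_f {g : G} (X Y : RelCenter (deg 1)) (hX : deg g X.pt) :
    (H.crossedBraiding X Y hX).hom.f = ((H.twist g Y).b X.pt hX).hom := rfl

theorem twist_tensor_right {g : G} (X : C) (Y Z : RelCenter (deg 1)) (hX : deg g X) :
    (α_ X Y.pt Z.pt).hom ≫ ((H.twist g (Y ⊗ Z)).b X hX).hom ≫ (H.conjTensorIso g Y Z).inv.f ▷ X ≫
        (α_ ((H.conjFunctor g).obj Y).pt ((H.conjFunctor g).obj Z).pt X).hom =
      ((H.twist g Y).b X hX).hom ▷ Z.pt ≫ (α_ ((H.conjFunctor g).obj Y).pt X Z.pt).hom ≫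
        ((H.conjFunctor g).obj Y).pt ◁ ((H.twist g Z).b X hX).hom := by
  have h₁ := H.over_conjTensorIso_inv g Y Z X hX
  rw [← reassoc_of% h₁]
  simp

theorem twist_tensor_left {g h : G} (X X' : C) (Y : RelCenter (deg 1)) (hX : deg g X)
    (hX' : deg h X') (hXX' : deg (g * h) (X ⊗ X')) :
    ((H.twist (g * h) Y).b (X ⊗ X') hXX').hom =
      (α_ X X' Y.pt).hom ≫ X ◁ ((H.twist h Y).b X' hX').hom ≫
        (α_ X ((H.conjFunctor h).obj Y).pt X').inv ≫
        ((H.twist g ((H.conjFunctor h).obj Y)).b X hX).hom ▷ X' ≫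
          (α_ ((H.conjFunctor g).obj ((H.conjFunctor h).obj Y)).pt X X').hom ≫
            ((H.conjComp (rfl : g * h = g * h)).hom.app Y).f ▷ (X ⊗ X') := by
  have h₁ := H.over_conjComp (rfl : g * h = g * h) Y (X ⊗ X') hXX'
  rw [Twist.comp_b_hom H _ _ _ X X' hX hX'] at h₁
  simpa using h₁

/-- Compatibility of the `G`-braiding with the action. After tensoring with `W` of degree `g` on the
right and twisting both factors past `W`, it is the naturality of the twist of `Y` by `g * h` with
respect to the twist `W ⊗ X ⟶ T g X ⊗ W` of `X` by `g`. -/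
theorem twist_conj {g h : G} (X Y : RelCenter (deg 1)) (hX : deg h X.pt) :
    ((H.twist (g * h * g⁻¹) ((H.conjFunctor g).obj Y)).b ((H.conjFunctor g).obj X).pt
        (H.deg_conj g hX)).hom ≫
      ((H.conjComp (inv_mul_cancel_right (g * h) g)).hom.app Y).f ▷ ((H.conjFunctor g).obj X).pt =
    (H.conjTensorIso g X Y).hom.f ≫ ((H.conjFunctor g).map (H.crossedBraiding X Y hX).hom).f ≫
      (H.conjTensorIso g ((H.conjFunctor h).obj Y) X).inv.f ≫
        ((H.conjComp (rfl : g * h = g * h)).hom.app Y).f ▷ ((H.conjFunctor g).obj X).pt := by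
  refine ((H.twist g X).tensor (H.twist g Y)).hom_ext H fun W hW => ?_
  let κ : (H.conjFunctor g).obj ((H.conjFunctor h).obj Y) ⟶ (H.conjFunctor (g * h)).obj Y :=
    (H.conjComp (rfl : g * h = g * h)).hom.app Y
  have hA := H.deg_conj g hX
  have hWX : deg (g * h) (W ⊗ X.pt) := H.tensor hW hX
  have hAW : deg (g * h) (((H.conjFunctor g).obj X).pt ⊗ W) :=
    H.tensor' (inv_mul_cancel_right (g * h) g) hA hW
  have e₁ := ((H.over_conjTensorIso_hom g X Y).comp ((H.over_map g
    (H.crossedBraiding X Y hX).hom).comp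
      (H.over_conjTensorIso_inv g ((H.conjFunctor h).obj Y) X))) W hW
  have e₂ := H.over_conjComp (inv_mul_cancel_right (g * h) g) Y _ hAW
  rw [Twist.comp_b_hom H _ _ _ _ W hA hW, RelCenter.id_f, MonoidalCategory.whiskerLeft_id,
    Category.id_comp] at e₂
  have e₃ := (H.twist (g * h) Y).nat hWX hAW ((H.twist g X).b W hW).hom
  rw [H.twist_tensor_left W X.pt Y hW hX, e₂] at e₃
  simp only [RelCenter.comp_f, Category.id_comp, Category.comp_id,
    crossedBraiding_hom_f] at e₁
  have e₄ : W ◁ ((H.twist h Y).b X.pt hX).hom ≫ (((H.twist g ((H.conjFunctor h).obj Y)).tensor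
      (H.twist g X)).b W hW).hom ≫ κ.f ▷ ((H.conjFunctor g).obj X).pt ▷ W =
      (((H.twist g X).tensor (H.twist g Y)).b W hW).hom ≫ ((H.conjTensorIso g X Y).hom.f ≫
        ((H.conjFunctor g).map (H.crossedBraiding X Y hX).hom).f ≫
          (H.conjTensorIso g ((H.conjFunctor h).obj Y) X).inv.f ≫
            κ.f ▷ ((H.conjFunctor g).obj X).pt) ▷ W := by
    rw [reassoc_of% e₁]
    simp
  refine Eq.trans ?_ e₄
  simp only [Twist.tensor_b, Iso.trans_hom, Iso.symm_hom, whiskerRightIso_hom, whiskerLeftIso_hom,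
    RelCenter.tensorObj_pt]
  calc
    _ = (α_ W X.pt Y.pt).inv ≫ (((H.twist g X).b W hW).hom ▷ Y.pt ≫
        ((α_ _ W Y.pt).hom ≫ ((H.conjFunctor g).obj X).pt ◁ ((H.twist g Y).b W hW).hom ≫
          (α_ _ _ W).inv ≫ ((H.twist (g * h * g⁻¹) ((H.conjFunctor g).obj Y)).b
            ((H.conjFunctor g).obj X).pt hA).hom ▷ W ≫ (α_ _ _ W).hom) ≫
            ((H.conjComp (inv_mul_cancel_right (g * h) g)).hom.app Y).f ▷ _) ≫
              (α_ _ _ W).inv := by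
      monoidal
    _ = _ := by
      rw [e₃]
      change (α_ W X.pt Y.pt).inv ≫ (((α_ W X.pt Y.pt).hom ≫ W ◁ ((H.twist h Y).b X.pt hX).hom ≫
        (α_ W ((H.conjFunctor h).obj Y).pt X.pt).inv ≫
          ((H.twist g ((H.conjFunctor h).obj Y)).b W hW).hom ▷ X.pt ≫
            (α_ ((H.conjFunctor g).obj ((H.conjFunctor h).obj Y)).pt W X.pt).hom ≫
              κ.f ▷ (W ⊗ X.pt)) ≫ _) ≫ _ = _
      clear_value κ
      calc
        _ = 𝟙 _ ⊗≫ W ◁ ((H.twist h Y).b X.pt hX).hom ⊗≫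
            ((H.twist g ((H.conjFunctor h).obj Y)).b W hW).hom ▷ X.pt ⊗≫
            (κ.f ▷ (W ⊗ X.pt) ≫ _ ◁ ((H.twist g X).b W hW).hom) ⊗≫ 𝟙 _ := by monoidal
        _ = _ := by rw [← whisker_exchange]; monoidal

end SplitGrading

theorem SplitGrading.nonempty_canonicalGCrossed (H : SplitGrading deg) [IsIdempotentComplete C]
    [MonoidalPreadditive C] (k : Type*) [Field k] [Linear k C] [MonoidalLinear k C] :
    Nonempty (CanonicalGCrossed k deg) :=
  ⟨{ H.groupAction k with
      grading := H.toIsGrading.relCenter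
      deg_T := fun g _ _ hX => H.deg_conj g hX
      c := fun X Y hX => H.crossedBraiding X Y hX
      c_naturality_left := fun hX hX' f Y => RelCenter.hom_ext ((H.twist _ Y).nat hX hX' f.f)
      c_naturality_right := fun X hX _ _ f => RelCenter.hom_ext (H.over_map _ f X.pt hX)
      c_T := fun X Y hX => RelCenter.hom_ext (H.twist_conj X Y hX)
      c_tensor_right := fun X Y Z hX => RelCenter.hom_ext (H.twist_tensor_right X.pt Y Z hX)
      c_tensor_left := fun X Y Z hX hY =>
        RelCenter.hom_ext (H.twist_tensor_left X.pt Y.pt Z hX hY _)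
      b := fun X Y hX => (H.twist _ Y).b X hX
      b_naturality_left := fun hX hX' f Y => (H.twist _ Y).nat hX hX' f
      b_naturality_right := fun X hX _ _ f => H.over_map _ f X hX
      b_left := fun V X Y hV hX hVX => (H.twist _ Y).left V X hV hX hVX
      b_right := fun X V Y hX hV hXV => (H.twist _ Y).right X V hX hV hXV
      b_tensor_right := fun X Y Z hX => H.twist_tensor_right X Y Z hX
      b_tensor_left := fun X X' Y hX hX' hXX' => H.twist_tensor_left X X' Y hX hX' hXX'
      c_eq_b := fun _ _ _ => rfl }⟩

end

/-! ### Faithful gradings of fusion categories -/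

section

variable {G : Type*} [Group G] [Fintype G] {C : Type u} [Category.{v} C]
    [Abelian C] [MonoidalCategory C] {deg : G → ObjectProperty C}

/-- The simple unit object is homogeneous, of a degree which is an idempotent of `G` because the
unit is isomorphic to its tensor square. -/
theorem IsGrading.deg_one_unit [MonoidalPreadditive C] (H : IsGrading deg) [Simple (𝟙_ C)] :
    deg 1 (𝟙_ C) := by
  obtain ⟨D⟩ := H.decomposition (𝟙_ C)
  have h₀ : (𝟙 (𝟙_ C)) ≠ 0 := id_nonzero _
  obtain ⟨g, hg⟩ : ∃ g, D.p g ≫ D.i g ≠ 0 := by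
    by_contra! h
    exact h₀ (by rw [← D.sum_p_i]; exact Finset.sum_eq_zero fun g _ => h g)
  have : IsIso (D.p g ≫ D.i g) := isIso_of_hom_simple hg
  have h₁ : D.p g ≫ D.i g = 𝟙 _ := by
    rw [← cancel_epi (D.p g ≫ D.i g), Category.assoc, ← Category.assoc (D.i g), D.i_p]
    simp
  have h₂ : deg g (𝟙_ C) := H.of_retract (D.deg_comp g) (D.p g) (D.i g) h₁
  have h₃ : deg (g * g) (𝟙_ C) := H.of_iso (λ_ _) (H.tensor h₂ h₂)
  have h₄ : g = g * g := by
    by_contra hne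
    exact h₀ (H.hom_eq_zero hne h₂ h₃ _)
  rwa [left_eq_mul.mp h₄] at h₂

/-- A nonzero morphism from the simple unit into a direct sum of simple objects is a split
monomorphism. -/
theorem exists_retraction_of_ne_zero {k : Type*} [Field k] [Linear k C] [IsFusionCategory k C]
    {X : C} (f : 𝟙_ C ⟶ X) (hf : f ≠ 0) : ∃ r : X ⟶ 𝟙_ C, f ≫ r = 𝟙 _ := by
  have := IsFusionCategory.simple_unit k (C := C)
  obtain ⟨n, S, hS, b, ⟨hb⟩, ⟨e⟩⟩ := IsFusionCategory.semisimple k X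
  obtain ⟨i, hi⟩ : ∃ i, f ≫ e.inv ≫ b.π i ≠ 0 := by
    by_contra! h
    have h₁ : f ≫ e.inv = 0 := hb.isLimit.hom_ext fun ⟨j⟩ => by simpa using h j
    exact hf (by rw [← cancel_mono e.inv, h₁, zero_comp])
  have := hS i
  have : IsIso (f ≫ e.inv ≫ b.π i) := isIso_of_hom_simple hi
  exact ⟨e.inv ≫ b.π i ≫ CategoryTheory.inv (f ≫ e.inv ≫ b.π i), by
    have := IsIso.hom_inv_id (f ≫ e.inv ≫ b.π i)
    simpa only [Category.assoc] using this⟩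

/-- The coevaluation of a nonzero homogeneous `X` is nonzero, hence split, and it factors through
the component of degree `g⁻¹` of the dual of `X`. -/
theorem IsGrading.exists_unit_retract {k : Type*} [Field k] [Linear k C] [IsFusionCategory k C]
    [MonoidalPreadditive C] [RigidCategory C] (H : IsGrading deg) {g : G} {X : C} (hX : deg g X)
    (hX₀ : ¬ IsZero X) : ∃ (Q : C) (_ : deg g⁻¹ Q) (η : 𝟙_ C ⟶ X ⊗ Q) (r : X ⊗ Q ⟶ 𝟙_ C),
      η ≫ r = 𝟙 _ := by
  have := IsFusionCategory.simple_unit k (C := C)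
  have h₁ : η_ X Xᘁ ≠ 0 := fun h => hX₀ (by
    have h₂ := ExactPairing.evaluation_coevaluation X Xᘁ
    rw [h, MonoidalPreadditive.zero_whiskerRight, zero_comp] at h₂
    rw [IsZero.iff_id_eq_zero, ← cancel_epi (λ_ X).hom, ← cancel_mono (ρ_ X).inv]
    simpa using h₂.symm)
  obtain ⟨r, hr⟩ := exists_retraction_of_ne_zero (k := k) _ h₁
  obtain ⟨D⟩ := H.decomposition (Xᘁ)
  refine ⟨D.comp g⁻¹, D.deg_comp _, η_ X Xᘁ ≫ X ◁ D.p g⁻¹, X ◁ D.i g⁻¹ ≫ r, ?_⟩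
  have h₃ : η_ X Xᘁ ≫ X ◁ (D.p g⁻¹ ≫ D.i g⁻¹) = η_ X Xᘁ := by
    conv_rhs => rw [← Category.comp_id (η_ X Xᘁ), ← D.whiskerLeft_sum_p_i X, Preadditive.comp_sum]
    rw [Finset.sum_eq_single g⁻¹]
    · intro h _ hh
      have h₄ : η_ X Xᘁ ≫ X ◁ D.p h = 0 :=
        H.hom_eq_zero (fun e => hh (eq_inv_of_mul_eq_one_right e.symm)) H.deg_one_unit
          (H.tensor hX (D.deg_comp h)) _
      rw [MonoidalCategory.whiskerLeft_comp, reassoc_of% h₄, zero_comp]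
    · simp
  rw [Category.assoc, ← MonoidalCategory.whiskerLeft_comp_assoc, reassoc_of% h₃, hr]

theorem IsGrading.nonempty_splitGrading (k : Type*) [Field k] [Linear k C] [IsFusionCategory k C]
    [MonoidalPreadditive C] [RigidCategory C] (H : IsGrading deg)
    (hf : ∀ g, ∃ X, deg g X ∧ ¬ IsZero X) : Nonempty (SplitGrading deg) := by
  choose P hP hP₀ using hf
  choose Q hQ η r hr using fun g => H.exists_unit_retract (k := k) (hP g) (hP₀ g)
  exact ⟨{ H with P := P, Q := Q, deg_P := hP, deg_Q := hQ, η := η, r := r, η_r := hr }⟩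

end

section

variable {G : Type*} [Group G] [Fintype G] {C : Type u} [Category.{v} C]
    [Preadditive C] [MonoidalCategory C] {deg : G → ObjectProperty C}

/-! ### Assembling half-braidings from twists -/

namespace Twist

/-- The twist obtained from a twist by composing with an isomorphism of its target. -/
@[simps] def postIso {g : G} {Y B B' : RelCenter (deg 1)} (t : Twist deg g Y B) (e : B ≅ B') :
    Twist deg g Y B' where
  b X hX := t.b X hX ≪≫ whiskerRightIso
    ⟨e.hom.f, e.inv.f, congrArg RelCenter.Hom.f e.hom_inv_id,
      congrArg RelCenter.Hom.f e.inv_hom_id⟩ X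
  nat hX hX' f := by
    simp only [Iso.trans_hom, whiskerRightIso_hom, Category.assoc]
    rw [reassoc_of% (t.nat hX hX' f), whisker_exchange]
  left V X hV hX hVX := by
    simp only [Iso.trans_hom, whiskerRightIso_hom]
    rw [t.left V X hV hX hVX]
    symm
    calc
      _ = (α_ V X Y.pt).hom ≫ V ◁ (t.b X hX).hom ⊗≫ (V ◁ e.hom.f ≫ (B'.γ V hV).hom) ▷ X ⊗≫
          𝟙 _ := by monoidal
      _ = _ := by rw [← e.hom.comm V hV]; monoidal
  right X V hX hV hXV := by
    simp only [Iso.trans_hom, whiskerRightIso_hom]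
    rw [t.right X V hX hV hXV]
    monoidal

theorem over_postIso {g : G} {Y B B' : RelCenter (deg 1)} (t : Twist deg g Y B) (e : B ≅ B') :
    Over t (t.postIso e) (𝟙 Y) e.hom := fun X hX => by simp

theorem Over.cancel {g : G} {Y B B' : RelCenter (deg 1)} {t : Twist deg g Y B}
    {t₁ t₂ : Twist deg g Y B'} {K : B ⟶ B'} (h₁ : Over t t₁ (𝟙 Y) K) (h₂ : Over t t₂ (𝟙 Y) K) :
    Over t₁ t₂ (𝟙 Y) (𝟙 B') := fun X hX => by
  have e₁ := h₁ X hX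
  have e₂ := h₂ X hX
  rw [← e₁] at e₂
  simpa using e₂

theorem Over.b_eq {g : G} {Y B : RelCenter (deg 1)} {t t' : Twist deg g Y B}
    (h : Over t t' (𝟙 Y) (𝟙 B)) (X : C) (hX : deg g X) : (t'.b X hX).hom = (t.b X hX).hom := by
  simpa using h X hX

end Twist

variable [MonoidalPreadditive C] (H : SplitGrading deg) {Y Y' : RelCenter (deg 1)}
  (s : ∀ g, Twist deg g Y Y)

/-- A chosen decomposition into homogeneous components. -/
noncomputable def SplitGrading.decomp (X : C) : Decomposition deg X := (H.decomposition X).some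

theorem SplitGrading.comp_p_i {X Z : C} {g : G} (hZ : deg g Z) (f : Z ⟶ X) :
    f ≫ (H.decomp X).p g ≫ (H.decomp X).i g = f := by
  conv_rhs => rw [← Category.comp_id f, ← (H.decomp X).sum_p_i, Preadditive.comp_sum]
  rw [Finset.sum_eq_single g]
  · intro h _ hh
    rw [← Category.assoc, H.hom_eq_zero (Ne.symm hh) hZ ((H.decomp X).deg_comp h)
      (f ≫ (H.decomp X).p h), zero_comp]
  · simp

/-- The morphism `X ⊗ Y ⟶ Y ⊗ X` which is given on the component of degree `g` of `X` by a twist of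
`Y` by `g` with target `Y` itself. -/
noncomputable def assembleHom (X : C) : X ⊗ Y.pt ⟶ Y.pt ⊗ X :=
  ∑ g, (H.decomp X).p g ▷ Y.pt ≫ ((s g).b ((H.decomp X).comp g) ((H.decomp X).deg_comp g)).hom ≫
    Y.pt ◁ (H.decomp X).i g

/-- The inverse of `assembleHom`. -/
noncomputable def assembleInv (X : C) : Y.pt ⊗ X ⟶ X ⊗ Y.pt :=
  ∑ g, Y.pt ◁ (H.decomp X).p g ≫ ((s g).b ((H.decomp X).comp g) ((H.decomp X).deg_comp g)).inv ≫
    (H.decomp X).i g ▷ Y.pt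

theorem comp_assembleHom {X Z : C} {g : G} (hZ : deg g Z) (f : Z ⟶ X) :
    f ▷ Y.pt ≫ assembleHom H s X = ((s g).b Z hZ).hom ≫ Y.pt ◁ f := by
  rw [assembleHom, Preadditive.comp_sum, Finset.sum_eq_single g]
  · rw [← comp_whiskerRight_assoc, reassoc_of% ((s g).nat hZ ((H.decomp X).deg_comp g)),
      ← MonoidalCategory.whiskerLeft_comp, Category.assoc, H.comp_p_i hZ]
  · intro h _ hh
    rw [← comp_whiskerRight_assoc, H.hom_eq_zero (Ne.symm hh) hZ
      ((H.decomp X).deg_comp h) (f ≫ (H.decomp X).p h)]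
    simp
  · simp

theorem comp_assembleInv {X Z : C} {g : G} (hZ : deg g Z) (f : Z ⟶ X) :
    Y.pt ◁ f ≫ assembleInv H s X = ((s g).b Z hZ).inv ≫ f ▷ Y.pt := by
  rw [assembleInv, Preadditive.comp_sum, Finset.sum_eq_single g]
  · have h := (s g).nat hZ ((H.decomp X).deg_comp g) (f ≫ (H.decomp X).p g)
    rw [← Iso.inv_comp_eq, ← Category.assoc, ← Iso.eq_comp_inv] at h
    rw [← MonoidalCategory.whiskerLeft_comp_assoc, ← reassoc_of% h,
      ← comp_whiskerRight, Category.assoc, H.comp_p_i hZ]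
  · intro h _ hh
    rw [← MonoidalCategory.whiskerLeft_comp_assoc, H.hom_eq_zero (Ne.symm hh) hZ
      ((H.decomp X).deg_comp h) (f ≫ (H.decomp X).p h)]
    simp
  · simp

theorem assembleHom_of_deg {X : C} {g : G} (hX : deg g X) :
    assembleHom H s X = ((s g).b X hX).hom := by
  simpa using comp_assembleHom H s hX (𝟙 X)

/-- A multiplicative family of twists of `Y`, one by each degree, with target `Y` itself, assembles
to a half-braiding of the object underlying `Y` with all objects of `C`. -/
@[reducible] noncomputable def assemble
    (hs : ∀ g h, Twist.Over (Twist.comp H rfl (s g) (s h)) (s (g * h)) (𝟙 Y) (𝟙 Y)) :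
    DrinfeldCenter C where
  pt := Y.pt
  γ X _ :=
    { hom := assembleHom H s X
      inv := assembleInv H s X
      hom_inv_id := (H.decomp X).hom_ext_right fun hZ f => by
        rw [reassoc_of% (comp_assembleHom H s hZ), comp_assembleInv H s hZ]; simp
      inv_hom_id := (H.decomp X).hom_ext_left fun hZ f => by
        rw [reassoc_of% (comp_assembleInv H s hZ), comp_assembleHom H s hZ]; simp }
  naturality {V W} _ _ f := (H.decomp V).hom_ext_right fun hZ t => by
    dsimp only
    rw [← comp_whiskerRight_assoc, comp_assembleHom H s hZ, reassoc_of% (comp_assembleHom H s hZ)]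
    simp
  monoidal V W _ _ _ := by
    dsimp only
    refine (H.decomp V).hom_ext_functor (tensorRight W ⋙ tensorRight Y.pt) fun {g V'} hV' t => ?_
    refine (H.decomp W).hom_ext_functor (tensorLeft V' ⋙ tensorRight Y.pt) fun {h W'} hW' t' => ?_
    change (V' ◁ t') ▷ Y.pt ≫ (t ▷ W) ▷ Y.pt ≫ _ = (V' ◁ t') ▷ Y.pt ≫ (t ▷ W) ▷ Y.pt ≫ _
    have e₁ := comp_assembleHom H s (H.tensor hV' hW') (V' ◁ t' ≫ t ▷ W)
    rw [comp_whiskerRight_assoc, (hs g h).b_eq, Twist.comp_b_hom H _ _ _ _ _ hV' hW'] at e₁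
    rw [e₁]
    symm
    calc
      _ = 𝟙 _ ⊗≫ V' ◁ t' ▷ Y.pt ⊗≫ (t ▷ (W ⊗ Y.pt) ≫ V ◁ assembleHom H s W) ⊗≫
          assembleHom H s V ▷ W ⊗≫ 𝟙 _ := by monoidal
      _ = 𝟙 _ ⊗≫ V' ◁ (t' ▷ Y.pt ≫ assembleHom H s W) ⊗≫
          (t ▷ Y.pt ≫ assembleHom H s V) ▷ W ⊗≫ 𝟙 _ := by
        rw [← whisker_exchange]; monoidal
      _ = 𝟙 _ ⊗≫ V' ◁ ((s h).b W' hW').hom ⊗≫ ((V' ⊗ Y.pt) ◁ t' ≫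
          ((s g).b V' hV').hom ▷ W) ⊗≫ (Y.pt ◁ t) ▷ W ⊗≫ 𝟙 _ := by
        rw [comp_assembleHom H s hW', comp_assembleHom H s hV']; monoidal
      _ = _ := by rw [whisker_exchange]; monoidal

theorem assembleHom_comm {s : ∀ g, Twist deg g Y Y} {s' : ∀ g, Twist deg g Y' Y'} {f : Y ⟶ Y'}
    (hf : ∀ g, Twist.Over (s g) (s' g) f f) (X : C) :
    assembleHom H s X ≫ f.f ▷ X = X ◁ f.f ≫ assembleHom H s' X :=
  (H.decomp X).hom_ext_right fun {g Z} hZ t => by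
    rw [reassoc_of% (comp_assembleHom H s hZ), ← whisker_exchange_assoc, comp_assembleHom H s' hZ,
      reassoc_of% (hf g Z hZ), whisker_exchange]

end

section

open Functor.LaxMonoidal Functor.OplaxMonoidal

variable {k : Type*} [Field k] {G : Type*} [Group G] [Fintype G] {C : Type u} [Category.{v} C]
    [Preadditive C] [Linear k C] [MonoidalCategory C] [MonoidalPreadditive C] [MonoidalLinear k C]
    {deg : G → ObjectProperty C}

namespace CanonicalGCrossed

variable (S : CanonicalGCrossed k deg) (H : SplitGrading deg)

/-! ### The twists of a canonical structure -/

/-- The isomorphisms `b` of a canonical structure, as twists. -/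
def twist (g : G) (Y : RelCenter (deg 1)) : Twist deg g Y ((S.T g).obj Y) where
  b X hX := S.b X Y hX
  nat hX hX' f := S.b_naturality_left hX hX' f Y
  left V X hV hX hVX := S.b_left V X Y hV hX hVX
  right X V hX hV hXV := S.b_right X V Y hX hV hXV

theorem over_map (g : G) {Y Y' : RelCenter (deg 1)} (f : Y ⟶ Y') :
    Twist.Over (S.twist g Y) (S.twist g Y') f ((S.T g).map f) :=
  fun X hX => S.b_naturality_right X hX f

/-- The tensor structure of `T g` is the one induced by `b`. -/
theorem over_δ (g : G) (Y Z : RelCenter (deg 1)) :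
    Twist.Over (S.twist g (Y ⊗ Z)) ((S.twist g Y).tensor (S.twist g Z)) (𝟙 _) (δ (S.T g) Y Z) :=
  fun X hX => by
    have h₁ := S.b_tensor_right X Y Z hX
    rw [← Iso.eq_inv_comp] at h₁
    rw [← cancel_mono (α_ ((S.T g).obj Y).pt ((S.T g).obj Z).pt X).hom]
    simpa [twist] using h₁.symm

/-- The isomorphism of `T g ∘ T h` with `T (g * h)` is the one induced by `b`. -/
theorem over_γ {g h l : G} (e : g * h = l) (Y : RelCenter (deg 1)) :
    Twist.Over (Twist.comp H e (S.twist g ((S.T h).obj Y)) (S.twist h Y)) (S.twist l Y) (𝟙 Y)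
      ((S.γ e).hom.app Y) := by
  subst e
  refine Twist.over_of_prod H rfl _ _ _ _ fun X X' hX hX' hXX' => ?_
  rw [Twist.comp_b_hom H _ _ _ X X' hX hX']
  have h₁ := S.b_tensor_left X X' Y hX hX' hXX'
  simp only [RelCenter.id_f, MonoidalCategory.whiskerLeft_id, Category.id_comp, Category.assoc]
  exact h₁

include H in
/-- The isomorphism of `T 1` with the identity is not constrained directly by `b`. The unit axiom of
the action determines it on objects of the form `T 1 Y`, and hence on all objects by naturality. -/
theorem over_ι (Y : RelCenter (deg 1)) :
    Twist.Over (S.twist 1 Y) (Twist.refl Y) (𝟙 Y) (S.ι.hom.app Y) := by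
  let ℓ (Y) := Twist.liftIso H (S.twist 1 Y) (Twist.refl Y)
  have hℓ (Y) : Twist.Over (S.twist 1 Y) (Twist.refl Y) (𝟙 Y) (ℓ Y).hom := Twist.over_lift H _ _ _
  have nat (Y Y' : RelCenter (deg 1)) (f : Y ⟶ Y') : (S.T 1).map f ≫ (ℓ Y').hom = (ℓ Y).hom ≫ f :=
    ((S.over_map 1 f).comp (hℓ Y')).eq H ((hℓ Y).comp (Twist.Over.of_hom f))
  have h₁ : S.ι.hom.app ((S.T 1).obj Y) = (ℓ ((S.T 1).obj Y)).hom := by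
    rw [← S.unit_left]
    exact (S.over_γ H (one_mul 1) Y).eq H ((Twist.Over.comp_comp H (one_mul 1) (hℓ _)
      (Twist.Over.refl _)).postcomp (Twist.Over.refl_comp H _)) rfl
  -- Naturality with respect to `Y ≅ T 1 Y` carries the comparison from `T 1 Y` to `Y`.
  have h₂ : S.ι.hom.app Y = (ℓ Y).hom := by
    rw [← cancel_mono (ℓ Y).inv]
    have h₃ : (S.T 1).map (ℓ Y).inv ≫ S.ι.hom.app _ = S.ι.hom.app Y ≫ (ℓ Y).inv :=
      S.ι.hom.naturality _
    rw [h₁] at h₃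
    exact h₃.symm.trans (nat _ _ _)
  rw [h₂]
  exact hℓ Y

include H in
/-- The unit constraint of `T g` is determined by its tensor constraint. -/
theorem over_η (g : G) : Twist.Over (S.twist g (𝟙_ _)) (Twist.unit deg g) (𝟙 _) (η (S.T g)) := by
  let e := Twist.liftIso H (S.twist g (𝟙_ _)) (Twist.unit deg g)
  have he : Twist.Over (S.twist g (𝟙_ _)) (Twist.unit deg g) (𝟙 _) e.hom := Twist.over_lift H _ _ _
  let U := (S.T g).obj (𝟙_ (RelCenter (deg 1)))
  have h₁ : (S.T g).map (λ_ (𝟙_ (RelCenter (deg 1)))).hom =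
      δ (S.T g) (𝟙_ _) (𝟙_ _) ≫ e.hom ▷ U ≫ (λ_ U).hom := by
    rw [← tensorHom_id]
    exact (S.over_map g _).eq H ((S.over_δ g _ _).comp
      ((he.tensor (Twist.Over.refl _)).comp (Twist.Over.leftUnitor _)))
  have h₂ : (S.T g).map (λ_ (𝟙_ (RelCenter (deg 1)))).hom =
      δ (S.T g) (𝟙_ _) (𝟙_ _) ≫ η (S.T g) ▷ U ≫ (λ_ U).hom := by
    rw [Functor.OplaxMonoidal.left_unitality_hom]
  have h₃ : e.hom ▷ U = η (S.T g) ▷ U := by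
    rw [← cancel_mono (λ_ U).hom, ← cancel_epi (δ (S.T g) (𝟙_ _) (𝟙_ _)), ← h₁, ← h₂]
  -- `h₃` holds after tensoring with `U`, which is isomorphic to the unit through `e`.
  have h₄ : e.hom ▷ 𝟙_ (RelCenter (deg 1)) = η (S.T g) ▷ 𝟙_ _ := by
    rw [← cancel_epi (U ◁ e.hom), whisker_exchange, whisker_exchange, h₃]
  have h₅ : e.hom = η (S.T g) := by
    have h₆ := congrArg (fun m => m ≫ (ρ_ (𝟙_ (RelCenter (deg 1)))).hom) h₄
    simp only [MonoidalCategory.rightUnitor_naturality] at h₆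
    exact (cancel_epi _).1 h₆
  rw [← h₅]
  exact he

/-! ### From equivariant objects to the Drinfeld center -/

variable {S}

/-- For an equivariant object `Y`, the composite of `b` and the equivariant structure is a twist
`X ⊗ Y ≅ Y ⊗ X` of `Y` by `g` with target `Y` itself. -/
def selfTwist (Y : Equivariantization S.toGroupAction) (g : G) : Twist deg g Y.pt Y.pt :=
  (S.twist g Y.pt).postIso (Y.u g)

theorem over_u (Y : Equivariantization S.toGroupAction) (g : G) :
    Twist.Over (S.twist g Y.pt) (selfTwist Y g) (𝟙 _) (Y.u g).hom :=
  (S.twist g Y.pt).over_postIso (Y.u g)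

/-- In an equivariant object the isomorphism attached to the neutral element is the unit isomorphism
of the action. -/
theorem u_one (Y : Equivariantization S.toGroupAction) :
    (Y.u 1).hom = S.ι.hom.app Y.pt := by
  have h₁ := Y.comm (one_mul 1)
  rw [cancel_mono] at h₁
  have h₂ := S.ι.hom.naturality (Y.u 1).hom
  rw [h₁, S.unit_left, cancel_epi] at h₂
  exact h₂.symm

include H in
theorem over_selfTwist_one (Y : Equivariantization S.toGroupAction) :
    Twist.Over (selfTwist Y 1) (Twist.refl Y.pt) (𝟙 _) (𝟙 _) :=
  (over_u Y 1).cancel (by rw [u_one]; exact S.over_ι H Y.pt)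

theorem over_selfTwist_comp (Y : Equivariantization S.toGroupAction) (g h : G) :
    Twist.Over (Twist.comp H rfl (selfTwist Y g) (selfTwist Y h)) (selfTwist Y (g * h))
      (𝟙 _) (𝟙 _) := by
  have h₁ : Twist.Over (S.twist g ((S.T h).obj Y.pt)) (selfTwist Y g) (Y.u h).hom
      ((S.T g).map (Y.u h).hom ≫ (Y.u g).hom) := by
    simpa using (S.over_map g (Y.u h).hom).comp (over_u Y g)
  refine (Twist.Over.comp_comp H rfl h₁ (over_u Y h)).cancel ?_
  rw [Y.comm rfl]
  simpa using (S.over_γ H rfl Y.pt).comp (over_u Y (g * h))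

theorem over_selfTwist_hom {Y Y' : Equivariantization S.toGroupAction} (f : Y ⟶ Y') (g : G) :
    Twist.Over (selfTwist Y g) (selfTwist Y' g) f.f f.f := fun X hX => by
  have h₁ := (S.over_map g f.f) X hX
  have h₂ := congrArg RelCenter.Hom.f (f.comm g)
  have h₃ := (over_u Y g) X hX
  have h₄ := (over_u Y' g) X hX
  simp only [RelCenter.id_f, MonoidalCategory.whiskerLeft_id, Category.id_comp,
    RelCenter.comp_f] at h₂ h₃ h₄
  rw [h₃, h₄, reassoc_of% h₁, Category.assoc, ← comp_whiskerRight, ← comp_whiskerRight, h₂]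

theorem over_selfTwist_tensor (Y Z : Equivariantization S.toGroupAction) (g : G) :
    Twist.Over ((selfTwist Y g).tensor (selfTwist Z g)) (selfTwist (Y ⊗ Z) g) (𝟙 _) (𝟙 _) := by
  have h₁ := (S.over_δ g Y.pt Z.pt).comp ((over_u Y g).tensor (over_u Z g))
  rw [id_tensorHom_id, Category.comp_id] at h₁
  exact h₁.cancel (over_u (Y ⊗ Z) g)

include H in
theorem over_selfTwist_unit (g : G) :
    Twist.Over (Twist.unit deg g)
      (selfTwist (𝟙_ (Equivariantization S.toGroupAction)) g) (𝟙 _) (𝟙 _) :=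
  (S.over_η H g).cancel (over_u (𝟙_ (Equivariantization S.toGroupAction)) g)

variable (S)

/-- The functor from the equivariantization to the Drinfeld center: the equivariant structure of `Y`
extends its central structure from the trivial component to all of `C`. -/
noncomputable def toCenter : Equivariantization S.toGroupAction ⥤ DrinfeldCenter C where
  obj Y := assemble H (selfTwist Y) (over_selfTwist_comp H Y)
  map f :=
    { f := f.f.f
      comm := fun V _ => assembleHom_comm H (over_selfTwist_hom f) V }
  map_id _ := rfl
  map_comp _ _ := rfl

theorem assembleHom_selfTwist_tensor (Y Z : Equivariantization S.toGroupAction) (V : C) :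
    assembleHom H (selfTwist (Y ⊗ Z)) V = (α_ V Y.pt.pt Z.pt.pt).inv ≫
      assembleHom H (selfTwist Y) V ▷ Z.pt.pt ≫ (α_ Y.pt.pt V Z.pt.pt).hom ≫
        Y.pt.pt ◁ assembleHom H (selfTwist Z) V ≫ (α_ Y.pt.pt Z.pt.pt V).inv := by
  refine (H.decomp V).hom_ext_right fun {g V'} hV' t => ?_
  rw [comp_assembleHom H (selfTwist (Y ⊗ Z)) hV', (over_selfTwist_tensor Y Z g).b_eq]
  simp only [Twist.tensor_b, Iso.trans_hom, Iso.symm_hom, whiskerRightIso_hom,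
    whiskerLeftIso_hom]
  have key : t ▷ (Y.pt.pt ⊗ Z.pt.pt) ≫ (α_ V Y.pt.pt Z.pt.pt).inv ≫
      assembleHom H (selfTwist Y) V ▷ Z.pt.pt ≫ (α_ Y.pt.pt V Z.pt.pt).hom ≫
        Y.pt.pt ◁ assembleHom H (selfTwist Z) V ≫ (α_ Y.pt.pt Z.pt.pt V).inv =
      ((α_ V' Y.pt.pt Z.pt.pt).inv ≫ ((selfTwist Y g).b V' hV').hom ▷ Z.pt.pt ≫
        (α_ Y.pt.pt V' Z.pt.pt).hom ≫ Y.pt.pt ◁ ((selfTwist Z g).b V' hV').hom ≫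
          (α_ Y.pt.pt Z.pt.pt V').inv) ≫ (Y.pt.pt ⊗ Z.pt.pt) ◁ t := by
    calc
      _ = 𝟙 _ ⊗≫ (t ▷ Y.pt.pt ≫ assembleHom H (selfTwist Y) V) ▷ Z.pt.pt ⊗≫
          Y.pt.pt ◁ assembleHom H (selfTwist Z) V ⊗≫ 𝟙 _ := by
        monoidal
      _ = 𝟙 _ ⊗≫ ((selfTwist Y g).b V' hV').hom ▷ Z.pt.pt ⊗≫
          Y.pt.pt ◁ (t ▷ Z.pt.pt ≫ assembleHom H (selfTwist Z) V) ⊗≫ 𝟙 _ := by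
        rw [comp_assembleHom H _ hV']; monoidal
      _ = _ := by
        rw [comp_assembleHom H _ hV']
        monoidal
  exact key.symm

theorem assembleHom_selfTwist_unit (V : C) :
    assembleHom H (selfTwist (𝟙_ (Equivariantization S.toGroupAction))) V =
      (ρ_ V).hom ≫ (λ_ V).inv := by
  refine (H.decomp V).hom_ext_right fun {g V'} hV' t => ?_
  rw [comp_assembleHom H _ hV', (over_selfTwist_unit H g).b_eq]
  simp only [Twist.unit_b, Iso.trans_hom, Iso.symm_hom]
  change ((ρ_ V').hom ≫ (λ_ V').inv) ≫ 𝟙_ C ◁ t = t ▷ 𝟙_ C ≫ (ρ_ V).hom ≫ (λ_ V).inv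
  simp

/-- The functor `toCenter` is monoidal, with the identities as structure isomorphisms. -/
noncomputable def toCenterCoreMonoidal : (S.toCenter H).CoreMonoidal where
  εIso := RelCenter.isoMk (Iso.refl (𝟙_ C)) fun V _ =>
    comp_id_whiskerRight_of_eq (S.assembleHom_selfTwist_unit H V).symm
  μIso Y Z := RelCenter.isoMk (Iso.refl (Y.pt.pt ⊗ Z.pt.pt)) fun V _ =>
    comp_id_whiskerRight_of_eq (S.assembleHom_selfTwist_tensor H Y Z V).symm
  μIso_hom_natural_left {X Y} f Z := by
    apply RelCenter.hom_ext
    change f.f.f ▷ Z.pt.pt ≫ 𝟙 (Y.pt.pt ⊗ Z.pt.pt) = 𝟙 (X.pt.pt ⊗ Z.pt.pt) ≫ f.f.f ▷ Z.pt.pt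
    simp
  μIso_hom_natural_right {X Y} Z f := by
    apply RelCenter.hom_ext
    change Z.pt.pt ◁ f.f.f ≫ 𝟙 (Z.pt.pt ⊗ Y.pt.pt) = 𝟙 (Z.pt.pt ⊗ X.pt.pt) ≫ Z.pt.pt ◁ f.f.f
    simp
  associativity X Y Z := by
    apply RelCenter.hom_ext
    change 𝟙 (X.pt.pt ⊗ Y.pt.pt) ▷ Z.pt.pt ≫ 𝟙 ((X.pt.pt ⊗ Y.pt.pt) ⊗ Z.pt.pt) ≫
        (α_ X.pt.pt Y.pt.pt Z.pt.pt).hom =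
      (α_ X.pt.pt Y.pt.pt Z.pt.pt).hom ≫ X.pt.pt ◁ 𝟙 (Y.pt.pt ⊗ Z.pt.pt) ≫
        𝟙 (X.pt.pt ⊗ Y.pt.pt ⊗ Z.pt.pt)
    simp
  left_unitality X := by
    apply RelCenter.hom_ext
    change (λ_ X.pt.pt).hom = 𝟙 (𝟙_ C) ▷ X.pt.pt ≫ 𝟙 (𝟙_ C ⊗ X.pt.pt) ≫ (λ_ X.pt.pt).hom
    simp
  right_unitality X := by
    apply RelCenter.hom_ext
    change (ρ_ X.pt.pt).hom = X.pt.pt ◁ 𝟙 (𝟙_ C) ≫ 𝟙 (X.pt.pt ⊗ 𝟙_ C) ≫ (ρ_ X.pt.pt).hom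
    simp

/-! ### The equivalence with the Drinfeld center -/

/-- The braiding of the equivariantization is the half-braiding of `toCenter Y`, by the definition
of both as a sum over homogeneous components. -/
theorem braidHom_f (X : RelCenter (deg 1)) (Y : Equivariantization S.toGroupAction) :
    (S.braidHom X Y).f = assembleHom H (selfTwist Y) X.pt := by
  rw [BraidedGCrossed.braidHom, RelCenter.sum_f]
  have h₁ (g : G) : ((S.decomp X).p g ▷ Y.pt ≫
      (S.c ((S.decomp X).comp g) Y.pt ((S.decomp X).deg_comp g)).hom ≫
        (Y.u g).hom ▷ (S.decomp X).comp g ≫ Y.pt ◁ (S.decomp X).i g).f =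
      ((S.decomp X).p g ≫ (S.decomp X).i g).f ▷ Y.pt.pt ≫ assembleHom H (selfTwist Y) X.pt := by
    rw [RelCenter.comp_f, RelCenter.comp_f ((S.decomp X).p g), comp_whiskerRight_assoc,
      comp_assembleHom H _ ((S.decomp X).deg_comp g), RelCenter.comp_f, RelCenter.comp_f, S.c_eq_b]
    simp [selfTwist, twist]
  rw [Finset.sum_congr rfl fun g _ => h₁ g, ← Preadditive.sum_comp, ← sum_whiskerRight,
    ← RelCenter.sum_f, (S.decomp X).sum_p_i]
  simp

/-- The functor `toCenter` is braided. -/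
@[reducible] noncomputable def toCenterBraided : (S.toCenter H).Braided where
  toMonoidal := (S.toCenterCoreMonoidal H).toMonoidal
  braided X Y := by
    apply RelCenter.hom_ext
    change 𝟙 (X.pt.pt ⊗ Y.pt.pt) ≫ (S.braidHom X.pt Y).f =
      assembleHom H (selfTwist Y) X.pt.pt ≫ 𝟙 (Y.pt.pt ⊗ X.pt.pt)
    rw [Category.id_comp, Category.comp_id, braidHom_f]

instance : (S.toCenter H).Additive where
  map_add := by intros; apply RelCenter.hom_ext; rfl

instance : (S.toCenter H).Linear k where
  map_smul _ _ := by apply RelCenter.hom_ext; rfl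

instance : (S.toCenter H).Faithful where
  map_injective h := by
    apply Equivariantization.hom_ext
    apply RelCenter.hom_ext
    exact (congrArg (fun φ : (S.toCenter H).obj _ ⟶ (S.toCenter H).obj _ => φ.f) h :)

instance : (S.toCenter H).Full where
  map_surjective {X Y} φ := by
    have h₁ {g : G} (V : C) (hV : deg g V) :
        ((selfTwist X g).b V hV).hom ≫ φ.f ▷ V = V ◁ φ.f ≫ ((selfTwist Y g).b V hV).hom := by
      have h := φ.comm V trivial
      change assembleHom H (selfTwist X) V ≫ φ.f ▷ V =
        V ◁ φ.f ≫ assembleHom H (selfTwist Y) V at h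
      rwa [assembleHom_of_deg H _ hV, assembleHom_of_deg H _ hV] at h
    have h₂ (Z : Equivariantization S.toGroupAction) (V : C) (hV : deg 1 V) :
        ((selfTwist Z 1).b V hV).hom = (Z.pt.γ V hV).hom :=
      ((over_selfTwist_one H Z).b_eq V hV).symm
    -- Compatibility in degree `1` is the compatibility with the central structures.
    let f : X.pt ⟶ Y.pt :=
      { f := φ.f
        comm := fun V hV => by rw [← h₂, ← h₂]; exact h₁ V hV }
    -- The equivariance of `f` is the uniqueness of morphisms over `f`.
    have h₃ (g : G) : Twist.Over (selfTwist X g) (selfTwist Y g) f f :=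
      fun V hV => (h₁ V hV).symm
    refine ⟨{ f := f, comm := fun g => ?_ }, rfl⟩
    exact ((over_u X g).comp (h₃ g)).eq H ((S.over_map g f).comp (over_u Y g))

/-! ### Essential surjectivity -/

/-- An object of the Drinfeld center as an object of the relative center of a subcategory. -/
def restrict (Z : DrinfeldCenter C) (P : ObjectProperty C) : RelCenter P where
  pt := Z.pt
  γ V _ := Z.γ V trivial
  naturality _ _ f := Z.naturality _ _ f
  monoidal V W _ _ _ := Z.monoidal V W _ _ _

/-- The half-braiding of `Z` with the objects of degree `g`, as a twist of its restriction. -/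
def restrictTwist (Z : DrinfeldCenter C) (g : G) :
    Twist deg g (restrict Z (deg 1)) (restrict Z (deg 1)) where
  b V _ := Z.γ V trivial
  nat _ _ f := Z.naturality _ _ f
  left V X _ _ _ := Z.monoidal V X _ _ _
  right X V _ _ _ := Z.monoidal X V _ _ _

theorem over_restrictTwist_comp (Z : DrinfeldCenter C) {g h l : G} (e : g * h = l) :
    Twist.Over (Twist.comp H e (restrictTwist Z g) (restrictTwist Z h)) (restrictTwist Z l)
      (𝟙 (restrict Z (deg 1))) (𝟙 _) := by
  refine Twist.over_of_prod H e _ _ _ _ fun X X' hX hX' hXX' => ?_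
  rw [Twist.comp_b_hom H _ _ _ X X' hX hX']
  have h₁ := Z.monoidal X X' trivial trivial trivial
  simp only [RelCenter.id_f, MonoidalCategory.whiskerLeft_id, id_whiskerRight, Category.id_comp,
    Category.comp_id]
  exact h₁

/-- An object of the Drinfeld center as an equivariant object. Both its half-braiding with the
objects of degree `g` and `b` are twists of its restriction by `g`; the equivariant structure is the
comparison of their targets. -/
noncomputable def ofCenter (Z : DrinfeldCenter C) : Equivariantization S.toGroupAction where
  pt := restrict Z (deg 1)
  u g := Twist.liftIso H (S.twist g _) (restrictTwist Z g)
  comm {g h l} e := by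
    have h₁ (g : G) : Twist.Over (S.twist g _) (restrictTwist Z g) (𝟙 _)
      (Twist.liftIso H (S.twist g _) (restrictTwist Z g)).hom := Twist.over_lift H _ _ _
    have h₂ : Twist.Over (S.twist g ((S.T h).obj (restrict Z (deg 1)))) (restrictTwist Z g) _ _ :=
      (S.over_map g (Twist.liftIso H (S.twist h _) (restrictTwist Z h)).hom).comp (h₁ g)
    rw [Category.comp_id] at h₂
    exact ((Twist.Over.comp_comp H e h₂ (h₁ h)).postcomp (over_restrictTwist_comp H Z e)).eq H
      ((S.over_γ H e _).comp (h₁ l))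

theorem over_selfTwist_ofCenter (Z : DrinfeldCenter C) (g : G) :
    Twist.Over (selfTwist (S.ofCenter H Z) g) (restrictTwist Z g) (𝟙 _) (𝟙 _) :=
  (over_u (S.ofCenter H Z) g).cancel (Twist.over_lift H _ _ _)

instance : (S.toCenter H).EssSurj where
  mem_essImage Z := ⟨S.ofCenter H Z, ⟨RelCenter.isoMk (Iso.refl Z.pt) fun V _ => by
    apply comp_id_whiskerRight_of_eq
    refine (H.decomp V).hom_ext_right fun {g V'} hV' t => ?_
    refine (comp_assembleHom H (selfTwist (S.ofCenter H Z)) hV' t).trans ?_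
    rw [← (S.over_selfTwist_ofCenter H Z g).b_eq V' hV']
    exact (Z.naturality trivial trivial t).symm⟩⟩

end CanonicalGCrossed
end
end GradedCenter

theorem theorem3p5 {k : Type*} [Field k] [IsAlgClosed k] [CharZero k]
    {G : Type*} [Group G] [Fintype G]
    {C : Type u} [Category.{v} C] [Abelian C] [Linear k C] [MonoidalCategory C]
    [MonoidalPreadditive C] [MonoidalLinear k C] [RigidCategory C]
    [GradedCenter.IsFusionCategory k C]
    (deg : G → ObjectProperty C) (hdeg : GradedCenter.IsGrading deg)
    (hfaithful : ∀ g : G, ∃ X : C, deg g X ∧ ¬ IsZero X) :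
    Nonempty (GradedCenter.CanonicalGCrossed k deg) ∧
      ∀ S : GradedCenter.CanonicalGCrossed k deg,
        ∃ (F : GradedCenter.Equivariantization S.toGroupAction ⥤ GradedCenter.DrinfeldCenter C)
          (_ : F.Braided), F.IsEquivalence ∧ F.Additive ∧ F.Linear k := by
  obtain ⟨H⟩ := hdeg.nonempty_splitGrading k hfaithful
  exact ⟨H.nonempty_canonicalGCrossed k, fun S =>
    ⟨S.toCenter H, S.toCenterBraided H, { }, inferInstance, inferInstance⟩⟩
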